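/- **Proposition 3.1.** Let $K=\mathbf F_q$ be a finite field, let $L_2,L_3$ be extensions of $K$ of degrees $2$ and $3$, let $Z\cong K^\times$ be the group of scalar matrices in $\mathrm{GL}_3(K)$, and let $\mathrm{PGL}_3(K)=\mathrm{GL}_3(K)/Z$. A subgroup of $\mathrm{PGL}_3(K)$ is a maximal abelian subgroup if and only if it is conjugate to one of the following groups: * (i) identifying $K^3$ with $L_3$, the cyclic group $L_3^\times/K^\times$ acting by multiplication; * (ii) identifying $K^3$ with $L_2\times K$, the group $(L_2^\times\times K^\times)/K^\times\cong L_2^\times$ acting by multiplication; * (iii) (only if $q\neq 2$) the group of invertible diagonal matrices modulo $Z$, isomorphic to $K^\times\times K^\times$; * (iv) (only if $q\neq2$) $\left\{\begin{pmatrix} r&a&0\\0&r&0\\0&0&1\end{pmatrix}: r\in K^\times, a\in K\right\}Z/Z\cong K^\times\times K$; * (v) $\left\{\begin{pmatrix} 1&a&b\\0&1&a\\0&0&1\end{pmatrix}: a,b\in K\right\}Z/Z$, isomorphic to $K^2$ if $q$ is odd and to $C_4^d$ if $q=2^d$; * (vi) $\left\{\begin{pmatrix} 1&0&b\\0&1&a\\0&0&1\end{pmatrix}: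 a,b\in K\right\}Z/Z\cong K^2$; * (vii) $\left\{\begin{pmatrix} 1&a&b\\0&1&0\\0&0&1\end{pmatrix}: a,b\in K\right\}Z/Z\cong K^2$; * (viii) (only if $q\equiv1 \pmod 3$) $\langle g,h\rangle Z/Z\cong C_3\times C_3$, where $g=\mathrm{diag}(1,\omega,\omega^2)$ with $\omega\in K$ a primitive cube root of unity and $h=\begin{pmatrix}0&0&1\\1&0&0\\0&1&0\end{pmatrix}$; * (ix) (only if $q\equiv 1\pmod 3$) identifying $K^3$ with $L_3$, the image $\cong C_3\times C_3$ in $\mathrm{PGL}_3(K)$ of the group generated by the multiplications by those $x\in L_3^\times$ with $x^3\in K^\times$ and by the Frobenius map $y\mapsto y^q$. Under the stated restrictions on $q$, no two of these nine groups are conjugate. The isomorphisms in (iii) and (iv) hold for $q=2$ as well. Moreover, for a group $G\le\mathrm{PGL}_3(K)$ call $(p,\ell)$ a *free pair* if $p$ is a point and $\ell$ a line of the projective plane $\mathbf P^2(K)$ whose stabilizers in $G$ are both trivial, and put $S_{p,\ell}=\{g\in G: g p\in\ell\}$. A *Sidon set* in an abelian group is a subset $S$ such that $xy=zw$ with $x,y,z,w\in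 S$ implies $\{x,y\}=\{z,w\}$. Let $G$ be one of the groups (i)–(v) (for every $q$). Then a free pair exists for which $S_{p,\ell}$ is a Sidon set that a group isomorphism carries to a translate of the following set; and the same holds for *every* free pair, if $q\ne2$ in cases (ii), (iii), (iv), and without restriction in cases (i), (v): * (i) (Singer) $(D\cap L_3^\times)/K^\times\subset L_3^\times/K^\times$, for any $2$-dimensional $K$-subspace $D\subset L_3$; * (ii) (Bose) $u+D\subset L_2^\times$, for any $1$-dimensional $K$-subspace $D\subset L_2$ and $u\in L_2\setminus D$; * (iii) (Hughes, Cilleruelo) $\{(x,y):x+y=1\}\subset K^\times\times K^\times$; * (iv) (Spence) $\{(x,x):x\in K^\times\}\subset K^\times\times K$; * (v) with $q$ odd (Erdős–Turán) $\{(x,x^2):x\in K\}\subset K^2$; in case (v) with $q=2^d$ even, $S_{p,\ell}$ is instead a Sidon set of size $q$ in $G\cong C_4^d$. -/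

import Mathlib

open scoped MatrixGroups Pointwise LinearAlgebra.Projectivization

namespace DesarguesSidon

noncomputable section

variable {K : Type*} [Field K]

/-- Linear automorphisms of `V`, written as invertible matrices through an identification
`e` of `V` with `K³`. -/
def toGL {V : Type*} [AddCommGroup V] [Module K V] (e : V ≃ₗ[K] (Fin 3 → K)) :
    LinearMap.GeneralLinearGroup K V →* GL (Fin 3) K :=
  (Matrix.GeneralLinearGroup.toLin.symm.toMonoidHom).comp
    (LinearMap.GeneralLinearGroup.congrLinearEquiv e).toMonoidHom

/-- The image in `PGL₃(K)` of the unit group of a 3-dimensional commutative `K`-algebra `A`,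
acting on `A ≅ K³` by multiplication. For a cubic extension `A = L` of `K` this is
`Lˣ / Kˣ`; for `A = L × K` with `L` a quadratic extension it is `(Lˣ × Kˣ) / Kˣ`. -/
def torus {A : Type*} [CommRing A] [Algebra K A] (e : A ≃ₗ[K] (Fin 3 → K)) :
    Subgroup PGL(3, K) :=
  ((Matrix.ProjGenLinGroup.mk.comp (toGL e)).comp
    (Units.map (Algebra.lmul K A : A →* Module.End K A))).range

variable (K) in
/-- The diagonal matrices, modulo scalars. -/
def diagonalGroup : Subgroup PGL(3, K) :=
  (Units.map (Matrix.diagonalRingHom (Fin 3) K : (Fin 3 → K) →* Matrix (Fin 3) (Fin 3) K)).range.map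
    Matrix.ProjGenLinGroup.mk

variable (K) in
/-- The matrices with a Jordan-type block `(r a; 0 r)` and a block `1`. -/
def blockGL : Subgroup (GL (Fin 3) K) where
  carrier := {g | ∃ r a : K, r ≠ 0 ∧ g.val = !![r, a, 0; 0, r, 0; 0, 0, 1]}
  one_mem' := ⟨1, 0, one_ne_zero, by
    ext i j; fin_cases i <;> fin_cases j <;> simp⟩
  mul_mem' := by
    rintro g h ⟨r, a, hr, hg⟩ ⟨s, b, hs, hh⟩
    refine ⟨r * s, r * b + a * s, mul_ne_zero hr hs, ?_⟩
    rw [Units.val_mul, hg, hh]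
    ext i j; fin_cases i <;> fin_cases j <;> simp [Matrix.mul_apply, Fin.sum_univ_three]
  inv_mem' := by
    rintro g ⟨r, a, hr, hg⟩
    refine ⟨r⁻¹, -(a * r⁻¹ * r⁻¹), inv_ne_zero hr, ?_⟩
    refine Units.inv_eq_of_mul_eq_one_right ?_
    rw [hg]
    ext i j; fin_cases i <;> fin_cases j <;> simp [Matrix.mul_apply, Fin.sum_univ_three, hr]
    field_simp
    ring

variable (K) in
/-- The group `blockGL K`, modulo scalars. -/
def blockGroup : Subgroup PGL(3, K) := (blockGL K).map Matrix.ProjGenLinGroup.mk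

/-- The unipotent upper triangular matrices whose superdiagonal is a multiple of `(x, y)`. -/
def unipotentGL (x y : K) : Subgroup (GL (Fin 3) K) where
  carrier := {g | ∃ a b : K, g.val = !![1, a * x, b; 0, 1, a * y; 0, 0, 1]}
  one_mem' := ⟨0, 0, by ext i j; fin_cases i <;> fin_cases j <;> simp⟩
  mul_mem' := by
    rintro g h ⟨a, b, hg⟩ ⟨a', b', hh⟩
    refine ⟨a + a', b' + a * x * (a' * y) + b, ?_⟩
    rw [Units.val_mul, hg, hh]
    ext i j; fin_cases i <;> fin_cases j <;> simp [Matrix.mul_apply, Fin.sum_univ_three] <;> ring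
  inv_mem' := by
    rintro g ⟨a, b, hg⟩
    refine ⟨-a, a * x * (a * y) - b, ?_⟩
    refine Units.inv_eq_of_mul_eq_one_right ?_
    rw [hg]
    ext i j; fin_cases i <;> fin_cases j <;> simp [Matrix.mul_apply, Fin.sum_univ_three]
    ring

/-- The group `unipotentGL x y`, modulo scalars. -/
def unipotentGroup (x y : K) : Subgroup PGL(3, K) :=
  (unipotentGL x y).map Matrix.ProjGenLinGroup.mk

/-- The image in `PGL₃(K)` of the group generated by `diag(1, ω, ω²)` and a cyclic permutation
matrix. (Used only for a primitive cube root of unity `ω`.) -/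
def heisenbergGroup (ω : K) : Subgroup PGL(3, K) :=
  (Subgroup.closure {x : GL (Fin 3) K |
    x.val = Matrix.diagonal ![1, ω, ω ^ 2] ∨ x.val = !![0, 0, 1; 1, 0, 0; 0, 1, 0]}).map
    Matrix.ProjGenLinGroup.mk

/-- The image in `PGL₃(K)` of the group generated by the multiplications by those `x ∈ Lˣ` with
`x ^ 3 ∈ Kˣ` and by the Frobenius map `y ↦ y ^ |K|` of `L`. -/
def frobeniusGroup {L : Type*} [Field L] [Algebra K L] (e : L ≃ₗ[K] (Fin 3 → K)) :
    Subgroup PGL(3, K) :=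
  (Subgroup.closure {f : LinearMap.GeneralLinearGroup K L |
    (∃ x : L, (∃ c : K, c ≠ 0 ∧ x ^ 3 = algebraMap K L c) ∧ ∀ y, f.val y = x * y) ∨
      ∀ y, f.val y = y ^ Nat.card K}).map (Matrix.ProjGenLinGroup.mk.comp (toGL e))

/-- Labels for the nine families. -/
inductive Family
  | cubic | quadratic | diagonal | block | unipotent | translation | dualTranslation
  | heisenberg | frobenius

variable (K) in
/-- The restrictions on `q = |K|` under which a family occurs. -/
def Family.Occurs : Family → Prop
  | diagonal => Nat.card K ≠ 2
  | block => Nat.card K ≠ 2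
  | heisenberg => Nat.card K % 3 = 1
  | frobenius => Nat.card K % 3 = 1
  | _ => True

/-- The subgroup of `PGL₃(K)` representing each family. -/
def Family.group {L₂ L₃ : Type*} [Field L₂] [Field L₃] [Algebra K L₂] [Algebra K L₃]
    (e₂ : (L₂ × K) ≃ₗ[K] (Fin 3 → K)) (e₃ : L₃ ≃ₗ[K] (Fin 3 → K)) (ω : K) :
    Family → Subgroup PGL(3, K)
  | cubic => torus e₃
  | quadratic => torus e₂
  | diagonal => diagonalGroup K
  | block => blockGroup K
  | unipotent => unipotentGroup 1 1
  | translation => unipotentGroup 0 1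
  | dualTranslation => unipotentGroup 1 0
  | heisenberg => heisenbergGroup ω
  | frobenius => frobeniusGroup e₃

/-- Maximal elements among the abelian subgroups of `G`. -/
def IsMaximalAbelian {G : Type*} [Group G] (H : Subgroup G) : Prop :=
  Maximal (fun A : Subgroup G => IsMulCommutative A) H

/-- Conjugacy of subgroups. -/
def IsConjSubgroup {G : Type*} [Group G] (H H' : Subgroup G) : Prop :=
  ∃ g : G, MulAut.conj g • H = H'

/-- Sidon sets, in multiplicative notation. -/
def IsSidon {G : Type*} [Group G] (S : Set G) : Prop :=
  ∀ x ∈ S, ∀ y ∈ S, ∀ z ∈ S, ∀ w ∈ S, x * y = z * w → ({x, y} : Set G) = {z, w}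

/-- `S` is carried to a translate of `T` by a group isomorphism. -/
def SameUpToIso {G G' : Type*} [Group G] [Group G'] (S : Set G) (T : Set G') : Prop :=
  ∃ (φ : G ≃* G') (t : G'), φ '' S = t • T

/-- The lines of the projective plane `P²(K)`, as sets of points. -/
def IsLine (l : Set (ℙ K (Fin 3 → K))) : Prop :=
  ∃ W : Submodule K (Fin 3 → K), Module.finrank K W = 2 ∧ l = {p | p.submodule ≤ W}

/-- `l` is a line, and both `p` and `l` have trivial stabilizer in `H`. -/
def FreePair (H : Subgroup PGL(3, K)) (p : ℙ K (Fin 3 → K)) (l : Set (ℙ K (Fin 3 → K))) :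
    Prop :=
  IsLine l ∧ (∀ g ∈ H, g • p = p → g = 1) ∧ (∀ g ∈ H, g • l = l → g = 1)

/-- The set of the `g ∈ H` that move the point `p` onto the line `l`. -/
def incidenceSet (H : Subgroup PGL(3, K)) (p : ℙ K (Fin 3 → K)) (l : Set (ℙ K (Fin 3 → K))) :
    Set H :=
  {g | (g : PGL(3, K)) • p ∈ l}

/-- Some point `p` and line `l` with trivial stabilizers in `H` give a Sidon set
`{g ∈ H : g p ∈ l}` with property `P`. -/
def SomePairYields (H : Subgroup PGL(3, K)) (P : Set H → Prop) : Prop :=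
  ∃ p l, FreePair H p l ∧ IsSidon (incidenceSet H p l) ∧ P (incidenceSet H p l)

/-- Every point `p` and line `l` with trivial stabilizers in `H` give a Sidon set
`{g ∈ H : g p ∈ l}` with property `P`. -/
def EveryPairYields (H : Subgroup PGL(3, K)) (P : Set H → Prop) : Prop :=
  ∀ p l, FreePair H p l → IsSidon (incidenceSet H p l) ∧ P (incidenceSet H p l)

variable (K) in
/-- The parabola in `K²` (Erdős–Turán). -/
def erdosTuran : Set (Multiplicative (K × K)) :=
  {v | ∃ x : K, v = Multiplicative.ofAdd (x, x ^ 2)}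

variable (K) in
/-- The quotient group `Lˣ / Kˣ`. -/
abbrev UnitsMod (L : Type*) [Field L] [Algebra K L] : Type _ :=
  Lˣ ⧸ (Units.map (algebraMap K L : K →* L)).range

/-- `(D ∩ Lˣ) / Kˣ` in `Lˣ / Kˣ` (Singer). -/
def singer {L : Type*} [Field L] [Algebra K L] (D : Submodule K L) : Set (UnitsMod K L) :=
  {v | ∃ x : Lˣ, (x : L) ∈ D ∧ v = QuotientGroup.mk x}

/-- The affine line `u + D` in `Lˣ` (Bose). -/
def bose {L : Type*} [Field L] [Algebra K L] (D : Submodule K L) (u : L) : Set Lˣ :=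
  {x | ∃ d ∈ D, (x : L) = u + d}

variable (K) in
/-- The set of the `(x, x)` in `Kˣ × K` (Spence). -/
def spence : Set (Kˣ × Multiplicative K) :=
  {v | ∃ x : Kˣ, v = (x, Multiplicative.ofAdd (x : K))}

variable (K) in
/-- The set of the `(x, y)` in `Kˣ × Kˣ` with `x + y = 1` (Hughes, Cilleruelo). -/
def hughes : Set (Kˣ × Kˣ) := {v | (v.1 : K) + (v.2 : K) = 1}

end

end DesarguesSidon

namespace DesarguesSidon

open Matrix.ProjGenLinGroup Matrix

variable {K : Type*} [Field K]

/-! Classes in PGL₃(K) commute exactly when representatives satisfy gh = c·hg for a scalar c, and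
determinants force c³ = 1. This separates abelian subgroups H into two kinds.

Suppose first that all representatives commute. An element without eigenvalues has irreducible
characteristic polynomial and turns K³ into a one-dimensional space over L₃. An element with an
eigenvalue that is not scalar plus nilpotent splits K³ into a line and a plane by Fitting's lemma,
and the plane is analysed in the same way. A nilpotent part with nonzero square turns K³ into
K[X]/(X³). In each case the representatives are multiplications by elements of a commutative algebra
A among L₃, L₂ × K, K³, K[ε] × K, K[X]/(X³), so H lies in a conjugate of Aˣ/Kˣ, the group `torus`.
Otherwise every representative is scalar plus square-zero; commuting square-zero maps of K³ have
rank at most one and annihilate each other, which leaves the two elementary abelian unipotent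
groups. This is `actsByMul_of_finrank_eq_three` with `exists_basis_of_sq_eq_zero`.

Suppose now that some pair has c ≠ 1. Such a pair acts irreducibly enough for a Schur lemma
(`mk_eq_one_of_commute`), so its classes generate their own centralizer. If v is an eigenvector of
g, then v, hv, h²v is a basis of eigenvectors, and the pair is determined up to conjugacy by c and
the scalar h³. Changing generators fixes c and reduces h³ modulo cubes to 1 or to a chosen noncube:
these are the Heisenberg and Frobenius groups (`HasWeylPair.stdPair`, `StdPair.conj`).

The listed groups are self-centralizing, hence maximal: from ghg⁻¹ = c·h, a representative h of
nonzero trace can only have c = 1, and there are enough units of nonzero trace to generate A. They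
are told apart by existence of a pair with c ≠ 1, order, square-zero lifts, a pointwise fixed line,
and whether determinants are cubes.

The Sidon property expresses that two distinct lines meet in one point (`FreePair.isSidon`). To
identify the sets, fix a functional `lam` on A for which (x, y) ↦ lam(xy) is nondegenerate. Every
functional is then lam(b·), freeness of a pair makes the data units, and the incidence set is a
translate of the image of {lam = 0} (`free_pair_translate`). A suitable `lam` on each algebra gives
each classical set. -/

theorem toGL_val_mulVec {V : Type*} [AddCommGroup V] [Module K V] (e : V ≃ₗ[K] (Fin 3 → K))
    (f : LinearMap.GeneralLinearGroup K V) (v : V) :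
    (toGL e f).val *ᵥ e v = e (f.val v) := by
  have : (toGL e f).val = LinearMap.toMatrix' (e.toLinearMap ∘ₗ f.val ∘ₗ e.symm.toLinearMap) := rfl
  rw [this, ← Matrix.toLin'_apply, Matrix.toLin'_toMatrix']
  simp

theorem GL_ext_mulVec {V : Type*} [AddCommGroup V] [Module K V] (e : V ≃ₗ[K] (Fin 3 → K))
    {M N : Matrix (Fin 3) (Fin 3) K} (h : ∀ v, M *ᵥ e v = N *ᵥ e v) : M = N := by
  apply Matrix.toLin'.injective
  ext1 i
  ext1
  simpa using h (e.symm (Pi.single i 1))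

/-! ### Matrix representatives of projective classes -/

theorem mk_eq_mk_iff_smul {g h : GL (Fin 3) K} :
    mk g = mk h ↔ ∃ c : K, c ≠ 0 ∧ h.val = c • g.val := by
  rw [mk_eq_mk_iff]
  constructor
  · rintro ⟨u, rfl⟩
    refine ⟨u, u.ne_zero, ?_⟩
    rw [Units.val_mul, GeneralLinearGroup.coe_scalar]
    ext i j; simp [mul_comm]
  · rintro ⟨c, hc, h⟩
    refine ⟨Units.mk0 c hc, Units.ext ?_⟩
    rw [Units.val_mul, h, GeneralLinearGroup.coe_scalar]
    ext i j; simp [mul_comm]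

theorem mk_eq_one_iff {g : GL (Fin 3) K} : mk g = 1 ↔ ∃ c : K, g.val = c • 1 := by
  rw [← mk_one, eq_comm, mk_eq_mk_iff_smul]
  constructor
  · rintro ⟨c, -, h⟩; exact ⟨c, h⟩
  · rintro ⟨c, h⟩
    refine ⟨c, ?_, h⟩
    rintro rfl
    have := g.det_ne_zero
    simp [h] at this

/-- Matrices whose projective classes commute commute up to a scalar. -/
theorem commute_mk_iff {g h : GL (Fin 3) K} :
    mk g * mk h = mk h * mk g ↔ ∃ c : K, c ≠ 0 ∧ g.val * h.val = c • (h.val * g.val) := by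
  rw [eq_comm, ← map_mul, ← map_mul, mk_eq_mk_iff_smul]; rfl

theorem scalar_cube_eq_one {g h : GL (Fin 3) K} {c : K} (H : g.val * h.val = c • (h.val * g.val)) :
    c ^ 3 = 1 := by
  have := congrArg Matrix.det H
  rw [Matrix.det_smul, Matrix.det_mul, Matrix.det_mul, Fintype.card_fin, mul_comm g.val.det] at this
  exact (mul_left_eq_self₀.mp this.symm).resolve_right
    (mul_ne_zero h.det_ne_zero g.det_ne_zero)

theorem mem_map_mk {S : Subgroup (GL (Fin 3) K)} {g : GL (Fin 3) K} :
    mk g ∈ S.map mk ↔ ∃ s ∈ S, ∃ c : K, c ≠ 0 ∧ g.val = c • s.val := by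
  simp only [Subgroup.mem_map, mk_eq_mk_iff_smul]

theorem mem_diagonalGroup {g : GL (Fin 3) K} :
    mk g ∈ diagonalGroup K ↔ ∃ d : Fin 3 → K, g.val = diagonal d := by
  rw [diagonalGroup, mem_map_mk]
  constructor
  · rintro ⟨_, ⟨u, rfl⟩, c, -, h⟩
    refine ⟨c • u.val, ?_⟩
    rw [h, Matrix.diagonal_smul]; rfl
  · rintro ⟨d, h⟩
    have hd : ∀ i, d i ≠ 0 := by
      have := g.det_ne_zero
      rw [h, Matrix.det_diagonal, Finset.prod_ne_zero_iff] at this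
      exact fun i => this i (Finset.mem_univ i)
    have hu : IsUnit d := Pi.isUnit_iff.2 fun i => (hd i).isUnit
    refine ⟨_, ⟨hu.unit, rfl⟩, 1, one_ne_zero, ?_⟩
    rw [h, one_smul]; rfl

/-- The test covers every representative, not only the normalised ones; dividing by the corner
entry, nonzero because the determinant is, restores the normalisation. -/
theorem mem_blockGroup {g : GL (Fin 3) K} :
    mk g ∈ blockGroup K ↔ ∃ r a s : K, g.val = !![r, a, 0; 0, r, 0; 0, 0, s] := by
  rw [blockGroup, mem_map_mk]
  constructor
  · rintro ⟨s, ⟨r, a, hr, hs⟩, c, hc, h⟩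
    refine ⟨c * r, c * a, c, ?_⟩
    rw [h, hs]
    ext i j; fin_cases i <;> fin_cases j <;> simp
  · rintro ⟨r, a, s, h⟩
    have := g.det_ne_zero
    rw [h, Matrix.det_fin_three] at this
    simp only [of_apply, cons_val', cons_val_zero, cons_val_one, cons_val] at this
    have hr : r ≠ 0 := by rintro rfl; simp at this
    have hs : s ≠ 0 := by rintro rfl; simp at this
    have hd : (!![r / s, a / s, 0; 0, r / s, 0; 0, 0, 1] : Matrix (Fin 3) (Fin 3) K).det ≠ 0 := by
      rw [Matrix.det_fin_three]; simp [hr, hs]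
    refine ⟨GeneralLinearGroup.mkOfDetNeZero _ hd, ⟨r / s, a / s, by simp [hr, hs], rfl⟩,
      s, hs, ?_⟩
    rw [h]
    ext i j; fin_cases i <;> fin_cases j <;> simp [GeneralLinearGroup.mkOfDetNeZero] <;> field_simp

theorem mem_unipotentGroup {x y : K} {g : GL (Fin 3) K} :
    mk g ∈ unipotentGroup x y ↔
      ∃ r a b : K, g.val = !![r, a * x, b; 0, r, a * y; 0, 0, r] := by
  rw [unipotentGroup, mem_map_mk]
  constructor
  · rintro ⟨s, ⟨a, b, hs⟩, c, hc, h⟩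
    refine ⟨c, c * a, c * b, ?_⟩
    rw [h, hs]
    ext i j; fin_cases i <;> fin_cases j <;> simp [mul_assoc]
  · rintro ⟨r, a, b, h⟩
    have := g.det_ne_zero
    rw [h, Matrix.det_fin_three] at this
    simp only [of_apply, cons_val', cons_val_zero, cons_val_one, cons_val] at this
    have hr : r ≠ 0 := by rintro rfl; simp at this
    have hd : (!![1, a / r * x, b / r; 0, 1, a / r * y; 0, 0, 1] : Matrix (Fin 3) (Fin 3) K).det ≠ 0 := by
      rw [Matrix.det_fin_three]; simp
    refine ⟨GeneralLinearGroup.mkOfDetNeZero _ hd, ⟨a / r, b / r, rfl⟩, r, hr, ?_⟩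
    rw [h]
    ext i j; fin_cases i <;> fin_cases j <;> simp [GeneralLinearGroup.mkOfDetNeZero] <;> field_simp

/-! ### Units of a three-dimensional algebra modulo scalars -/

section torus

variable {A : Type*} [CommRing A] [Algebra K A] (e : A ≃ₗ[K] (Fin 3 → K))

/-- The projective class of multiplication by a unit. -/
noncomputable def mulClass : Aˣ →* PGL(3, K) :=
  (mk.comp (toGL e)).comp (Units.map (Algebra.lmul K A : A →* Module.End K A))

/-- Multiplication by a unit as a matrix. -/
noncomputable def mulGL : Aˣ →* GL (Fin 3) K :=
  (toGL e).comp (Units.map (Algebra.lmul K A : A →* Module.End K A))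

theorem mulClass_eq (u : Aˣ) : mulClass e u = mk (mulGL e u) := rfl

theorem mulGL_mulVec (u : Aˣ) (x : A) : (mulGL e u).val *ᵥ e x = e (u * x) :=
  toGL_val_mulVec e _ x

theorem mulClass_mem (u : Aˣ) : mulClass e u ∈ torus e := ⟨u, rfl⟩

variable {e}

theorem mk_eq_mulClass {g : GL (Fin 3) K} {u : Aˣ} (h : ∀ x, g.val *ᵥ e x = e (u * x)) :
    mk g = mulClass e u := by
  rw [mulClass_eq]
  congr 1
  exact Units.ext (GL_ext_mulVec e fun v => by rw [h, mulGL_mulVec])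

/-- It need not be assumed that `a` is a unit: since g is surjective, some multiple of `a` equals 1.
-/
theorem mem_torus {g : GL (Fin 3) K} :
    mk g ∈ torus e ↔ ∃ a : A, ∀ x, g.val *ᵥ e x = e (a * x) := by
  constructor
  · rintro ⟨u, hu⟩
    change mulClass e u = _ at hu
    rw [mulClass_eq, mk_eq_mk_iff_smul] at hu
    obtain ⟨c, hc, h⟩ := hu
    refine ⟨c • (u : A), fun x => ?_⟩
    rw [h, smul_mulVec, mulGL_mulVec, ← map_smul, smul_mul_assoc]
  · rintro ⟨a, h⟩
    have h1 := h (e.symm ((g⁻¹).val *ᵥ e 1))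
    rw [LinearEquiv.apply_symm_apply, mulVec_mulVec, ← Units.val_mul, mul_inv_cancel,
      Units.val_one, one_mulVec] at h1
    have ha : IsUnit a := IsUnit.of_mul_eq_one _ (e.injective h1).symm
    rw [mk_eq_mulClass (u := ha.unit) h]
    exact mulClass_mem e _

theorem mulClass_eq_iff {u v : Aˣ} :
    mulClass e u = mulClass e v ↔ ∃ c : K, c ≠ 0 ∧ (v : A) = c • (u : A) := by
  rw [mulClass_eq, mulClass_eq, mk_eq_mk_iff_smul]
  refine exists_congr fun c => and_congr_right fun _ => ?_
  constructor
  · intro h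
    have := congrArg (fun M => M *ᵥ e 1) h
    simp only [smul_mulVec, mulGL_mulVec, mul_one, ← map_smul] at this
    exact e.injective this
  · intro h
    refine GL_ext_mulVec e fun x => ?_
    rw [smul_mulVec, mulGL_mulVec, mulGL_mulVec, ← map_smul, h, smul_mul_assoc]

theorem mulClass_eq_one_iff [Nontrivial A] {u : Aˣ} :
    mulClass e u = 1 ↔ ∃ c : K, (u : A) = c • (1 : A) := by
  rw [← map_one (mulClass e), eq_comm, mulClass_eq_iff]
  constructor
  · rintro ⟨c, -, h⟩; exact ⟨c, h⟩
  · rintro ⟨c, h⟩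
    refine ⟨c, ?_, h⟩
    rintro rfl
    rw [zero_smul] at h; exact u.ne_zero h

instance torus_comm : IsMulCommutative (torus e) :=
  ⟨⟨by
    rintro ⟨_, u, rfl⟩ ⟨_, v, rfl⟩
    refine Subtype.ext ?_
    change mulClass e u * mulClass e v = mulClass e v * mulClass e u
    rw [← map_mul, mul_comm, map_mul]⟩⟩

end torus

/-! ### Conjugacy and containment up to conjugacy -/

section conj

theorem IsConjSubgroup.symm {G : Type*} [Group G] {H H' : Subgroup G} (h : IsConjSubgroup H H') :
    IsConjSubgroup H' H := by
  obtain ⟨g, rfl⟩ := h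
  exact ⟨g⁻¹, by rw [map_inv, inv_smul_smul]⟩

theorem mem_conj_iff {G : Type*} [Group G] {H : Subgroup G} {g x : G} :
    x ∈ MulAut.conj g • H ↔ g⁻¹ * x * g ∈ H := by
  rw [Subgroup.mem_pointwise_smul_iff_inv_smul_mem, ← map_inv, MulAut.smul_def, MulAut.conj_apply,
    inv_inv]

/-- A subgroup is contained in a conjugate of another one. -/
def SubConj {G : Type*} [Group G] (H H' : Subgroup G) : Prop := ∃ g : G, H ≤ MulAut.conj g • H'

theorem SubConj.trans_conj {G : Type*} [Group G] {H H' H'' : Subgroup G}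
    (h : SubConj H H') (h' : IsConjSubgroup H'' H') : SubConj H H'' := by
  obtain ⟨g, hg⟩ := h
  obtain ⟨g', rfl⟩ := h'
  exact ⟨g * g', by rwa [map_mul, mul_smul]⟩

theorem SubConj.trans_le {G : Type*} [Group G] {H H' H'' : Subgroup G}
    (h : SubConj H H') (h' : H' ≤ H'') : SubConj H H'' := by
  obtain ⟨g, hg⟩ := h
  exact ⟨g, hg.trans (Subgroup.pointwise_smul_le_pointwise_smul_iff.2 h')⟩

/-- The matrix of a linear automorphism of `K³`. -/
noncomputable def equivGL (φ : (Fin 3 → K) ≃ₗ[K] (Fin 3 → K)) : GL (Fin 3) K :=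
  toGL (LinearEquiv.refl K _) (LinearMap.GeneralLinearGroup.ofLinearEquiv φ)

theorem equivGL_mulVec (φ : (Fin 3 → K) ≃ₗ[K] (Fin 3 → K)) (v : Fin 3 → K) :
    (equivGL φ).val *ᵥ v = φ v := toGL_val_mulVec (LinearEquiv.refl K _) _ v

theorem inv_mulVec_eq_iff {g : GL (Fin 3) K} {v w : Fin 3 → K} :
    (g⁻¹).val *ᵥ v = w ↔ v = g.val *ᵥ w := by
  constructor
  · rintro rfl
    rw [mulVec_mulVec, ← Units.val_mul, mul_inv_cancel, Units.val_one, one_mulVec]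
  · rintro rfl
    rw [mulVec_mulVec, ← Units.val_mul, inv_mul_cancel, Units.val_one, one_mulVec]

/-- An algebra isomorphism transports multiplication operators, so the change of coordinates it
induces conjugates one group to the other. In particular the identification with K³ is irrelevant.
-/
theorem torus_conj {A B : Type*} [CommRing A] [Algebra K A] [CommRing B] [Algebra K B]
    (e : A ≃ₗ[K] (Fin 3 → K)) (e' : B ≃ₗ[K] (Fin 3 → K)) (ψ : A ≃ₐ[K] B) :
    IsConjSubgroup (torus e) (torus e') := by
  let φ : (Fin 3 → K) ≃ₗ[K] (Fin 3 → K) := (e.symm.trans ψ.toLinearEquiv).trans e'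
  refine ⟨mk (equivGL φ), ?_⟩
  ext x
  obtain ⟨g, rfl⟩ := mk_surjective x
  rw [mem_conj_iff, ← map_inv, ← map_mul, ← map_mul, mem_torus, mem_torus]
  have key : ∀ a x, ((equivGL φ)⁻¹ * g * equivGL φ).val *ᵥ e x = e (a * x) ↔
      g.val *ᵥ e' (ψ x) = e' (ψ a * ψ x) := by
    intro a x
    rw [Units.val_mul, Units.val_mul, ← mulVec_mulVec, ← mulVec_mulVec, inv_mulVec_eq_iff,
      equivGL_mulVec, equivGL_mulVec]
    simp [φ]
  simp only [key]
  constructor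
  · rintro ⟨a, h⟩
    exact ⟨ψ a, fun x => by simpa using h (ψ.symm x)⟩
  · rintro ⟨a, h⟩
    exact ⟨ψ.symm a, fun x => by simpa using h (ψ x)⟩

end conj

/-! ### Lines of the projective plane and the Sidon property -/

section lines

/-- Two distinct planes in K³ meet in dimension at most one. -/
theorem line_inter_unique {l l' : Set (ℙ K (Fin 3 → K))} (hl : IsLine l) (hl' : IsLine l')
    (hne : l ≠ l') {p p' : ℙ K (Fin 3 → K)} (hp : p ∈ l) (hp' : p ∈ l') (hq : p' ∈ l)
    (hq' : p' ∈ l') : p = p' := by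
  obtain ⟨W, hW, rfl⟩ := hl
  obtain ⟨W', hW', rfl⟩ := hl'
  have hWW : W ≠ W' := by rintro rfl; exact hne rfl
  have hlt : W ⊓ W' < W := by
    refine lt_of_le_of_ne inf_le_left fun h => hWW ?_
    exact Submodule.eq_of_le_of_finrank_eq (inf_eq_left.1 h) (hW.trans hW'.symm)
  have hfin := Submodule.finrank_lt_finrank_of_lt hlt
  have key : ∀ r : ℙ K (Fin 3 → K), r.submodule ≤ W → r.submodule ≤ W' →
      r.submodule = W ⊓ W' := fun r h h' =>
    Submodule.eq_of_le_of_finrank_le (le_inf h h') (by rw [r.finrank_submodule]; omega)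
  exact Projectivization.submodule_injective ((key p hp hp').trans (key p' hq hq').symm)

theorem mk_mem_line {W : Submodule K (Fin 3 → K)} {v : Fin 3 → K} (hv : v ≠ 0) :
    (Projectivization.mk K v hv).submodule ≤ W ↔ v ∈ W := by
  rw [Projectivization.submodule_mk, Submodule.span_singleton_le_iff_mem]

theorem mk_smul_mk_mulVec (g : GL (Fin 3) K) {v : Fin 3 → K} (hv : v ≠ 0)
    (hgv : g.val *ᵥ v ≠ 0) :
    (mk g : PGL(3, K)) • Projectivization.mk K v hv = Projectivization.mk K (g.val *ᵥ v) hgv :=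
  rfl

theorem mulVec_ne_zero (g : GL (Fin 3) K) {v : Fin 3 → K} (hv : v ≠ 0) : g.val *ᵥ v ≠ 0 := by
  intro h
  apply hv
  rw [← one_mulVec v, ← Units.val_one, ← inv_mul_cancel g, Units.val_mul, ← mulVec_mulVec, h,
    mulVec_zero]

theorem isLine_smul {l : Set (ℙ K (Fin 3 → K))} (hl : IsLine l) (x : PGL(3, K)) :
    IsLine (x • l) := by
  obtain ⟨W, hW, rfl⟩ := hl
  obtain ⟨g, rfl⟩ := mk_surjective x
  let φ : (Fin 3 → K) ≃ₗ[K] (Fin 3 → K) := (GeneralLinearGroup.toLin g).toLinearEquiv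
  have hφ : ∀ v, φ v = g.val *ᵥ v := fun v => rfl
  refine ⟨W.map φ.toLinearMap, by rw [← hW]; exact φ.finrank_map_eq W, ?_⟩
  ext p
  induction p using Projectivization.ind with | h v hv =>
  rw [Set.mem_smul_set_iff_inv_smul_mem, ← map_inv, mk_smul_mk_mulVec _ _ (mulVec_ne_zero _ hv)]
  simp only [Set.mem_ofPred_eq]
  rw [mk_mem_line, mk_mem_line, Submodule.mem_map]
  constructor
  · intro h
    exact ⟨_, h, (inv_mulVec_eq_iff.1 rfl).symm⟩
  · rintro ⟨w, hw, h⟩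
    rwa [inv_mulVec_eq_iff.2 (h.symm.trans (hφ w))]

/-- If xy = zw with x ≠ z, then g = xz⁻¹ ≠ 1 satisfies gz = x and gy = w. So zp and yp both lie on l
and on g⁻¹l, which differ because l has trivial stabilizer. Hence zp = yp, and the trivial
stabilizer of p gives z = y. -/
theorem FreePair.isSidon {H : Subgroup PGL(3, K)} [IsMulCommutative H] {p : ℙ K (Fin 3 → K)}
    {l : Set (ℙ K (Fin 3 → K))} (h : FreePair H p l) : IsSidon (incidenceSet H p l) := by
  obtain ⟨hl, hp, hl'⟩ := h
  have hc : ∀ a b : H, a * b = b * a := mul_comm'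
  intro x hx y hy z hz w hw hxy
  by_cases hxz : x = z
  · subst hxz
    rw [mul_left_cancel hxy]
  have hg1 : x * z⁻¹ ≠ 1 := fun h => hxz (by rwa [mul_inv_eq_one] at h)
  have hgy : x * z⁻¹ * y = w := by
    rw [hc x, mul_assoc, hxy, inv_mul_cancel_left]
  have hgz : x * z⁻¹ * z = x := inv_mul_cancel_right _ _
  set g := x * z⁻¹
  have hne : l ≠ (g⁻¹ : PGL(3, K)) • l := fun h => hg1 <| by
    have := hl' (g⁻¹ : H) (g⁻¹).2 (by rw [Subgroup.coe_inv]; exact h.symm)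
    simpa using this
  have mem : ∀ a : H, g * a ∈ incidenceSet H p l →
      (a : PGL(3, K)) • p ∈ (g⁻¹ : PGL(3, K)) • l := fun a ha => by
    rw [Set.mem_inv_smul_set_iff, smul_smul]
    exact ha
  have hzy := line_inter_unique hl (isLine_smul hl _) hne hz (mem z (by rwa [hgz]))
    hy (mem y (by rwa [hgy]))
  have hzy' : z = y := by
    have := hp (z⁻¹ * y : H) (z⁻¹ * y).2 (by
      rw [Subgroup.coe_mul, Subgroup.coe_inv, mul_smul, ← hzy, inv_smul_smul])
    rw [← Subgroup.coe_one, Subtype.coe_inj, inv_mul_eq_one] at this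
    exact this
  subst hzy'
  rw [hgz] at hgy
  rw [hgy, Set.pair_comm]

end lines

/-! ### Free pairs for the unit group of an algebra -/

section pairs

variable {A : Type*} [CommRing A] [Algebra K A] (e : A ≃ₗ[K] (Fin 3 → K))

theorem mulClass_smul_mk (u : Aˣ) {v : A} (hv : e v ≠ 0) (huv : e (u * v) ≠ 0) :
    mulClass e u • Projectivization.mk K (e v) hv = Projectivization.mk K (e (u * v)) huv := by
  rw [mulClass_eq, mk_smul_mk_mulVec _ _ (mulVec_ne_zero _ hv)]
  simp only [mulGL_mulVec]

/-- The line on which a nonzero linear functional on `A ≅ K³` vanishes. -/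
def functionalLine (f : Module.Dual K A) : Set (ℙ K (Fin 3 → K)) :=
  {p | p.submodule ≤ LinearMap.ker (f ∘ₗ e.symm.toLinearMap)}

variable {e}

theorem mk_mem_functionalLine {f : Module.Dual K A} {v : A} (hv : e v ≠ 0) :
    Projectivization.mk K (e v) hv ∈ functionalLine e f ↔ f v = 0 := by
  rw [functionalLine, Set.mem_ofPred_eq, mk_mem_line]
  simp

theorem isLine_iff {l : Set (ℙ K (Fin 3 → K))} :
    IsLine l ↔ ∃ f : Module.Dual K A, f ≠ 0 ∧ l = functionalLine e f := by
  constructor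
  · rintro ⟨W, hW, rfl⟩
    obtain ⟨f, hf, hWf⟩ := Submodule.exists_le_ker_of_lt_top W (by
      rw [lt_top_iff_ne_top]
      rintro rfl
      simp at hW)
    have hker : W = LinearMap.ker f := by
      refine Submodule.eq_of_le_of_finrank_le hWf ?_
      have := Module.Dual.finrank_ker_add_one_of_ne_zero hf
      rw [Module.finrank_fin_fun] at this
      omega
    refine ⟨f ∘ₗ e.toLinearMap, fun h => hf ?_, ?_⟩
    · ext1 i
      ext
      simpa using LinearMap.congr_fun h (e.symm (Pi.single i 1))
    · rw [functionalLine, LinearMap.comp_assoc]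
      simp [hker]
  · rintro ⟨f, hf, rfl⟩
    refine ⟨_, ?_, rfl⟩
    have hne : f ∘ₗ e.symm.toLinearMap ≠ 0 := fun h => hf <| by
      ext x
      simpa using LinearMap.congr_fun h (e x)
    have := Module.Dual.finrank_ker_add_one_of_ne_zero hne
    rw [Module.finrank_fin_fun] at this
    omega

theorem smul_functionalLine (u : Aˣ) {f : Module.Dual K A} :
    mulClass e u • functionalLine e f =
      functionalLine e (f ∘ₗ LinearMap.mulLeft K ((u⁻¹ : Aˣ) : A)) := by
  ext p
  induction p using Projectivization.ind with | h v hv =>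
  obtain ⟨v, rfl⟩ := e.surjective v
  have h0 : e ((u⁻¹ : Aˣ) * v) ≠ 0 := by
    rw [← mulGL_mulVec]; exact mulVec_ne_zero _ hv
  rw [Set.mem_smul_set_iff_inv_smul_mem, ← map_inv, mulClass_smul_mk e _ hv h0,
    mk_mem_functionalLine, mk_mem_functionalLine]
  rfl

theorem functionalLine_eq_iff {f f' : Module.Dual K A} (hf : f ≠ 0) :
    functionalLine e f = functionalLine e f' → ∃ c : K, f' = c • f := by
  intro h
  obtain ⟨x, hx⟩ : ∃ x, f x ≠ 0 := by
    by_contra! hh; exact hf (LinearMap.ext hh)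
  have key : ∀ v, f v = 0 → f' v = 0 := fun v hv => by
    by_cases hv0 : v = 0
    · simp [hv0]
    have hv' : e v ≠ 0 := by simpa using hv0
    rw [← mk_mem_functionalLine hv', ← h, mk_mem_functionalLine]
    exact hv
  refine ⟨f' x / f x, LinearMap.ext fun y => ?_⟩
  have := key (y - (f y / f x) • x) (by simp [hx])
  rw [map_sub, map_smul, smul_eq_mul, sub_eq_zero] at this
  rw [this, LinearMap.smul_apply, smul_eq_mul]
  field_simp

/-- The functional `x ↦ lam (b * x)`. -/
def twist (lam : Module.Dual K A) : A →ₗ[K] Module.Dual K A :=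
  (LinearMap.mul K A).compr₂ lam

theorem twist_apply (lam : Module.Dual K A) (b x : A) : twist lam b x = lam (b * x) := rfl

/-- The elements of the torus represented by units on which a functional vanishes. -/
def hyperplaneSet (e : A ≃ₗ[K] (Fin 3 → K)) (lam : Module.Dual K A) : Set (torus e) :=
  {g | ∃ u : Aˣ, (g : PGL(3, K)) = mulClass e u ∧ lam u = 0}

theorem mem_incidenceSet_iff {f : Module.Dual K A} {v : A} (hv : e v ≠ 0) {g : torus e} :
    g ∈ incidenceSet (torus e) (Projectivization.mk K (e v) hv) (functionalLine e f) ↔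
      ∃ u : Aˣ, (g : PGL(3, K)) = mulClass e u ∧ f (u * v) = 0 := by
  have h0 : ∀ u : Aˣ, e (u * v) ≠ 0 := fun u => by
    rw [← mulGL_mulVec]; exact mulVec_ne_zero _ hv
  constructor
  · intro hg
    obtain ⟨u, hu⟩ := g.2
    change mulClass e u = _ at hu
    refine ⟨u, hu.symm, ?_⟩
    rw [incidenceSet, Set.mem_ofPred_eq, ← hu, mulClass_smul_mk e u hv (h0 u),
      mk_mem_functionalLine] at hg
    exact hg
  · rintro ⟨u, hu, h⟩
    rw [incidenceSet, Set.mem_ofPred_eq, hu, mulClass_smul_mk e u hv (h0 u),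
      mk_mem_functionalLine]
    exact h

/-- Injectivity of `twist lam` means that (x, y) ↦ lam(xy) is nondegenerate. A unit fixing the point
of 1 is a scalar; a unit u fixing the line lam = 0 makes lam(u⁻¹·) a multiple of lam, so u⁻¹ is a
scalar too. -/
theorem standard_pair [Nontrivial A] {lam : Module.Dual K A}
    (hlam : Function.Injective (twist lam)) :
    ∃ p l, FreePair (torus e) p l ∧ incidenceSet (torus e) p l = hyperplaneSet e lam := by
  have h1 : e 1 ≠ 0 := by simp
  have hlam0 : lam ≠ 0 := fun h => by
    have := @hlam 1 0 (by ext x; simp [twist_apply, h])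
    exact one_ne_zero this
  refine ⟨Projectivization.mk K (e 1) h1, functionalLine e lam,
    ⟨isLine_iff.2 ⟨lam, hlam0, rfl⟩, ?_, ?_⟩, ?_⟩
  · rintro _ ⟨u, rfl⟩ h
    change mulClass e u • _ = _ at h
    have h0 : e (u * 1) ≠ 0 := by simp
    rw [mulClass_smul_mk e u h1 h0, Projectivization.mk_eq_mk_iff'] at h
    obtain ⟨c, hc⟩ := h
    change mulClass e u = 1
    rw [mulClass_eq_one_iff]
    refine ⟨c, e.injective ?_⟩
    rw [map_smul, hc, mul_one]
  · rintro _ ⟨u, rfl⟩ h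
    change mulClass e u • _ = _ at h
    change mulClass e u = 1
    rw [smul_functionalLine] at h
    obtain ⟨c, hc⟩ := functionalLine_eq_iff hlam0 h.symm
    have : ((u⁻¹ : Aˣ) : A) = c • 1 := hlam <| by
      ext x
      rw [twist_apply, map_smul, LinearMap.smul_apply, twist_apply, one_mul]
      exact LinearMap.congr_fun hc x
    rw [← inv_eq_one, ← map_inv, mulClass_eq_one_iff]
    exact ⟨c, this⟩
  · ext g
    rw [mem_incidenceSet_iff]
    simp only [mul_one]
    rfl

theorem twist_surjective (e : A ≃ₗ[K] (Fin 3 → K)) {lam : Module.Dual K A} (hlam : Function.Injective (twist lam)) :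
    Function.Surjective (twist lam) := by
  have : Module.Finite K A := Module.Finite.equiv e.symm
  exact (LinearMap.injective_iff_surjective_of_finrank_eq_finrank
    (Subspace.dual_finrank_eq).symm).1 hlam

/-- Nonzero nonunits are eigenvectors of nonscalar units. -/
def NonunitsMoved (K A : Type*) [Field K] [CommRing A] [Algebra K A] : Prop :=
  ∀ v : A, v ≠ 0 → ¬ IsUnit v → ∃ u : Aˣ, (∀ c : K, (u : A) ≠ c • 1) ∧ ∃ c : K, u * v = c • v

/-- Write the point as v and the line as lam(b·) = 0. A nonunit v or b would be an eigenvector of a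
nonscalar unit, which would then fix the point or the line. -/
theorem free_pair_translate [Nontrivial A] {lam : Module.Dual K A}
    (hlam : Function.Injective (twist lam)) (hA : NonunitsMoved K A)
    {p : ℙ K (Fin 3 → K)} {l : Set (ℙ K (Fin 3 → K))} (h : FreePair (torus e) p l) :
    ∃ t : torus e, incidenceSet (torus e) p l = t • hyperplaneSet e lam := by
  obtain ⟨hl, hp, hl'⟩ := h
  obtain ⟨f, hf, rfl⟩ := (isLine_iff (e := e)).1 hl
  obtain ⟨b, rfl⟩ := twist_surjective e hlam f
  induction p using Projectivization.ind with | h v hv =>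
  obtain ⟨v, rfl⟩ := e.surjective v
  have hv0 : v ≠ 0 := by rintro rfl; simp at hv
  have hb0 : b ≠ 0 := by rintro rfl; simp at hf
  have hvu : IsUnit v := by
    by_contra hvu
    obtain ⟨u, hu, c, hc⟩ := hA v hv0 hvu
    have h0 : e (u * v) ≠ 0 := by rw [← mulGL_mulVec]; exact mulVec_ne_zero _ hv
    have := hp (mulClass e u) (mulClass_mem e u) (by
      rw [mulClass_smul_mk e u hv h0, Projectivization.mk_eq_mk_iff']
      exact ⟨c, by rw [hc, map_smul]⟩)
    obtain ⟨k, hk⟩ := mulClass_eq_one_iff.1 this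
    exact hu k hk
  have hbu : IsUnit b := by
    by_contra hbu
    obtain ⟨u, hu, c, hc⟩ := hA b hb0 hbu
    have hc0 : c ≠ 0 := by
      rintro rfl
      rw [zero_smul, Units.mul_right_eq_zero] at hc
      exact hb0 hc
    have := hl' (mulClass e u⁻¹) (mulClass_mem e _) (by
      rw [smul_functionalLine]
      ext p
      induction p using Projectivization.ind with | h w hw =>
      obtain ⟨w, rfl⟩ := e.surjective w
      rw [mk_mem_functionalLine, mk_mem_functionalLine, inv_inv, LinearMap.comp_apply,
        LinearMap.mulLeft_apply, twist_apply, twist_apply, mul_left_comm, ← mul_assoc, hc,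
        smul_mul_assoc, map_smul, smul_eq_mul, mul_eq_zero, or_iff_right hc0])
    rw [map_inv, inv_eq_one] at this
    obtain ⟨k, hk⟩ := mulClass_eq_one_iff.1 this
    exact hu k hk
  obtain ⟨v, rfl⟩ := hvu
  obtain ⟨b, rfl⟩ := hbu
  -- The condition lam(b·u·v) = 0 says that bv·u lies in the hyperplane, so the translation is by
  -- (bv)⁻¹.
  refine ⟨⟨mulClass e (b * v)⁻¹, mulClass_mem e _⟩, ?_⟩
  ext g
  rw [mem_incidenceSet_iff, Set.mem_smul_set_iff_inv_smul_mem]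
  simp only [twist_apply]
  constructor
  · rintro ⟨u, hu, h⟩
    refine ⟨b * v * u, ?_, ?_⟩
    · rw [smul_eq_mul, Subgroup.coe_mul, Subgroup.coe_inv, hu, ← map_inv, inv_inv, ← map_mul]
    · rw [← h]; congr 1; push_cast; ring
  · rintro ⟨u, hu, h⟩
    refine ⟨(b * v)⁻¹ * u, ?_, ?_⟩
    · rw [smul_eq_mul, Subgroup.coe_mul, Subgroup.coe_inv, ← map_inv, inv_inv] at hu
      rw [map_mul, ← hu, ← mul_assoc, ← map_mul, inv_mul_cancel, map_one, one_mul]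
    · rw [← h]; congr 1
      have : b * ((b * v)⁻¹ * u * v) = u := by
        rw [show b * ((b * v)⁻¹ * u * v) = (b * v)⁻¹ * (b * v) * u by ac_rfl, inv_mul_cancel,
          one_mul]
      simpa only [Units.val_mul] using congrArg Units.val this

theorem torus_pairs [Nontrivial A] {lam : Module.Dual K A}
    (hlam : Function.Injective (twist lam)) {P : Set (torus e) → Prop}
    (hP : ∀ t : torus e, P (t • hyperplaneSet e lam)) :
    SomePairYields (torus e) P ∧ (NonunitsMoved K A → EveryPairYields (torus e) P) := by
  constructor
  · obtain ⟨p, l, h, hS⟩ := standard_pair (e := e) hlam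
    refine ⟨p, l, h, h.isSidon, ?_⟩
    rw [hS, ← one_smul (torus e) (hyperplaneSet e lam)]
    exact hP 1
  · intro hA p l h
    obtain ⟨t, ht⟩ := free_pair_translate hlam hA h
    exact ⟨h.isSidon, ht ▸ hP t⟩

theorem SameUpToIso.smul {G G' : Type*} [Group G] [Group G'] {S : Set G} {T : Set G'}
    (h : SameUpToIso S T) (t : G) : SameUpToIso (t • S) T := by
  obtain ⟨φ, s, hs⟩ := h
  refine ⟨φ, φ t * s, ?_⟩
  rw [mul_smul, ← hs]
  ext x
  constructor
  · rintro ⟨_, ⟨a, ha, rfl⟩, rfl⟩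
    exact ⟨φ a, ⟨a, ha, rfl⟩, by simp⟩
  · rintro ⟨_, ⟨a, ha, rfl⟩, rfl⟩
    exact ⟨t • a, ⟨a, ha, rfl⟩, by simp⟩

/-- A surjective homomorphism from the units with kernel the scalars identifies the torus. -/
theorem exists_torus_equiv [Nontrivial A] (e : A ≃ₗ[K] (Fin 3 → K)) {G : Type*} [Group G]
    (θ : Aˣ →* G)
    (hθ : Function.Surjective θ) (hker : ∀ u : Aˣ, θ u = 1 ↔ ∃ c : K, (u : A) = c • 1) :
    ∃ φ : torus e ≃* G, ∀ u, φ ⟨mulClass e u, mulClass_mem e u⟩ = θ u := by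
  let π : Aˣ →* torus e := (mulClass e).rangeRestrict
  have hπ : Function.Surjective π := (mulClass e).rangeRestrict_surjective
  have hk : π.ker = θ.ker := by
    ext u
    rw [MonoidHom.mem_ker, MonoidHom.mem_ker, hker, ← mulClass_eq_one_iff (e := e),
      ← Subtype.coe_inj]
    rfl
  let φ := (QuotientGroup.quotientKerEquivOfSurjective π hπ).symm.trans
    ((QuotientGroup.quotientMulEquivOfEq hk).trans
      (QuotientGroup.quotientKerEquivOfSurjective θ hθ))
  refine ⟨φ, fun u => ?_⟩
  have : (QuotientGroup.quotientKerEquivOfSurjective π hπ).symm (π u) = QuotientGroup.mk u := by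
    rw [MulEquiv.symm_apply_eq]; rfl
  change (QuotientGroup.quotientKerEquivOfSurjective θ hθ)
    (QuotientGroup.quotientMulEquivOfEq hk
      ((QuotientGroup.quotientKerEquivOfSurjective π hπ).symm (π u))) = _
  rw [this]
  rfl

theorem sameUpToIso_hyperplaneSet [Nontrivial A] (e : A ≃ₗ[K] (Fin 3 → K)) {G : Type*} [Group G]
    (θ : Aˣ →* G)
    (hθ : Function.Surjective θ) (hker : ∀ u : Aˣ, θ u = 1 ↔ ∃ c : K, (u : A) = c • 1)
    {lam : Module.Dual K A} {T : Set G} (hT : ∀ x, x ∈ T ↔ ∃ u : Aˣ, lam u = 0 ∧ θ u = x) :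
    SameUpToIso (hyperplaneSet e lam) T := by
  obtain ⟨φ, hφ⟩ := exists_torus_equiv e θ hθ hker
  refine ⟨φ, 1, ?_⟩
  rw [one_smul]
  ext x
  rw [hT]
  constructor
  · rintro ⟨⟨g, hg⟩, ⟨u, hu, h⟩, rfl⟩
    obtain rfl : g = _ := hu
    exact ⟨u, h, (hφ u).symm⟩
  · rintro ⟨u, h, rfl⟩
    exact ⟨_, ⟨u, rfl, h⟩, hφ u⟩

end pairs

theorem exists_ne_zero_ne_one [Finite K] (h : Nat.card K ≠ 2) : ∃ d : K, d ≠ 0 ∧ d ≠ 1 := by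
  by_contra! hd
  apply h
  rw [Nat.card_eq_two_iff]
  refine ⟨0, 1, zero_ne_one, ?_⟩
  ext d
  simpa using or_iff_not_imp_left.2 (hd d)

/-! ### The algebra `K[X] / (X ^ 3)` -/

/-- Truncated polynomials `a + b X + c X ^ 2`. -/
@[ext] structure Jet (K : Type*) where
  /-- constant coefficient -/
  a : K
  /-- linear coefficient -/
  b : K
  /-- quadratic coefficient -/
  c : K

namespace Jet

instance : Zero (Jet K) := ⟨⟨0, 0, 0⟩⟩
instance : One (Jet K) := ⟨⟨1, 0, 0⟩⟩
instance : Add (Jet K) := ⟨fun x y => ⟨x.a + y.a, x.b + y.b, x.c + y.c⟩⟩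
instance : Neg (Jet K) := ⟨fun x => ⟨-x.a, -x.b, -x.c⟩⟩
instance : Mul (Jet K) :=
  ⟨fun x y => ⟨x.a * y.a, x.a * y.b + x.b * y.a, x.a * y.c + x.b * y.b + x.c * y.a⟩⟩
instance : SMul K (Jet K) := ⟨fun k x => ⟨k * x.a, k * x.b, k * x.c⟩⟩

@[simp] theorem zero_a : (0 : Jet K).a = 0 := rfl
@[simp] theorem zero_b : (0 : Jet K).b = 0 := rfl
@[simp] theorem zero_c : (0 : Jet K).c = 0 := rfl
@[simp] theorem one_a : (1 : Jet K).a = 1 := rfl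
@[simp] theorem one_b : (1 : Jet K).b = 0 := rfl
@[simp] theorem one_c : (1 : Jet K).c = 0 := rfl
@[simp] theorem add_a (x y : Jet K) : (x + y).a = x.a + y.a := rfl
@[simp] theorem add_b (x y : Jet K) : (x + y).b = x.b + y.b := rfl
@[simp] theorem add_c (x y : Jet K) : (x + y).c = x.c + y.c := rfl
@[simp] theorem neg_a (x : Jet K) : (-x).a = -x.a := rfl
@[simp] theorem neg_b (x : Jet K) : (-x).b = -x.b := rfl
@[simp] theorem neg_c (x : Jet K) : (-x).c = -x.c := rfl
@[simp] theorem mul_a (x y : Jet K) : (x * y).a = x.a * y.a := rfl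
@[simp] theorem mul_b (x y : Jet K) : (x * y).b = x.a * y.b + x.b * y.a := rfl
@[simp] theorem mul_c (x y : Jet K) : (x * y).c = x.a * y.c + x.b * y.b + x.c * y.a := rfl
@[simp] theorem smul_a (k : K) (x : Jet K) : (k • x).a = k * x.a := rfl
@[simp] theorem smul_b (k : K) (x : Jet K) : (k • x).b = k * x.b := rfl
@[simp] theorem smul_c (k : K) (x : Jet K) : (k • x).c = k * x.c := rfl

instance : CommRing (Jet K) where
  add_assoc _ _ _ := by ext <;> simp [add_assoc]
  zero_add _ := by ext <;> simp
  add_zero _ := by ext <;> simp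
  add_comm _ _ := by ext <;> simp [add_comm]
  neg_add_cancel _ := by ext <;> simp
  nsmul := nsmulRec
  zsmul := zsmulRec
  mul_assoc _ _ _ := by ext <;> simp <;> ring
  one_mul _ := by ext <;> simp
  mul_one _ := by ext <;> simp
  zero_mul _ := by ext <;> simp
  mul_zero _ := by ext <;> simp
  left_distrib _ _ _ := by ext <;> simp <;> ring
  right_distrib _ _ _ := by ext <;> simp <;> ring
  mul_comm _ _ := by ext <;> simp <;> ring

instance : Module K (Jet K) where
  one_smul _ := by ext <;> simp
  mul_smul _ _ _ := by ext <;> simp [mul_assoc]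
  smul_zero _ := by ext <;> simp
  smul_add _ _ _ := by ext <;> simp [mul_add]
  add_smul _ _ _ := by ext <;> simp [add_mul]
  zero_smul _ := by ext <;> simp

instance : Algebra K (Jet K) :=
  Algebra.ofModule (fun _ _ _ => by ext <;> simp <;> ring) (fun _ _ _ => by ext <;> simp <;> ring)

instance : Nontrivial (Jet K) := ⟨0, 1, fun h => zero_ne_one (congrArg Jet.a h)⟩

variable (K) in
/-- Coordinates, highest degree first. -/
def toFun3 : Jet K ≃ₗ[K] (Fin 3 → K) where
  toFun x := ![x.c, x.b, x.a]
  invFun v := ⟨v 2, v 1, v 0⟩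
  map_add' _ _ := by ext i; fin_cases i <;> simp
  map_smul' _ _ := by ext i; fin_cases i <;> simp
  left_inv _ := rfl
  right_inv _ := by ext i; fin_cases i <;> simp

theorem toFun3_apply (x : Jet K) : toFun3 K x = ![x.c, x.b, x.a] := rfl

theorem unit_a_ne_zero (u : (Jet K)ˣ) : u.val.a ≠ 0 := by
  intro h
  have := congrArg Jet.a u.mul_inv
  rw [mul_a, h, zero_mul, one_a] at this
  exact zero_ne_one this

/-- Units of the algebra. -/
def mkUnit (x : Jet K) (hx : x.a ≠ 0) : (Jet K)ˣ :=
  ⟨x, ⟨x.a⁻¹, -x.b / x.a ^ 2, x.b ^ 2 / x.a ^ 3 - x.c / x.a ^ 2⟩,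
    by ext <;> simp <;> field_simp <;> ring, by ext <;> simp <;> field_simp <;> ring⟩

@[simp] theorem mkUnit_val (x : Jet K) (hx : x.a ≠ 0) : (mkUnit x hx : Jet K) = x := rfl

theorem scalar_iff {x : Jet K} : (∃ c : K, x = c • 1) ↔ x.b = 0 ∧ x.c = 0 := by
  constructor
  · rintro ⟨c, rfl⟩; simp
  · rintro ⟨hb, hc⟩
    exact ⟨x.a, by ext <;> simp [hb, hc]⟩

variable (K) in
/-- The quadratic coefficient as a linear functional. -/
def cCoeff : Module.Dual K (Jet K) where
  toFun x := x.c
  map_add' _ _ := rfl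
  map_smul' _ _ := rfl

theorem cCoeff_apply (x : Jet K) : cCoeff K x = x.c := rfl

/-- In the basis 1, X, X² the pairing is triangular about the antidiagonal with ones on it, hence
nondegenerate. -/
theorem twist_cCoeff_injective : Function.Injective (twist (cCoeff K)) := by
  rw [← LinearMap.ker_eq_bot, LinearMap.ker_eq_bot']
  intro m h
  have h0 := LinearMap.congr_fun h ⟨1, 0, 0⟩
  have h1 := LinearMap.congr_fun h ⟨0, 1, 0⟩
  have h2 := LinearMap.congr_fun h ⟨0, 0, 1⟩
  simp only [twist_apply, cCoeff_apply, mul_c, LinearMap.zero_apply, mul_zero, mul_one, zero_add,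
    add_zero] at h0 h1 h2
  ext <;> assumption

theorem nonunitsMoved : NonunitsMoved K (Jet K) := by
  intro v _ hv
  have ha : v.a = 0 := by
    by_contra ha
    exact hv (mkUnit v ha).isUnit
  -- The unit 1 + X² fixes every multiple of X, because X³ = 0.
  refine ⟨mkUnit ⟨1, 0, 1⟩ one_ne_zero, fun c hc => ?_, 1, ?_⟩
  · have := congrArg Jet.c hc
    simp at this
  · ext <;> simp [ha]

end Jet

/-- With the highest degree listed first, multiplication by X is the upper shift N, and the matrices
in question are the polynomials r + aN + bN². -/
theorem unipotentGroup_eq_torus : unipotentGroup (1 : K) 1 = torus (Jet.toFun3 K) := by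
  ext x
  obtain ⟨g, rfl⟩ := mk_surjective x
  rw [mem_unipotentGroup, mem_torus]
  have key : ∀ a : Jet K, (∀ x, g.val *ᵥ Jet.toFun3 K x = Jet.toFun3 K (a * x)) ↔
      g.val = !![a.a, a.b * 1, a.c; 0, a.a, a.b * 1; 0, 0, a.a] := by
    intro a
    have h : ∀ x, !![a.a, a.b * 1, a.c; 0, a.a, a.b * 1; 0, 0, a.a] *ᵥ Jet.toFun3 K x =
        Jet.toFun3 K (a * x) := by
      intro x
      ext i
      fin_cases i <;> simp [Jet.toFun3_apply, mulVec, add_assoc]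
    refine ⟨fun hg => GL_ext_mulVec (Jet.toFun3 K) fun v => by rw [hg, h], fun hg => hg ▸ h⟩
  simp only [key]
  exact ⟨fun ⟨r, a, b, h⟩ => ⟨⟨r, a, b⟩, h⟩, fun ⟨x, h⟩ => ⟨x.a, x.b, x.c, h⟩⟩

/-! ### Odd characteristic: logarithm coordinates -/

/-- Logarithmic coordinates of a unit, with the second one scaled by `-2`. -/
noncomputable def jetLog : (Jet K)ˣ →* Multiplicative (K × K) :=
  MonoidHom.mk' (fun u => Multiplicative.ofAdd
    (u.val.b / u.val.a, (u.val.b / u.val.a) ^ 2 - 2 * (u.val.c / u.val.a))) (by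
    intro u v
    have hu := Jet.unit_a_ne_zero u
    have hv := Jet.unit_a_ne_zero v
    rw [← ofAdd_add]
    congr 1
    ext
    · simp; field_simp; ring
    · simp; field_simp; ring)

theorem jetLog_apply (u : (Jet K)ˣ) : jetLog u = Multiplicative.ofAdd
    (u.val.b / u.val.a, (u.val.b / u.val.a) ^ 2 - 2 * (u.val.c / u.val.a)) := rfl

theorem jetLog_surjective (h2 : (2 : K) ≠ 0) : Function.Surjective (jetLog (K := K)) := by
  intro x
  obtain ⟨⟨s, t⟩, rfl⟩ := Multiplicative.ofAdd.surjective x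
  refine ⟨Jet.mkUnit ⟨1, s, (s ^ 2 - t) / 2⟩ one_ne_zero, ?_⟩
  rw [jetLog_apply]
  congr 1
  ext
  · simp
  · simp; field_simp; ring

theorem jetLog_eq_one_iff (h2 : (2 : K) ≠ 0) (u : (Jet K)ˣ) :
    jetLog u = 1 ↔ ∃ c : K, (u : Jet K) = c • 1 := by
  have hu := Jet.unit_a_ne_zero u
  rw [jetLog_apply, ofAdd_eq_one, Jet.scalar_iff, Prod.mk_eq_zero]
  constructor
  · rintro ⟨hb, hc⟩
    rw [hb] at hc
    refine ⟨by simpa [hu] using hb, by simpa [hu, h2] using hc⟩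
  · rintro ⟨hb, hc⟩
    simp [hb, hc]

theorem two_ne_zero_of_odd [Finite K] (h : Odd (Nat.card K)) : (2 : K) ≠ 0 := by
  have : Fintype K := Fintype.ofFinite K
  refine Ring.two_ne_zero fun hc => ?_
  have := FiniteField.even_card_of_char_two hc
  rw [Nat.card_eq_fintype_card, Nat.odd_iff] at h
  omega

theorem unipotent_equiv_of_odd [Finite K] (h : Odd (Nat.card K)) :
    Nonempty (unipotentGroup (1 : K) 1 ≃* Multiplicative (K × K)) := by
  have h2 := two_ne_zero_of_odd h
  rw [unipotentGroup_eq_torus]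
  obtain ⟨φ, -⟩ := exists_torus_equiv (Jet.toFun3 K) jetLog (jetLog_surjective h2)
    (jetLog_eq_one_iff h2)
  exact ⟨φ⟩

/-- Since log(1 + sX + tX²) = sX + (t − s²/2)X², scaling the second coordinate by −2 sends the
hyperplane t = 0 exactly to the parabola (s, s²). -/
theorem unipotent_pairs_of_odd [Finite K] (h : Odd (Nat.card K)) :
    SomePairYields (unipotentGroup (1 : K) 1) (fun S => SameUpToIso S (erdosTuran K)) ∧
      EveryPairYields (unipotentGroup (1 : K) 1) (fun S => SameUpToIso S (erdosTuran K)) := by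
  have h2 := two_ne_zero_of_odd h
  rw [unipotentGroup_eq_torus]
  have := torus_pairs (e := Jet.toFun3 K) Jet.twist_cCoeff_injective
    (P := fun S => SameUpToIso S (erdosTuran K)) (fun t => SameUpToIso.smul
      (sameUpToIso_hyperplaneSet _ jetLog (jetLog_surjective h2) (jetLog_eq_one_iff h2) (by
        intro x
        constructor
        · rintro ⟨s, rfl⟩
          refine ⟨Jet.mkUnit ⟨1, s, 0⟩ one_ne_zero, rfl, ?_⟩
          rw [jetLog_apply]; simp
        · rintro ⟨u, hu, rfl⟩
          rw [Jet.cCoeff_apply] at hu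
          refine ⟨u.val.b / u.val.a, ?_⟩
          rw [jetLog_apply, hu]; simp)) t)
  exact ⟨this.1, this.2 Jet.nonunitsMoved⟩

/-! ### Counting in the unipotent group -/

variable (K) in
-- Each class has exactly one representative with constant coefficient 1.
theorem bijective_jet :
    Function.Bijective (fun x : K × K => (⟨mulClass (Jet.toFun3 K)
      (Jet.mkUnit ⟨1, x.1, x.2⟩ one_ne_zero), mulClass_mem _ _⟩ : torus (Jet.toFun3 K))) := by
  constructor
  · rintro ⟨x, y⟩ ⟨x', y'⟩ h
    obtain ⟨c, -, hc⟩ := mulClass_eq_iff.1 (congrArg Subtype.val h)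
    simp only [Jet.mkUnit_val, Jet.ext_iff, Jet.smul_a, Jet.smul_b, Jet.smul_c, mul_one] at hc
    obtain ⟨rfl, h1, h2⟩ := hc
    simp [h1, h2]
  · rintro ⟨_, u, rfl⟩
    have hu := Jet.unit_a_ne_zero u
    refine ⟨⟨u.val.b / u.val.a, u.val.c / u.val.a⟩, Subtype.ext ?_⟩
    refine mulClass_eq_iff.2 ⟨u.val.a, hu, ?_⟩
    ext <;> simp <;> field_simp

theorem card_unipotent [Finite K] : Nat.card (unipotentGroup (1 : K) 1) = Nat.card K ^ 2 := by
  rw [unipotentGroup_eq_torus, ← Nat.card_eq_of_bijective _ (bijective_jet K), Nat.card_prod, sq]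

theorem ncard_hyperplaneSet_jet :
    (hyperplaneSet (Jet.toFun3 K) (Jet.cCoeff K)).ncard = Nat.card K := by
  have : hyperplaneSet (Jet.toFun3 K) (Jet.cCoeff K) = Set.range (fun x : K =>
      (⟨mulClass (Jet.toFun3 K) (Jet.mkUnit ⟨1, x, 0⟩ one_ne_zero), mulClass_mem _ _⟩ :
        torus (Jet.toFun3 K))) := by
    ext ⟨g, hg⟩
    constructor
    · rintro ⟨u, hu, h⟩
      obtain rfl : g = _ := hu
      have ha := Jet.unit_a_ne_zero u
      rw [Jet.cCoeff_apply] at h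
      refine ⟨u.val.b / u.val.a, Subtype.ext (mulClass_eq_iff.2 ⟨u.val.a, ha, ?_⟩)⟩
      ext <;> simp [h]; field_simp
    · rintro ⟨x, hx⟩
      exact ⟨_, (congrArg Subtype.val hx).symm, rfl⟩
  rw [this, ← Set.image_univ, Set.ncard_image_of_injective, Set.ncard_univ]
  intro x y h
  have := (bijective_jet K).1 (a₁ := (x, 0)) (a₂ := (y, 0)) h
  exact congrArg Prod.fst this

theorem unipotent_pairs_ncard :
    SomePairYields (unipotentGroup (1 : K) 1) (fun S => S.ncard = Nat.card K) ∧
      EveryPairYields (unipotentGroup (1 : K) 1) (fun S => S.ncard = Nat.card K) := by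
  rw [unipotentGroup_eq_torus]
  have := torus_pairs (e := Jet.toFun3 K) Jet.twist_cCoeff_injective
    (P := fun S => S.ncard = Nat.card K) (fun t => by
      rw [← ncard_hyperplaneSet_jet]
      exact Set.ncard_image_of_injective _ (MulAction.injective t))
  exact ⟨this.1, this.2 Jet.nonunitsMoved⟩

/-! ### Characteristic two -/

/-- The ratio of the linear and the constant coefficient, on the torus. -/
theorem exists_jetSlope : ∃ β : torus (Jet.toFun3 K) →* Multiplicative K,
    (∀ u, β ⟨mulClass (Jet.toFun3 K) u, mulClass_mem _ u⟩ =
      Multiplicative.ofAdd (u.val.b / u.val.a)) := by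
  let β₀ : (Jet K)ˣ →* Multiplicative K :=
    MonoidHom.mk' (fun u => Multiplicative.ofAdd (u.val.b / u.val.a)) (by
      intro u v
      have hu := Jet.unit_a_ne_zero u
      have hv := Jet.unit_a_ne_zero v
      rw [← ofAdd_add]
      congr 1
      simp; field_simp; ring)
  let π : (Jet K)ˣ →* torus (Jet.toFun3 K) := (mulClass (Jet.toFun3 K)).rangeRestrict
  have hπ : Function.Surjective π := (mulClass (Jet.toFun3 K)).rangeRestrict_surjective
  have hk : π.ker ≤ β₀.ker := by
    intro u hu
    rw [MonoidHom.mem_ker, ← Subtype.coe_inj] at hu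
    change mulClass (Jet.toFun3 K) u = 1 at hu
    rw [mulClass_eq_one_iff, Jet.scalar_iff] at hu
    change Multiplicative.ofAdd _ = _
    rw [hu.1]; simp
  let β := π.liftOfSurjective hπ ⟨β₀, hk⟩
  exact ⟨β, fun u => π.liftOfRightInverse_comp_apply _ (Function.rightInverse_surjInv hπ) ⟨β₀, hk⟩ u⟩

/-- In characteristic two (a + bX + cX²)² = a² + b²X², which is scalar exactly when b = 0. -/
theorem jet_sq_eq_one_iff [CharP K 2] {β : torus (Jet.toFun3 K) →* Multiplicative K}
    (hβ : ∀ u, β ⟨mulClass (Jet.toFun3 K) u, mulClass_mem _ u⟩ =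
      Multiplicative.ofAdd (u.val.b / u.val.a)) (g : torus (Jet.toFun3 K)) :
    g ^ 2 = 1 ↔ β g = 1 := by
  obtain ⟨_, u, rfl⟩ := g
  have hu := Jet.unit_a_ne_zero u
  have h2 : (2 : K) = 0 := CharP.cast_eq_zero K 2
  change (⟨mulClass (Jet.toFun3 K) u, mulClass_mem _ u⟩ : torus (Jet.toFun3 K)) ^ 2 = 1 ↔
    β ⟨mulClass (Jet.toFun3 K) u, mulClass_mem _ u⟩ = 1
  rw [hβ, ← Subtype.coe_inj, Subgroup.coe_pow, Subgroup.coe_one, ← map_pow,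
    mulClass_eq_one_iff, Jet.scalar_iff, ofAdd_eq_one, div_eq_zero_iff, or_iff_left hu,
    Units.val_pow_eq_pow_val, sq, Jet.mul_b, Jet.mul_c]
  have e1 : u.val.a * u.val.b + u.val.b * u.val.a = 0 := by linear_combination u.val.a * u.val.b * h2
  have e2 : u.val.a * u.val.c + u.val.b * u.val.b + u.val.c * u.val.a = u.val.b ^ 2 := by
    linear_combination u.val.a * u.val.c * h2
  rw [e1, e2]
  simp

/-- Lift an 𝔽₂-basis of K through the slope map b/a, whose kernel is the 2-torsion, and map (ℤ/4)ᵈ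
to the group by these lifts. An element k of the kernel has even coordinates by independence of the
slopes; writing k = 2m, the image of m is 2-torsion, so m is even as well and k = 0. Both sides have
4ᵈ = q² elements. -/
theorem unipotent_equiv_of_card_two_pow [Finite K] {d : ℕ} (hd : Nat.card K = 2 ^ d) :
    Nonempty (unipotentGroup (1 : K) 1 ≃* Multiplicative (Fin d → ZMod 4)) := by
  have hcard : Nat.card (torus (Jet.toFun3 K)) = Nat.card K ^ 2 := by
    rw [← unipotentGroup_eq_torus, card_unipotent]
  rw [unipotentGroup_eq_torus]
  have := Fintype.ofFinite K
  have hd0 : d ≠ 0 := by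
    rintro rfl
    have := Finite.one_lt_card (α := K)
    omega
  have : CharP K 2 := by
    have : ringChar K = 2 := FiniteField.even_card_iff_char_two.2 (by
      rw [← Nat.card_eq_fintype_card, hd, ← Nat.even_iff]
      exact (Nat.even_pow.2 ⟨even_two, hd0⟩))
    exact this ▸ ringChar.charP K
  let : Algebra (ZMod 2) K := ZMod.algebra K 2
  have hfr : Module.finrank (ZMod 2) K = d := by
    have h := Module.card_eq_pow_finrank (K := ZMod 2) (V := K)
    rw [← Nat.card_eq_fintype_card, hd, ZMod.card] at h
    exact (Nat.pow_right_injective le_rfl h).symm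
  let bas : Module.Basis (Fin d) (ZMod 2) K := Module.finBasisOfFinrankEq _ _ hfr
  obtain ⟨β, hβ⟩ := exists_jetSlope (K := K)
  let : CommGroup (torus (Jet.toFun3 K)) := { mul_comm := mul_comm' }
  let γ : Additive (torus (Jet.toFun3 K)) →+ K := MonoidHom.toAdditive β
  have hsq : ∀ g : Additive (torus (Jet.toFun3 K)), 2 • g = 0 ↔ γ g = 0 := fun g =>
    jet_sq_eq_one_iff hβ g.toMul
  have h2 : (2 : K) = 0 := CharP.cast_eq_zero K 2
  have h4 : ∀ g : Additive (torus (Jet.toFun3 K)), 4 • g = 0 := fun g => by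
    rw [show 4 = 2 * 2 from rfl, mul_smul, hsq, map_nsmul, nsmul_eq_mul, Nat.cast_two, h2, zero_mul]
  let : Module (ZMod 4) (Additive (torus (Jet.toFun3 K))) := AddCommGroup.zmodModule h4
  let v : Fin d → Additive (torus (Jet.toFun3 K)) := fun i => Additive.ofMul
    ⟨mulClass (Jet.toFun3 K) (Jet.mkUnit ⟨1, bas i, 0⟩ one_ne_zero), mulClass_mem _ _⟩
  have hv : ∀ i, γ (v i) = bas i := fun i => by
    refine (congrArg Multiplicative.toAdd
      (hβ (Jet.mkUnit ⟨1, bas i, 0⟩ one_ne_zero))).trans ?_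
    simp
  let F := Fintype.linearCombination (ZMod 4) v
  have hγF : ∀ k : Fin d → ZMod 4, γ (F k) = 0 → ∀ i, Even (k i).val := by
    intro k hk
    have hF : F k = ∑ i, (k i).val • v i := by
      rw [Fintype.linearCombination_apply]
      refine Finset.sum_congr rfl fun i _ => ?_
      conv_lhs => rw [← ZMod.natCast_zmod_val (k i)]
      exact Nat.cast_smul_eq_nsmul (ZMod 4) _ _
    rw [hF, map_sum] at hk
    simp only [map_nsmul, hv] at hk
    have hk' : ∑ i, ((k i).val : ZMod 2) • bas i = 0 := by
      rw [← hk]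
      exact Finset.sum_congr rfl fun i _ => Nat.cast_smul_eq_nsmul (ZMod 2) _ _
    intro i
    have := Fintype.linearIndependent_iff.1 bas.linearIndependent _ hk' i
    rwa [ZMod.natCast_eq_zero_iff, ← even_iff_two_dvd] at this
  have hF : Function.Injective F := by
    rw [← LinearMap.ker_eq_bot, LinearMap.ker_eq_bot']
    intro k hk
    have h1 := hγF k (by rw [hk, map_zero])
    have hhalf : k = 2 • (fun i => (((k i).val / 2 : ℕ) : ZMod 4)) := by
      ext1 i
      rw [Pi.smul_apply, nsmul_eq_mul, ← Nat.cast_mul, Nat.mul_div_cancel' (h1 i).two_dvd,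
        ZMod.natCast_zmod_val]
    set m : Fin d → ZMod 4 := fun i => (((k i).val / 2 : ℕ) : ZMod 4)
    rw [hhalf, map_nsmul, hsq] at hk
    have hm := hγF m hk
    rw [hhalf]
    ext1 i
    obtain ⟨t, ht⟩ := hm i
    rw [Pi.smul_apply, Pi.zero_apply, ← ZMod.natCast_zmod_val (m i), ht, nsmul_eq_mul,
      ← Nat.cast_mul, ZMod.natCast_eq_zero_iff]
    omega
  have hfin : Finite (torus (Jet.toFun3 K)) := Nat.finite_of_card_ne_zero (by
    rw [hcard, hd]; positivity)
  have hfin' : Finite (Additive (torus (Jet.toFun3 K))) := hfin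
  have hbij : Function.Bijective F := by
    refine (Nat.bijective_iff_injective_and_card F).2 ⟨hF, ?_⟩
    change _ = Nat.card (torus (Jet.toFun3 K))
    rw [hcard, hd, Nat.card_fun, Nat.card_zmod, Nat.card_fin, ← pow_mul, mul_comm, pow_mul]
    norm_num
  let E : (Fin d → ZMod 4) ≃+ Additive (torus (Jet.toFun3 K)) :=
    AddEquiv.ofBijective F.toAddMonoidHom hbij
  exact ⟨
    { toFun := fun g => Multiplicative.ofAdd (E.symm (Additive.ofMul g))
      invFun := fun w => (E w.toAdd).toMul
      left_inv := fun g => E.apply_symm_apply (Additive.ofMul g)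
      right_inv := fun w => E.symm_apply_apply w.toAdd
      map_mul' := fun g h => E.symm.map_add (Additive.ofMul g) (Additive.ofMul h) }⟩

/-! ### The elementary abelian unipotent groups -/

theorem unipotent_equiv_prod {x y : K} (hxy : x * y = 0) (h : x ≠ 0 ∨ y ≠ 0) :
    Nonempty (unipotentGroup x y ≃* Multiplicative (K × K)) := by
  let f : Multiplicative (K × K) →* Matrix (Fin 3) (Fin 3) K :=
    { toFun := fun v => !![1, v.toAdd.1 * x, v.toAdd.2; 0, 1, v.toAdd.1 * y; 0, 0, 1]
      map_one' := by ext i j; fin_cases i <;> fin_cases j <;> simp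
      map_mul' := fun v w => by
        ext i j; fin_cases i <;> fin_cases j <;>
          simp [Matrix.mul_apply, Fin.sum_univ_three, add_mul]
        · ring
        -- The corner entry picks up a term with factor xy, the only obstruction to additivity.
        · linear_combination (-v.toAdd.1 * w.toAdd.1) * hxy
        · ring }
  let F : Multiplicative (K × K) →* PGL(3, K) := mk.comp f.toHomUnits
  have hF : Function.Injective F := by
    rw [injective_iff_map_eq_one]
    intro v hv
    obtain ⟨c, hc⟩ := mk_eq_one_iff.1 hv
    have hc' : ∀ i j, f v i j = (c • (1 : Matrix (Fin 3) (Fin 3) K)) i j :=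
      fun i j => congrFun (congrFun hc i) j
    have h1 := hc' 0 1
    have h2 := hc' 1 2
    have h3 := hc' 0 2
    simp [f] at h1 h2 h3
    apply Multiplicative.toAdd.injective
    ext
    · rcases h with h | h
      · simpa [h] using h1
      · simpa [h] using h2
    · exact h3
  have hr : F.range = unipotentGroup x y := by
    ext g
    constructor
    · rintro ⟨v, rfl⟩
      exact mem_unipotentGroup.2 ⟨1, v.toAdd.1, v.toAdd.2, rfl⟩
    · rintro ⟨g, ⟨a, b, hg⟩, rfl⟩
      refine ⟨Multiplicative.ofAdd (a, b), ?_⟩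
      change mk (f.toHomUnits _) = _
      congr 1
      exact Units.ext hg.symm
  exact ⟨((MonoidHom.ofInjective hF).trans (MulEquiv.subgroupCongr hr)).symm⟩

/-! ### Cubic extensions -/

/-- If lam(m·) = 0 with m ≠ 0, evaluating at m⁻¹x shows lam = 0. -/
theorem twist_injective_of_field {L : Type*} [Field L] [Algebra K L] {lam : Module.Dual K L}
    (h : lam ≠ 0) : Function.Injective (twist lam) := by
  rw [← LinearMap.ker_eq_bot, LinearMap.ker_eq_bot']
  intro m hm
  by_contra hm0
  apply h
  ext x
  have := LinearMap.congr_fun hm (m⁻¹ * x)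
  rwa [twist_apply, mul_inv_cancel_left₀ hm0] at this

theorem exists_dual_ker_eq {V : Type*} [AddCommGroup V] [Module K V] [FiniteDimensional K V]
    (D : Submodule K V) (hD : Module.finrank K D + 1 = Module.finrank K V) :
    ∃ f : Module.Dual K V, f ≠ 0 ∧ ∀ x, f x = 0 ↔ x ∈ D := by
  obtain ⟨f, hf, hDf⟩ := Submodule.exists_le_ker_of_lt_top D (by
    rw [lt_top_iff_ne_top]
    rintro rfl
    rw [finrank_top] at hD
    omega)
  refine ⟨f, hf, fun x => ?_⟩
  rw [Submodule.eq_of_le_of_finrank_le hDf, LinearMap.mem_ker]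
  have := Module.Dual.finrank_ker_add_one_of_ne_zero hf
  omega

section cubic

variable {L : Type*} [Field L] [Algebra K L]

theorem quotient_kernel (u : Lˣ) :
    QuotientGroup.mk' (Units.map (algebraMap K L : K →* L)).range u = 1 ↔
      ∃ c : K, (u : L) = c • 1 := by
  rw [← MonoidHom.mem_ker, QuotientGroup.ker_mk']
  constructor
  · rintro ⟨c, rfl⟩
    exact ⟨c, by simp [Algebra.algebraMap_eq_smul_one]⟩
  · rintro ⟨c, hc⟩
    have hc0 : c ≠ 0 := by rintro rfl; simp at hc
    exact ⟨Units.mk0 c hc0, Units.ext (by simp [hc, Algebra.algebraMap_eq_smul_one])⟩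

theorem cubic_equiv (e : L ≃ₗ[K] (Fin 3 → K)) : Nonempty (torus e ≃* UnitsMod K L) := by
  obtain ⟨φ, -⟩ := exists_torus_equiv e
    (QuotientGroup.mk' (Units.map (algebraMap K L : K →* L)).range)
    (QuotientGroup.mk'_surjective _) quotient_kernel
  exact ⟨φ⟩

theorem cubic_isCyclic [Finite L] (e : L ≃ₗ[K] (Fin 3 → K)) : IsCyclic (torus e) :=
  isCyclic_of_surjective _ (mulClass e).rangeRestrict_surjective

theorem cubic_pairs (e : L ≃ₗ[K] (Fin 3 → K)) (hL : Module.finrank K L = 3)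
    (D : Submodule K L) (hD : Module.finrank K D = 2) :
    SomePairYields (torus e) (fun S => SameUpToIso S (singer D)) ∧
      EveryPairYields (torus e) (fun S => SameUpToIso S (singer D)) := by
  have : FiniteDimensional K L := Module.finite_of_finrank_pos (by omega)
  obtain ⟨f, hf, hfD⟩ := exists_dual_ker_eq D (by omega)
  have := torus_pairs (e := e) (twist_injective_of_field hf)
    (P := fun S => SameUpToIso S (singer D)) (fun t => SameUpToIso.smul
      (sameUpToIso_hyperplaneSet e (QuotientGroup.mk' _)
        (QuotientGroup.mk'_surjective _) quotient_kernel (by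
          intro x
          simp only [hfD]
          constructor
          · rintro ⟨u, hu, rfl⟩; exact ⟨u, hu, rfl⟩
          · rintro ⟨u, hu, rfl⟩; exact ⟨u, hu, rfl⟩)) t)
  exact ⟨this.1, this.2 fun v hv hv' => absurd hv.isUnit hv'⟩

theorem card_cubic [Finite K] (e : L ≃ₗ[K] (Fin 3 → K)) (hL : Module.finrank K L = 3) :
    Nat.card (torus e) = Nat.card K ^ 2 + Nat.card K + 1 := by
  have : FiniteDimensional K L := Module.finite_of_finrank_pos (by omega)
  have : Finite L := Module.finite_of_finite K
  obtain ⟨φ⟩ := cubic_equiv e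
  rw [Nat.card_congr φ.toEquiv]
  have h1 := Subgroup.card_eq_card_quotient_mul_card_subgroup
    (Units.map (algebraMap K L : K →* L)).range
  have hinj : Function.Injective (Units.map (algebraMap K L : K →* L)) :=
    Units.map_injective (algebraMap K L).injective
  rw [← Nat.card_congr (MonoidHom.ofInjective hinj).toEquiv, Nat.card_units, Nat.card_units,
    Module.natCard_eq_pow_finrank (K := K) (V := L), hL] at h1
  have hq := Finite.one_lt_card (α := K)
  obtain ⟨m, hm⟩ : ∃ m, Nat.card K = m + 1 := ⟨Nat.card K - 1, by omega⟩
  rw [hm] at h1 hq ⊢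
  -- The order is (q³ − 1)/(q − 1), with m = q − 1.
  refine Nat.eq_of_mul_eq_mul_right (show 0 < m by omega) ?_
  rw [Nat.add_sub_cancel] at h1
  rw [← h1]
  have : (m + 1) ^ 3 = ((m + 1) ^ 2 + (m + 1) + 1) * m + 1 := by ring
  omega

end cubic

/-! ### Quadratic extensions -/

section quadratic

variable {L : Type*} [Field L] [Algebra K L]

variable (K L) in
/-- The homomorphism `(x, c) ↦ x / c`. -/
noncomputable def quadraticRatio : (L × K)ˣ →* Lˣ :=
  Units.map (RingHom.fst L K : L × K →* L) /
    Units.map (((algebraMap K L).comp (RingHom.snd L K) : L × K →+* L) : L × K →* L)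

theorem quadraticRatio_val (u : (L × K)ˣ) :
    ((quadraticRatio K L u : Lˣ) : L) = u.val.1 / algebraMap K L u.val.2 := by
  rw [quadraticRatio, MonoidHom.div_apply, Units.val_div_eq_div_val]
  rfl

theorem unit_prod_ne_zero {B C : Type*} [CommRing B] [CommRing C] [Nontrivial B] [Nontrivial C]
    (u : (B × C)ˣ) : u.val.1 ≠ 0 ∧ u.val.2 ≠ 0 :=
  ⟨(Prod.isUnit_iff.1 u.isUnit).1.ne_zero, (Prod.isUnit_iff.1 u.isUnit).2.ne_zero⟩

/-- A unit of a product of fields. -/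
def prodUnit {B C : Type*} [Field B] [Field C] (x : B) (y : C) (hx : x ≠ 0) (hy : y ≠ 0) :
    (B × C)ˣ := MulEquiv.prodUnits.symm (Units.mk0 x hx, Units.mk0 y hy)

@[simp] theorem prodUnit_val {B C : Type*} [Field B] [Field C] (x : B) (y : C) (hx : x ≠ 0)
    (hy : y ≠ 0) : (prodUnit x y hx hy : B × C) = (x, y) := rfl

theorem quadraticRatio_surjective : Function.Surjective (quadraticRatio K L) := by
  intro x
  refine ⟨prodUnit x 1 x.ne_zero one_ne_zero, Units.ext ?_⟩
  rw [quadraticRatio_val]; simp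

theorem quadraticRatio_eq_one_iff (u : (L × K)ˣ) :
    quadraticRatio K L u = 1 ↔ ∃ c : K, (u : L × K) = c • 1 := by
  have hu := unit_prod_ne_zero u
  rw [← Units.val_inj, quadraticRatio_val, Units.val_one,
    div_eq_one_iff_eq (by simpa using hu.2)]
  constructor
  · intro h
    exact ⟨u.val.2, by ext <;> simp [h, Algebra.algebraMap_eq_smul_one]⟩
  · rintro ⟨c, hc⟩
    simp [hc, Algebra.algebraMap_eq_smul_one]

theorem quadratic_equiv (e : (L × K) ≃ₗ[K] (Fin 3 → K)) : Nonempty (torus e ≃* Lˣ) := by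
  obtain ⟨φ, -⟩ := exists_torus_equiv e (quadraticRatio K L) quadraticRatio_surjective
    quadraticRatio_eq_one_iff
  exact ⟨φ⟩

theorem card_quadratic [Finite K] (e : (L × K) ≃ₗ[K] (Fin 3 → K)) (hL : Module.finrank K L = 2) :
    Nat.card (torus e) = Nat.card K ^ 2 - 1 := by
  have : FiniteDimensional K L := Module.finite_of_finrank_pos (by omega)
  have : Finite L := Module.finite_of_finite K
  obtain ⟨φ⟩ := quadratic_equiv e
  rw [Nat.card_congr φ.toEquiv, Nat.card_units, Module.natCard_eq_pow_finrank (K := K), hL]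

/-- A nonzero nonunit has a zero coordinate and is fixed by the unit that is 1 in the other
coordinate and d in that one; it is nonscalar only if d ≠ 1, which is where q ≠ 2 enters. -/
theorem nonunitsMoved_quadratic [Finite K] (h : Nat.card K ≠ 2) : NonunitsMoved K (L × K) := by
  obtain ⟨d, hd0, hd1⟩ := exists_ne_zero_ne_one h
  have hd0' : algebraMap K L d ≠ 0 := by simpa using hd0
  intro v hv0 hv
  rw [Prod.isUnit_iff, isUnit_iff_ne_zero, isUnit_iff_ne_zero] at hv
  by_cases h1 : v.1 = 0
  · refine ⟨prodUnit (algebraMap K L d) 1 hd0' one_ne_zero, fun c hc => ?_, 1, ?_⟩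
    · obtain ⟨hc1, hc2⟩ := Prod.ext_iff.1 hc
      simp only [prodUnit_val, Prod.smul_fst, Prod.smul_snd, Prod.fst_one, Prod.snd_one,
        smul_eq_mul, mul_one] at hc1 hc2
      rw [← hc2, one_smul] at hc1
      exact hd1 ((algebraMap K L).injective (by rw [hc1, map_one]))
    · ext <;> simp [h1]
  · have h2 : v.2 = 0 := by
      by_contra h2; exact hv ⟨h1, h2⟩
    refine ⟨prodUnit 1 d one_ne_zero hd0, fun c hc => ?_, 1, ?_⟩
    · obtain ⟨hc1, hc2⟩ := Prod.ext_iff.1 hc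
      simp only [prodUnit_val, Prod.smul_fst, Prod.smul_snd, Prod.fst_one, Prod.snd_one,
        smul_eq_mul, mul_one] at hc1 hc2
      rw [← hc2, ← Algebra.algebraMap_eq_smul_one] at hc1
      exact hd1 ((algebraMap K L).injective (by rw [← hc1, map_one]))
    · ext <;> simp [h2]

theorem quadratic_pairs [Finite K] (e : (L × K) ≃ₗ[K] (Fin 3 → K)) (hL : Module.finrank K L = 2)
    (D : Submodule K L) (u : L) (hD : Module.finrank K D = 1) (hu : u ∉ D) :
    SomePairYields (torus e) (fun S => SameUpToIso S (bose D u)) ∧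
      (Nat.card K ≠ 2 → EveryPairYields (torus e) (fun S => SameUpToIso S (bose D u))) := by
  have : FiniteDimensional K L := Module.finite_of_finrank_pos (by omega)
  obtain ⟨f, hf, hfD⟩ := exists_dual_ker_eq D (by omega)
  have hfu : f u ≠ 0 := fun h => hu ((hfD u).1 h)
  -- Vanishing at (x, c) with c ≠ 0 says f(x/c) = f(u), that is, x/c ∈ u + ker f = u + D.
  let lam : Module.Dual K (L × K) := f ∘ₗ LinearMap.fst K L K - f u • LinearMap.snd K L K
  have hlam_apply : ∀ x, lam x = f x.1 - f u * x.2 := fun x => rfl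
  have hlam : Function.Injective (twist lam) := by
    rw [← LinearMap.ker_eq_bot, LinearMap.ker_eq_bot']
    rintro ⟨x, c⟩ h
    have h2 := LinearMap.congr_fun h (0, 1)
    rw [twist_apply, hlam_apply] at h2
    simp [hfu] at h2
    subst h2
    have hx : twist f x = twist f 0 := by
      ext y
      have := LinearMap.congr_fun h (y, 0)
      rw [twist_apply, hlam_apply] at this
      simpa [twist_apply] using this
    rw [twist_injective_of_field hf hx]; rfl
  have := torus_pairs (e := e) hlam
    (P := fun S => SameUpToIso S (bose D u)) (fun t => SameUpToIso.smul
      (sameUpToIso_hyperplaneSet e (quadraticRatio K L) quadraticRatio_surjective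
        quadraticRatio_eq_one_iff (by
          intro x
          constructor
          · rintro ⟨d, hd, h⟩
            refine ⟨prodUnit x 1 x.ne_zero one_ne_zero, ?_, Units.ext ?_⟩
            · rw [hlam_apply, prodUnit_val, h, map_add, (hfD d).2 hd]; ring
            · rw [quadraticRatio_val]; simp
          · rintro ⟨w, hw, rfl⟩
            have hw0 := (unit_prod_ne_zero w).2
            have hw' : f w.val.1 = f u * w.val.2 := sub_eq_zero.1 hw
            refine ⟨w.val.1 / algebraMap K L w.val.2 - u, ?_, ?_⟩
            · rw [← hfD, map_sub, div_eq_mul_inv, ← map_inv₀, mul_comm, ← Algebra.smul_def,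
                map_smul, hw', smul_eq_mul]
              field_simp; ring
            · rw [quadraticRatio_val]; ring)) t)
  exact ⟨this.1, fun h => this.2 (nonunitsMoved_quadratic h)⟩

end quadratic

/-! ### Diagonal matrices -/

theorem diagonalGroup_eq_torus : diagonalGroup K = torus (LinearEquiv.refl K (Fin 3 → K)) := by
  ext x
  obtain ⟨g, rfl⟩ := mk_surjective x
  rw [mem_diagonalGroup, mem_torus]
  have h : ∀ d x : Fin 3 → K, diagonal d *ᵥ LinearEquiv.refl K (Fin 3 → K) x =
      LinearEquiv.refl K (Fin 3 → K) (d * x) := by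
    intro d x
    ext i
    simp [mulVec_diagonal]
  exact exists_congr fun d =>
    ⟨fun hg => hg ▸ h d, fun hg => GL_ext_mulVec (LinearEquiv.refl K _) fun v => by rw [hg, h]⟩

theorem unit_fun_ne_zero (u : (Fin 3 → K)ˣ) (i : Fin 3) : u.val i ≠ 0 :=
  (Pi.isUnit_iff.1 u.isUnit i).ne_zero

/-- A unit of `K³`. -/
noncomputable def funUnit (d : Fin 3 → K) (hd : ∀ i, d i ≠ 0) : (Fin 3 → K)ˣ :=
  (Pi.isUnit_iff.2 fun i => (hd i).isUnit : IsUnit d).unit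

@[simp] theorem funUnit_val (d : Fin 3 → K) (hd : ∀ i, d i ≠ 0) :
    (funUnit d hd : Fin 3 → K) = d := rfl

variable (K) in
/-- The homomorphism `(x, y, z) ↦ (x / z, y / z)`. -/
noncomputable def diagonalRatio : (Fin 3 → K)ˣ →* Kˣ × Kˣ :=
  (Units.map (Pi.evalRingHom (fun _ : Fin 3 => K) 0 : (Fin 3 → K) →* K) /
    Units.map (Pi.evalRingHom (fun _ : Fin 3 => K) 2 : (Fin 3 → K) →* K)).prod
  (Units.map (Pi.evalRingHom (fun _ : Fin 3 => K) 1 : (Fin 3 → K) →* K) /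
    Units.map (Pi.evalRingHom (fun _ : Fin 3 => K) 2 : (Fin 3 → K) →* K))

theorem diagonalRatio_fst (u : (Fin 3 → K)ˣ) :
    ((diagonalRatio K u).1 : K) = u.val 0 / u.val 2 := by
  rw [diagonalRatio, MonoidHom.prod_apply, MonoidHom.div_apply, Units.val_div_eq_div_val]
  rfl

theorem diagonalRatio_snd (u : (Fin 3 → K)ˣ) :
    ((diagonalRatio K u).2 : K) = u.val 1 / u.val 2 := by
  rw [diagonalRatio, MonoidHom.prod_apply, MonoidHom.div_apply, MonoidHom.div_apply,
    Units.val_div_eq_div_val]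
  rfl

theorem forall_fin_three_ne_zero {x y z : K} (hx : x ≠ 0) (hy : y ≠ 0) (hz : z ≠ 0) :
    ∀ i, (![x, y, z] : Fin 3 → K) i ≠ 0 := by
  intro i; fin_cases i <;> assumption

theorem diagonalRatio_surjective : Function.Surjective (diagonalRatio K) := by
  rintro ⟨x, y⟩
  refine ⟨funUnit ![x, y, 1] (forall_fin_three_ne_zero x.ne_zero y.ne_zero one_ne_zero), ?_⟩
  ext
  · rw [diagonalRatio_fst]; simp
  · rw [diagonalRatio_snd]; simp

theorem diagonalRatio_eq_one_iff (u : (Fin 3 → K)ˣ) :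
    diagonalRatio K u = 1 ↔ ∃ c : K, (u : Fin 3 → K) = c • 1 := by
  have h2 := unit_fun_ne_zero u 2
  rw [Prod.ext_iff, ← Units.val_inj, ← Units.val_inj, diagonalRatio_fst, diagonalRatio_snd,
    Prod.fst_one, Prod.snd_one, Units.val_one, div_eq_one_iff_eq h2, div_eq_one_iff_eq h2]
  constructor
  · rintro ⟨h0, h1⟩
    refine ⟨u.val 2, ?_⟩
    ext i; fin_cases i <;> simp [h0, h1]
  · rintro ⟨c, hc⟩
    simp [hc]

theorem diagonal_equiv : Nonempty (diagonalGroup K ≃* Kˣ × Kˣ) := by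
  rw [diagonalGroup_eq_torus]
  obtain ⟨φ, -⟩ := exists_torus_equiv (LinearEquiv.refl K (Fin 3 → K)) (diagonalRatio K)
    diagonalRatio_surjective diagonalRatio_eq_one_iff
  exact ⟨φ⟩

theorem card_diagonal [Finite K] : Nat.card (diagonalGroup K) = (Nat.card K - 1) ^ 2 := by
  obtain ⟨φ⟩ := diagonal_equiv (K := K)
  rw [Nat.card_congr φ.toEquiv, Nat.card_prod, Nat.card_units, sq]

theorem nonunitsMoved_diagonal [Finite K] (h : Nat.card K ≠ 2) : NonunitsMoved K (Fin 3 → K) := by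
  obtain ⟨d, hd0, hd1⟩ := exists_ne_zero_ne_one h
  intro v _ hv
  rw [Pi.isUnit_iff] at hv
  push Not at hv
  obtain ⟨i, hi⟩ := hv
  have hi : v i = 0 := by simpa using hi
  -- The diagonal element with d at a zero coordinate of v fixes v.
  refine ⟨funUnit (Function.update 1 i d) fun j => ?_, fun c hc => ?_, 1, ?_⟩
  · by_cases hj : j = i
    · subst hj; simpa using hd0
    · simp [hj]
  · have h1 := congrFun hc i
    have h2 := congrFun hc (i + 1)
    have : i + 1 ≠ i := by fin_cases i <;> decide
    simp [this] at h1 h2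
    exact hd1 (h1.trans h2.symm)
  · ext j
    by_cases hj : j = i
    · subst hj; simp [hi]
    · simp [hj]

theorem diagonal_pairs [Finite K] :
    SomePairYields (diagonalGroup K) (fun S => SameUpToIso S (hughes K)) ∧
      (Nat.card K ≠ 2 →
        EveryPairYields (diagonalGroup K) (fun S => SameUpToIso S (hughes K))) := by
  rw [diagonalGroup_eq_torus]
  -- Dividing x + y = z by z gives the equation of the set in the coordinates (x/z, y/z).
  let lam : Module.Dual K (Fin 3 → K) :=
    LinearMap.proj (R := K) (φ := fun _ : Fin 3 => K) 0 +
      LinearMap.proj (R := K) (φ := fun _ : Fin 3 => K) 1 -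
      LinearMap.proj (R := K) (φ := fun _ : Fin 3 => K) 2
  have hlam_apply : ∀ x, lam x = x 0 + x 1 - x 2 := fun x => rfl
  have hlam : Function.Injective (twist lam) := by
    rw [← LinearMap.ker_eq_bot, LinearMap.ker_eq_bot']
    intro x h
    ext i
    have := LinearMap.congr_fun h (Pi.single i 1)
    rw [twist_apply, hlam_apply] at this
    fin_cases i <;> simpa [Pi.single_apply] using this
  have := torus_pairs (e := LinearEquiv.refl K (Fin 3 → K)) hlam
    (P := fun S => SameUpToIso S (hughes K)) (fun t => SameUpToIso.smul
      (sameUpToIso_hyperplaneSet _ (diagonalRatio K) diagonalRatio_surjective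
        diagonalRatio_eq_one_iff (by
          rintro ⟨x, y⟩
          constructor
          · intro h
            refine ⟨funUnit ![x, y, 1]
              (forall_fin_three_ne_zero x.ne_zero y.ne_zero one_ne_zero), ?_, ?_⟩
            · have : (x : K) + y = 1 := h
              rw [hlam_apply]; simp [this]
            · ext
              · rw [diagonalRatio_fst]; simp
              · rw [diagonalRatio_snd]; simp
          · rintro ⟨w, hw, hw'⟩
            rw [← hw']
            have h2 := unit_fun_ne_zero w 2
            change ((diagonalRatio K w).1 : K) + ((diagonalRatio K w).2 : K) = 1
            rw [diagonalRatio_fst, diagonalRatio_snd, ← add_div, div_eq_one_iff_eq h2,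
              ← sub_eq_zero]
            exact hw)) t)
  exact ⟨this.1, fun h => this.2 (nonunitsMoved_diagonal h)⟩

/-! ### The block group -/

variable (K) in
/-- Coordinates on `K[ε] × K`. -/
def dualFun3 : (DualNumber K × K) ≃ₗ[K] (Fin 3 → K) where
  toFun x := ![x.1.snd, x.1.fst, x.2]
  invFun v := ((v 1, v 0), v 2)
  map_add' _ _ := by ext i; fin_cases i <;> simp
  map_smul' _ _ := by ext i; fin_cases i <;> simp
  left_inv _ := rfl
  right_inv _ := by ext i; fin_cases i <;> rfl

theorem dualFun3_apply (x : DualNumber K × K) : dualFun3 K x = ![x.1.snd, x.1.fst, x.2] := rfl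

/-- Elements of `K[ε] × K`. -/
def dualMk (r a c : K) : DualNumber K × K := ((r, a), c)

@[simp] theorem dualMk_fst_fst {R : Type*} (r a c : R) : (dualMk r a c).1.fst = r := rfl
@[simp] theorem dualMk_fst_snd {R : Type*} (r a c : R) : (dualMk r a c).1.snd = a := rfl
@[simp] theorem dualMk_snd {R : Type*} (r a c : R) : (dualMk r a c).2 = c := rfl

theorem dual_ext {R : Type*} {x y : DualNumber R × R} (h1 : x.1.fst = y.1.fst) (h2 : x.1.snd = y.1.snd)
    (h3 : x.2 = y.2) : x = y := Prod.ext (TrivSqZeroExt.ext h1 h2) h3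

theorem blockGroup_eq_torus : blockGroup K = torus (dualFun3 K) := by
  ext x
  obtain ⟨g, rfl⟩ := mk_surjective x
  rw [mem_blockGroup, mem_torus]
  have h : ∀ (r a s : K) x, !![r, a, 0; 0, r, 0; 0, 0, s] *ᵥ dualFun3 K x =
      dualFun3 K (dualMk r a s * x) := by
    intro r a s x
    ext i
    fin_cases i <;> simp [dualFun3_apply, mulVec, mul_comm, add_comm]
  constructor
  · rintro ⟨r, a, s, hg⟩
    exact ⟨dualMk r a s, hg ▸ h r a s⟩
  · rintro ⟨x, hg⟩
    exact ⟨x.1.fst, x.1.snd, x.2, GL_ext_mulVec (dualFun3 K) fun v => by rw [hg, h]; rfl⟩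

theorem isUnit_dual_iff {x : DualNumber K × K} : IsUnit x ↔ x.1.fst ≠ 0 ∧ x.2 ≠ 0 := by
  rw [Prod.isUnit_iff, TrivSqZeroExt.isUnit_iff_isUnit_fst, isUnit_iff_ne_zero, isUnit_iff_ne_zero]

/-- Units of `K[ε] × K`. -/
noncomputable def dualUnit (r a c : K) (hr : r ≠ 0) (hc : c ≠ 0) : (DualNumber K × K)ˣ :=
  (isUnit_dual_iff.2 ⟨hr, hc⟩ : IsUnit (dualMk r a c)).unit

@[simp] theorem dualUnit_val (r a c : K) (hr : r ≠ 0) (hc : c ≠ 0) :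
    (dualUnit r a c hr hc : DualNumber K × K) = dualMk r a c := rfl

variable (K) in
/-- The homomorphism `(r + a ε, c) ↦ (c / r, a / r)`. -/
noncomputable def blockRatio : (DualNumber K × K)ˣ →* Kˣ × Multiplicative K :=
  (Units.map (RingHom.snd (DualNumber K) K : DualNumber K × K →* K) /
    Units.map ((TrivSqZeroExt.fstHom K K K : DualNumber K →* K).comp
      (RingHom.fst (DualNumber K) K : DualNumber K × K →* DualNumber K))).prod
  (MonoidHom.mk' (fun u => Multiplicative.ofAdd (u.val.1.snd / u.val.1.fst)) (by
    intro u v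
    have hu := (isUnit_dual_iff.1 u.isUnit).1
    have hv := (isUnit_dual_iff.1 v.isUnit).1
    rw [← ofAdd_add]
    congr 1
    simp; field_simp; ring))

theorem blockRatio_fst (u : (DualNumber K × K)ˣ) :
    ((blockRatio K u).1 : K) = u.val.2 / u.val.1.fst := by
  rw [blockRatio, MonoidHom.prod_apply, MonoidHom.div_apply, Units.val_div_eq_div_val]
  rfl

theorem blockRatio_snd (u : (DualNumber K × K)ˣ) :
    (blockRatio K u).2 = Multiplicative.ofAdd (u.val.1.snd / u.val.1.fst) := rfl

theorem blockRatio_surjective : Function.Surjective (blockRatio K) := by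
  rintro ⟨x, y⟩
  refine ⟨dualUnit 1 y.toAdd x one_ne_zero x.ne_zero, ?_⟩
  ext
  · rw [blockRatio_fst]; simp
  · rw [blockRatio_snd]; simp

theorem blockRatio_eq_one_iff (u : (DualNumber K × K)ˣ) :
    blockRatio K u = 1 ↔ ∃ c : K, (u : DualNumber K × K) = c • 1 := by
  have hu := isUnit_dual_iff.1 u.isUnit
  rw [Prod.ext_iff, ← Units.val_inj, blockRatio_fst, blockRatio_snd,
    Prod.fst_one, Prod.snd_one, Units.val_one, div_eq_one_iff_eq hu.1, ofAdd_eq_one,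
    div_eq_zero_iff, or_iff_left hu.1]
  constructor
  · rintro ⟨h0, h1⟩
    exact ⟨u.val.2, dual_ext (by simp [h0]) (by simp [h1]) (by simp)⟩
  · rintro ⟨c, hc⟩
    simp [hc]

theorem block_equiv : Nonempty (blockGroup K ≃* Kˣ × Multiplicative K) := by
  rw [blockGroup_eq_torus]
  obtain ⟨φ, -⟩ := exists_torus_equiv (dualFun3 K) (blockRatio K)
    blockRatio_surjective blockRatio_eq_one_iff
  exact ⟨φ⟩

theorem card_block [Finite K] : Nat.card (blockGroup K) = (Nat.card K - 1) * Nat.card K := by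
  obtain ⟨φ⟩ := block_equiv (K := K)
  rw [Nat.card_congr φ.toEquiv, Nat.card_prod, Nat.card_units]
  rfl

theorem nonunitsMoved_block [Finite K] (h : Nat.card K ≠ 2) :
    NonunitsMoved K (DualNumber K × K) := by
  obtain ⟨d, hd0, hd1⟩ := exists_ne_zero_ne_one h
  intro v _ hv
  rw [isUnit_dual_iff] at hv
  by_cases h2 : v.2 = 0
  · refine ⟨dualUnit 1 0 d one_ne_zero hd0, fun c hc => ?_, 1, ?_⟩
    · have h1 := congrArg (fun x => x.1.fst) hc
      have h2 := congrArg Prod.snd hc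
      simp at h1 h2
      exact hd1 (h2.trans h1.symm)
    · apply dual_ext <;> simp [h2]
  · have h1 : v.1.fst = 0 := by
      by_contra h1; exact hv ⟨h1, h2⟩
    -- The unit (1 + ε, 1) fixes (aε, c), since ε² = 0.
    refine ⟨dualUnit 1 1 1 one_ne_zero one_ne_zero, fun c hc => ?_, 1, ?_⟩
    · have := congrArg (fun x => x.1.snd) hc
      simp at this
    · apply dual_ext <;> simp [h1]

theorem block_pairs [Finite K] :
    SomePairYields (blockGroup K) (fun S => SameUpToIso S (spence K)) ∧
      (Nat.card K ≠ 2 →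
        EveryPairYields (blockGroup K) (fun S => SameUpToIso S (spence K))) := by
  rw [blockGroup_eq_torus]
  -- On r + aε with last coordinate c this is a − c; its vanishing makes the coordinates c/r and a/r
  -- equal.
  let lam : Module.Dual K (DualNumber K × K) :=
    { toFun := fun x => x.1.snd - x.2
      map_add' := fun x y => by simp; ring
      map_smul' := fun c x => by simp; ring }
  have hlam_apply : ∀ x, lam x = x.1.snd - x.2 := fun x => rfl
  have hlam : Function.Injective (twist lam) := by
    rw [← LinearMap.ker_eq_bot, LinearMap.ker_eq_bot']
    intro x h
    have h0 := LinearMap.congr_fun h (dualMk 0 1 0)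
    have h1 := LinearMap.congr_fun h (dualMk 1 0 0)
    have h2 := LinearMap.congr_fun h (dualMk 0 0 1)
    rw [twist_apply, hlam_apply] at h0 h1 h2
    simp at h0 h1 h2
    exact dual_ext h0 h1 h2
  have := torus_pairs (e := dualFun3 K) hlam
    (P := fun S => SameUpToIso S (spence K)) (fun t => SameUpToIso.smul
      (sameUpToIso_hyperplaneSet _ (blockRatio K) blockRatio_surjective
        blockRatio_eq_one_iff (by
          intro p
          constructor
          · rintro ⟨x, rfl⟩
            refine ⟨dualUnit 1 x x one_ne_zero x.ne_zero, ?_, ?_⟩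
            · rw [hlam_apply]; simp
            · ext
              · rw [blockRatio_fst]; simp
              · rw [blockRatio_snd]; simp
          · rintro ⟨w, hw, hw'⟩
            rw [← hw']
            refine ⟨(blockRatio K w).1, Prod.ext rfl ?_⟩
            rw [blockRatio_snd, blockRatio_fst, sub_eq_zero.1 hw])) t)
  exact ⟨this.1, fun h => this.2 (nonunitsMoved_block h)⟩

/-! ### Maximal abelian subgroups -/

theorem isMulCommutative_iff {G : Type*} [Group G] {H : Subgroup G} :
    IsMulCommutative H ↔ ∀ x ∈ H, ∀ y ∈ H, x * y = y * x := by
  constructor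
  · intro h x hx y hy
    exact congrArg Subtype.val (mul_comm' (⟨x, hx⟩ : H) ⟨y, hy⟩)
  · intro h
    exact ⟨⟨fun x y => Subtype.ext (h x x.2 y y.2)⟩⟩

theorem isMaximalAbelian_of_centralizer {G : Type*} [Group G] {H : Subgroup G}
    (hH : IsMulCommutative H) (h : ∀ x, (∀ y ∈ H, x * y = y * x) → x ∈ H) :
    IsMaximalAbelian H := by
  refine ⟨hH, fun B hB hHB x hx => h x fun y hy => ?_⟩
  exact isMulCommutative_iff.1 hB x hx y (hHB hy)

theorem isMulCommutative_conj {G : Type*} [Group G] {H : Subgroup G}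
    (hH : IsMulCommutative H) (g : G) : IsMulCommutative (MulAut.conj g • H : Subgroup G) := by
  rw [isMulCommutative_iff] at hH ⊢
  intro x hx y hy
  rw [mem_conj_iff] at hx hy
  have := hH _ hx _ hy
  calc x * y = g * (g⁻¹ * x * g * (g⁻¹ * y * g)) * g⁻¹ := by group
    _ = y * x := by rw [this]; group

theorem IsMaximalAbelian.conj {G : Type*} [Group G] {H H' : Subgroup G}
    (hH : IsMaximalAbelian H) (h : IsConjSubgroup H H') : IsMaximalAbelian H' := by
  obtain ⟨g, rfl⟩ := h
  refine ⟨isMulCommutative_conj hH.1 g, fun B hB hHB => ?_⟩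
  rw [Subgroup.subset_pointwise_smul_iff, ← map_inv]
  refine hH.2 (isMulCommutative_conj hB _) ?_
  rwa [map_inv, ← Subgroup.pointwise_smul_subset_iff]

theorem IsMaximalAbelian.conj_of_subConj {G : Type*} [Group G] {H H' : Subgroup G}
    (hH : IsMaximalAbelian H) (hH' : IsMulCommutative H') (h : SubConj H H') :
    IsConjSubgroup H' H := by
  obtain ⟨g, hg⟩ := h
  exact ⟨g, le_antisymm (hH.2 (isMulCommutative_conj hH' g) hg) hg⟩

/-! ### The listed groups are self-centralizing -/

/-- Cube roots of unity in `K` are trivial. -/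
def NoCubeRoots (K : Type*) [Field K] : Prop := ∀ c : K, c ^ 3 = 1 → c = 1

/-- In characteristic three, c³ − 1 = (c − 1)³. -/
theorem three_ne_zero_of_not_noCubeRoots (h : ¬ NoCubeRoots K) : (3 : K) ≠ 0 := by
  intro h3
  apply h
  intro c hc
  have : (c - 1) ^ 3 = 0 := by linear_combination hc + (c - c ^ 2) * h3
  exact sub_eq_zero.1 (pow_eq_zero_iff (by norm_num) |>.1 this)

/-- From gh = c·hg one gets ghg⁻¹ = c·h, and comparing traces gives c = 1 unless h has trace zero.
-/
theorem commute_of_trace {g h : GL (Fin 3) K} (H : mk g * mk h = mk h * mk g)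
    (ht : NoCubeRoots K ∨ h.val.trace ≠ 0) : g.val * h.val = h.val * g.val := by
  obtain ⟨c, hc0, hc⟩ := commute_mk_iff.1 H
  have hc3 := scalar_cube_eq_one hc
  suffices c = 1 by rw [hc, this, one_smul]
  rcases ht with ht | ht
  · exact ht c hc3
  · have h1 := congrArg (fun M => (M * (g⁻¹).val).trace) hc
    have hg : g.val * (g⁻¹).val = 1 := by rw [← Units.val_mul, mul_inv_cancel, Units.val_one]
    have hg' : (g⁻¹).val * g.val = 1 := by rw [← Units.val_mul, inv_mul_cancel, Units.val_one]
    simp only [smul_mul, mul_assoc, hg, trace_smul, mul_one] at h1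
    rw [trace_mul_comm, mul_assoc, hg', mul_one, smul_eq_mul] at h1
    exact (mul_eq_right₀ ht).1 h1.symm

theorem noCubeRoots_or_three_ne_zero (K : Type*) [Field K] : NoCubeRoots K ∨ (3 : K) ≠ 0 :=
  or_iff_not_imp_left.2 three_ne_zero_of_not_noCubeRoots

theorem unipotentGroup_comm {x y : K} : IsMulCommutative (unipotentGroup x y) := by
  rw [isMulCommutative_iff]
  rintro _ ⟨g, ⟨a, b, hg⟩, rfl⟩ _ ⟨h, ⟨a', b', hh⟩, rfl⟩
  rw [commute_mk_iff]
  refine ⟨1, one_ne_zero, ?_⟩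
  rw [hg, hh]
  ext i j; fin_cases i <;> fin_cases j <;> simp [Matrix.mul_apply, Fin.sum_univ_three] <;> ring

/-- Unipotent matrices have trace 3, which is nonzero whenever nontrivial cube roots of unity exist.
So a centralizing class has a representative genuinely commuting with all of them, and its entries
are read off from the cases (a, b) = (0, 1) and (1, 0). -/
theorem unipotentGroup_maximal {x y : K} (h : x ≠ 0 ∨ y ≠ 0) :
    IsMaximalAbelian (unipotentGroup x y) := by
  refine isMaximalAbelian_of_centralizer unipotentGroup_comm fun z hz => ?_
  obtain ⟨g, rfl⟩ := mk_surjective z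
  have key : ∀ a b : K, g.val * !![1, a * x, b; 0, 1, a * y; 0, 0, 1] =
      !![1, a * x, b; 0, 1, a * y; 0, 0, 1] * g.val := by
    intro a b
    have hd : (!![1, a * x, b; 0, 1, a * y; 0, 0, 1] : Matrix (Fin 3) (Fin 3) K).det ≠ 0 := by
      rw [Matrix.det_fin_three]; simp
    refine commute_of_trace (h := GeneralLinearGroup.mkOfDetNeZero _ hd)
      (hz _ (mem_unipotentGroup.2 ⟨1, a, b, rfl⟩)) ?_
    refine (noCubeRoots_or_three_ne_zero K).imp_right fun h3 => ?_
    change (!![1, a * x, b; 0, 1, a * y; 0, 0, 1] : Matrix (Fin 3) (Fin 3) K).trace ≠ 0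
    rw [trace_fin_three]
    convert h3 using 1
    simp; norm_num
  have k1 := fun i j => congrFun (congrFun (key 0 1) i) j
  have k2 := fun i j => congrFun (congrFun (key 1 0) i) j
  simp only [Matrix.mul_apply, Fin.sum_univ_three] at k1 k2
  have a1 := k1 0 0
  have a2 := k1 0 1
  have a3 := k1 0 2
  have a4 := k1 1 2
  have b1 := k2 0 1
  have b2 := k2 0 2
  have b3 := k2 1 2
  simp at a1 a2 a3 a4 b1 b2 b3
  have c1 : g.val 2 2 = g.val 0 0 := by linear_combination -a3
  have c2 : g.val 1 1 = g.val 0 0 := by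
    rcases h with h | h
    · exact mul_left_cancel₀ h (by linear_combination -b1)
    · exact mul_left_cancel₀ h (by linear_combination b3 + y * c1)
  obtain ⟨a, h1, h2⟩ : ∃ a, a * x = g.val 0 1 ∧ a * y = g.val 1 2 := by
    rcases h with h | h
    · exact ⟨g.val 0 1 / x, by field_simp, by field_simp; linear_combination b2⟩
    · exact ⟨g.val 1 2 / y, by field_simp; linear_combination -b2, by field_simp⟩
  refine mem_unipotentGroup.2 ⟨g.val 0 0, a, g.val 0 2, ?_⟩
  rw [h1, h2]
  ext i j; fin_cases i <;> fin_cases j <;> simp [a1, a2, a4, c1, c2]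

section torus

variable {A : Type*} [CommRing A] [Algebra K A] {e : A ≃ₗ[K] (Fin 3 → K)}

/-- The elements whose multiplication commutes with a matrix. -/
def multCommutant (e : A ≃ₗ[K] (Fin 3 → K)) (g : GL (Fin 3) K) : Subalgebra K A where
  carrier := {a | ∀ x, e.symm (g.val *ᵥ e (a * x)) = a * e.symm (g.val *ᵥ e x)}
  mul_mem' := by
    intro a b ha hb x
    rw [mul_assoc, ha, hb, mul_assoc]
  add_mem' := by
    intro a b ha hb x
    rw [add_mul, map_add, mulVec_add, map_add, ha, hb, add_mul]
  algebraMap_mem' := by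
    intro c x
    rw [← Algebra.smul_def, ← Algebra.smul_def, map_smul, mulVec_smul, map_smul]

/-- An A-linear endomorphism of A is multiplication by its value at 1. -/
theorem mem_torus_of_multCommutant {g : GL (Fin 3) K} (h : ∀ a, a ∈ multCommutant e g) :
    mk g ∈ torus e := by
  refine mem_torus.2 ⟨e.symm (g.val *ᵥ e 1), fun x => ?_⟩
  have := h x 1
  rw [mul_one] at this
  rw [mul_comm, ← this, LinearEquiv.apply_symm_apply]

theorem trace_mulGL (e : A ≃ₗ[K] (Fin 3 → K)) (u : Aˣ) :
    (mulGL e u).val.trace = Algebra.trace K A u := by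
  have h : (mulGL e u).val =
    LinearMap.toMatrix' (e.toLinearMap ∘ₗ Algebra.lmul K A u ∘ₗ e.symm.toLinearMap) := rfl
  rw [h, ← LinearMap.toMatrix_eq_toMatrix', ← LinearMap.trace_eq_matrix_trace, Algebra.trace_apply]
  exact LinearMap.trace_conj' (Algebra.lmul K A (u : A)) e

theorem unit_mem_multCommutant {g : GL (Fin 3) K} (hg : ∀ y ∈ torus e, mk g * y = y * mk g)
    {u : A} (hu : IsUnit u) (ht : NoCubeRoots K ∨ Algebra.trace K A u ≠ 0) :
    u ∈ multCommutant e g := by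
  obtain ⟨u, rfl⟩ := hu
  have h := commute_of_trace (h := mulGL e u) (hg _ (mulClass_mem e u)) (by rwa [trace_mulGL])
  intro x
  have := congrArg (fun M => M *ᵥ e x) h
  simp only [← mulVec_mulVec, mulGL_mulVec] at this
  rw [this]
  obtain ⟨y, hy⟩ := e.surjective (g.val *ᵥ e x)
  rw [← hy, mulGL_mulVec, e.symm_apply_apply, e.symm_apply_apply]

/-- Units to which `commute_of_trace` applies commute with every centralizing matrix. If the only
subalgebra containing them all is A, such a matrix is A-linear. -/
theorem torus_maximal
    (h : ∀ T : Subalgebra K A, (∀ u : A, IsUnit u →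
      (NoCubeRoots K ∨ Algebra.trace K A u ≠ 0) → u ∈ T) → T = ⊤) :
    IsMaximalAbelian (torus e) := by
  refine isMaximalAbelian_of_centralizer torus_comm fun z hz => ?_
  obtain ⟨g, rfl⟩ := mk_surjective z
  refine mem_torus_of_multCommutant fun a => ?_
  rw [h (multCommutant e g) fun u hu ht => unit_mem_multCommutant hz hu ht]
  exact Algebra.mem_top

end torus

/-- An element a of trace zero is reached as (a + 1) − 1, the trace of a + 1 being 3 ≠ 0. -/
theorem cubic_maximal {L : Type*} [Field L] [Algebra K L] (hL : Module.finrank K L = 3)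
    (e : L ≃ₗ[K] (Fin 3 → K)) : IsMaximalAbelian (torus e) := by
  refine torus_maximal fun T hT => ?_
  rw [eq_top_iff]
  intro a _
  by_cases ha : a = 0
  · exact ha ▸ T.zero_mem
  by_cases ht : NoCubeRoots K ∨ Algebra.trace K L a ≠ 0
  · exact hT a (isUnit_iff_ne_zero.2 ha) ht
  push Not at ht
  have h3 := three_ne_zero_of_not_noCubeRoots ht.1
  have h1 : Algebra.trace K L 1 = 3 := by
    rw [← map_one (algebraMap K L), Algebra.trace_algebraMap, hL]; simp
  have h2 : Algebra.trace K L (a + 1) ≠ 0 := by rwa [map_add, ht.2, h1, zero_add]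
  have ha1 : a + 1 ≠ 0 := by
    intro h; rw [h, map_zero] at h2; exact h2 rfl
  have := T.sub_mem (hT (a + 1) (isUnit_iff_ne_zero.2 ha1) (Or.inr h2)) T.one_mem
  rwa [add_sub_cancel_right] at this

theorem exists_cubeRoot (h : ¬ NoCubeRoots K) : ∃ d : K, d ≠ 0 ∧ d ≠ 1 ∧ 2 + d ≠ 0 := by
  have h3 := three_ne_zero_of_not_noCubeRoots h
  unfold NoCubeRoots at h
  push Not at h
  obtain ⟨d, hd, hd1⟩ := h
  refine ⟨d, by rintro rfl; simp at hd, hd1, fun h2 => ?_⟩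
  -- If d = −2, then 1 = d³ = −8.
  have : (3 : K) * 3 = 0 := by linear_combination -hd + (d ^ 2 - 2 * d + 4) * h2
  exact h3 (by simpa using this)

/-- The quantity 2 + d is the trace of diag(1, 1, d), so this matrix can serve to separate
coordinates in the diagonal and block algebras. -/
theorem exists_separating [Finite K] (h : Nat.card K ≠ 2) :
    ∃ d : K, d ≠ 0 ∧ d ≠ 1 ∧ (NoCubeRoots K ∨ 2 + d ≠ 0) := by
  by_cases hn : NoCubeRoots K
  · obtain ⟨d, h0, h1⟩ := exists_ne_zero_ne_one h
    exact ⟨d, h0, h1, Or.inl hn⟩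
  · obtain ⟨d, h0, h1, h2⟩ := exists_cubeRoot hn
    exact ⟨d, h0, h1, Or.inr h2⟩

/-- The idempotent (0, 1) is obtained from units allowed by the trace condition; each (x, 0) then
follows by correcting the last coordinate of an allowed unit (x, k). -/
theorem quadratic_maximal {L : Type*} [Field L] [Algebra K L] (hL : Module.finrank K L = 2)
    (e : (L × K) ≃ₗ[K] (Fin 3 → K)) : IsMaximalAbelian (torus e) := by
  have : FiniteDimensional K L := Module.finite_of_finrank_pos (by omega)
  refine torus_maximal fun T hT => ?_
  have unit : ∀ (x : L) (c : K), x ≠ 0 → c ≠ 0 →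
      (NoCubeRoots K ∨ Algebra.trace K L x + c ≠ 0) → (x, c) ∈ T := by
    intro x c hx hc ht
    refine hT _ (Prod.isUnit_iff.2 ⟨hx.isUnit, hc.isUnit⟩) (ht.imp_right fun ht => ?_)
    rwa [Algebra.trace_prod_apply, Algebra.trace_self_apply]
  have h01 : ((0, 1) : L × K) ∈ T := by
    by_cases hn : NoCubeRoots K
    · obtain ⟨b, hb⟩ : ∃ b : L, b ∉ (⊥ : Subalgebra K L) := by
        by_contra! hb
        have : (⊥ : Subalgebra K L) = ⊤ := eq_top_iff.2 fun x _ => hb x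
        rw [Subalgebra.bot_eq_top_iff_finrank_eq_one] at this
        omega
      have hb0 : b ≠ 0 := by rintro rfl; exact hb (Subalgebra.zero_mem _)
      have hb1 : 1 - b ≠ 0 := fun h => hb ((sub_eq_zero.1 h) ▸ Subalgebra.one_mem _)
      -- Here (b, 1) + (1 − b, 1) − (1, 1) = (0, 1); b outside K makes both b and 1 − b nonzero.
      have := T.sub_mem (T.add_mem (unit b 1 hb0 one_ne_zero (Or.inl hn))
        (unit (1 - b) 1 hb1 one_ne_zero (Or.inl hn))) T.one_mem
      convert this using 1
      ext <;> simp
    · obtain ⟨d, h0, h1, h2⟩ := exists_cubeRoot hn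
      have ht1 : Algebra.trace K L 1 = 2 := by
        rw [← map_one (algebraMap K L), Algebra.trace_algebraMap, hL]; simp
      have := T.smul_mem (T.sub_mem (unit 1 d one_ne_zero h0 (Or.inr (by rwa [ht1]))) T.one_mem)
        (d - 1)⁻¹
      convert this using 1
      ext
      · simp
      · simp [sub_ne_zero.2 h1]
  have hx0 : ∀ x : L, (x, (0 : K)) ∈ T := by
    intro x
    by_cases hx : x = 0
    · subst hx; exact T.zero_mem
    obtain ⟨k, hk⟩ : ∃ k : K, (x, k) ∈ T := by
      by_cases ht : NoCubeRoots K ∨ Algebra.trace K L x + 1 ≠ 0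
      · exact ⟨1, unit x 1 hx one_ne_zero ht⟩
      push Not at ht
      obtain ⟨d, h0, h1, h2⟩ := exists_cubeRoot ht.1
      -- The trace of x is −1 here, so the total trace is d − 1 ≠ 0.
      exact ⟨d, unit x d hx h0 (Or.inr fun h => h1 (by linear_combination h - ht.2))⟩
    have := T.sub_mem hk (T.smul_mem h01 k)
    convert this using 1
    ext <;> simp
  rw [eq_top_iff]
  rintro ⟨x, c⟩ _
  have := T.add_mem (hx0 x) (T.smul_mem h01 c)
  convert this using 1
  ext <;> simp

theorem diagonal_maximal [Finite K] (h : Nat.card K ≠ 2) : IsMaximalAbelian (diagonalGroup K) := by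
  rw [diagonalGroup_eq_torus]
  obtain ⟨d, h0, h1, h2⟩ := exists_separating h
  refine torus_maximal fun T hT => ?_
  have hi : ∀ i, (Pi.single i 1 : Fin 3 → K) ∈ T := by
    intro i
    -- This unit is d at i and 1 elsewhere; subtracting 1 and rescaling isolates the idempotent at
    -- i.
    have hu : (1 + Pi.single i (d - 1) : Fin 3 → K) ∈ T := by
      refine hT _ (Pi.isUnit_iff.2 fun j => ?_) (h2.imp_right fun h2 => ?_)
      · by_cases hj : j = i
        · subst hj; simpa using h0
        · simp [hj]
      · rw [Algebra.trace_eq_matrix_trace (Pi.basisFun K (Fin 3)), trace_fin_three]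
        simp only [Algebra.leftMulMatrix_eq_repr_mul]
        fin_cases i <;> simp [Pi.basisFun_apply] <;> intro h <;>
          exact h2 (by linear_combination h)
    have := T.smul_mem (T.sub_mem hu T.one_mem) (d - 1)⁻¹
    convert this using 1
    ext j
    by_cases hj : j = i
    · subst hj; simp [sub_ne_zero.2 h1]
    · simp [hj]
  rw [eq_top_iff]
  intro x _
  rw [← Finset.univ_sum_single x]
  refine T.sum_mem fun i _ => ?_
  have := T.smul_mem (hi i) (x i)
  convert this using 1
  ext j
  simp [Pi.single_apply]

theorem trace_dual (r a c : K) : Algebra.trace K (DualNumber K × K) (dualMk r a c) = 2 * r + c := by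
  have hr : dualMk r a c = r • dualMk 1 0 0 + a • dualMk 0 1 0 + c • dualMk 0 0 1 := by
    apply dual_ext <;> simp
  let b : Module.Basis (Fin 3) K (DualNumber K × K) := Module.Basis.ofEquivFun (dualFun3 K)
  rw [Algebra.trace_eq_matrix_trace b, trace_fin_three]
  simp only [Algebra.leftMulMatrix_eq_repr_mul]
  have hb0 : b 0 = dualMk 0 1 0 := by
    apply dual_ext <;> simp [b, Module.Basis.coe_ofEquivFun] <;> rfl
  have hb1 : b 1 = dualMk 1 0 0 := by
    apply dual_ext <;> simp [b, Module.Basis.coe_ofEquivFun] <;> rfl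
  have hb2 : b 2 = dualMk 0 0 1 := by
    apply dual_ext <;> simp [b, Module.Basis.coe_ofEquivFun] <;> rfl
  rw [hb0, hb1, hb2]
  simp [b, dualFun3_apply]
  ring

theorem block_maximal [Finite K] (h : Nat.card K ≠ 2) : IsMaximalAbelian (blockGroup K) := by
  rw [blockGroup_eq_torus]
  obtain ⟨d, h0, h1, h2⟩ := exists_separating h
  refine torus_maximal fun T hT => ?_
  have unit : ∀ r a c : K, r ≠ 0 → c ≠ 0 → (NoCubeRoots K ∨ 2 * r + c ≠ 0) →
      dualMk r a c ∈ T := fun r a c hr hc ht =>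
    hT _ (isUnit_dual_iff.2 ⟨hr, hc⟩) (by rwa [trace_dual])
  have e1 : dualMk (0 : K) 0 1 ∈ T := by
    have := T.smul_mem (T.sub_mem (unit 1 0 d one_ne_zero h0 (by rwa [mul_one])) T.one_mem)
      (d - 1)⁻¹
    convert this using 1
    apply dual_ext <;> simp [sub_ne_zero.2 h1]
  have e2 : dualMk (0 : K) 1 0 ∈ T := by
    have := T.sub_mem (unit 1 1 1 one_ne_zero one_ne_zero
      ((noCubeRoots_or_three_ne_zero K).imp_right fun h3 => by norm_num [h3])) T.one_mem
    convert this using 1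
    apply dual_ext <;> simp
  rw [eq_top_iff]
  intro x _
  have := T.add_mem (T.algebraMap_mem x.1.fst) (T.add_mem (T.smul_mem e2 x.1.snd)
    (T.smul_mem e1 (x.2 - x.1.fst)))
  convert this using 1
  apply dual_ext <;> simp [Algebra.algebraMap_eq_smul_one]

/-! ### Matrices commuting up to a scalar -/

/-- The matrices `g` and `h` commute up to the scalar `c`. -/
def Rel (g h : GL (Fin 3) K) (c : K) : Prop := g.val * h.val = c • (h.val * g.val)

namespace Rel

variable {g g' h h' : GL (Fin 3) K} {c c' : K}

theorem refl (g : GL (Fin 3) K) : Rel g g 1 := by simp [Rel]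

theorem one_left (g : GL (Fin 3) K) : Rel 1 g 1 := by simp [Rel]

theorem one_right (g : GL (Fin 3) K) : Rel g 1 1 := by simp [Rel]

theorem mul_left (H : Rel g h c) (H' : Rel g' h c') : Rel (g * g') h (c * c') := by
  unfold Rel at *
  rw [Units.val_mul, mul_assoc, H', mul_smul_comm, ← mul_assoc, H, smul_mul_assoc, smul_smul,
    mul_assoc, mul_comm c']

theorem mul_right (H : Rel g h c) (H' : Rel g h' c') : Rel g (h * h') (c * c') := by
  unfold Rel at *
  rw [Units.val_mul, ← mul_assoc, H, smul_mul_assoc, mul_assoc, H', mul_smul_comm, smul_smul,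
    mul_assoc]

theorem pow_left (H : Rel g h c) (n : ℕ) : Rel (g ^ n) h (c ^ n) := by
  induction n with
  | zero => simpa using one_left h
  | succ n ih => rw [pow_succ, pow_succ]; exact ih.mul_left H

theorem pow_right (H : Rel g h c) (n : ℕ) : Rel g (h ^ n) (c ^ n) := by
  induction n with
  | zero => simpa using one_right g
  | succ n ih => rw [pow_succ, pow_succ]; exact ih.mul_right H

theorem ne_zero (H : Rel g h c) : c ≠ 0 := by
  rintro rfl
  have : (g * h).val = 0 := by rw [Units.val_mul, H, zero_smul]
  exact (g * h).ne_zero this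

theorem symm (H : Rel g h c) : Rel h g c⁻¹ := by
  unfold Rel at *
  rw [H, smul_smul, inv_mul_cancel₀ (ne_zero H), one_smul]

theorem cube (H : Rel g h c) : c ^ 3 = 1 := scalar_cube_eq_one H

theorem commute (H : Rel g h c) : mk g * mk h = mk h * mk g :=
  commute_mk_iff.2 ⟨c, H.ne_zero, H⟩

theorem eq_one_of_commute (H : Rel g h c) (hc : g.val * h.val = h.val * g.val) : c = 1 := by
  have h1 : (c - 1) • (h * g).val = 0 := by
    rw [sub_smul, one_smul, Units.val_mul, ← H, hc, sub_self]
  rcases smul_eq_zero.1 h1 with h1 | h1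
  · exact sub_eq_zero.1 h1
  · exact absurd h1 (h * g).ne_zero

theorem trace_eq_zero (H : Rel g h c) (hc : c ≠ 1) : h.val.trace = 0 := by
  by_contra ht
  exact hc (H.eq_one_of_commute (commute_of_trace H.commute (Or.inr ht)))

theorem inv_right (H : Rel g h c) : Rel g h⁻¹ c⁻¹ := by
  have h1 : g * h⁻¹ * h = h⁻¹ * (h * g) := by group
  unfold Rel at *
  have h2 : (g * h⁻¹).val = (h⁻¹ * (h * g) * h⁻¹).val := by rw [← h1]; group
  have h3 : (h * g).val = c⁻¹ • (g * h).val := by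
    rw [Units.val_mul, Units.val_mul, H, smul_smul, inv_mul_cancel₀ (ne_zero H), one_smul]
  rw [← Units.val_mul, h2, Units.val_mul, Units.val_mul, h3, mul_smul_comm, smul_mul_assoc,
    ← Units.val_mul, ← Units.val_mul, ← Units.val_mul]
  congr 2
  group

end Rel

theorem exists_rel_of_commute {g h : GL (Fin 3) K} (H : mk g * mk h = mk h * mk g) :
    ∃ c, Rel g h c := by
  obtain ⟨c, -, hc⟩ := commute_mk_iff.1 H
  exact ⟨c, hc⟩

/-- Both h and h⁻¹ commute with g up to a nontrivial scalar, so both have trace zero. The trace of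
the adjugate is det h times that of h⁻¹, so the two middle coefficients of the characteristic
polynomial vanish. -/
theorem det_sub_of_rel {g h : GL (Fin 3) K} {c : K} (H : Rel g h c) (hc : c ≠ 1) (x : K) :
    (x • (1 : Matrix (Fin 3) (Fin 3) K) - h.val).det = x ^ 3 - h.val.det := by
  have h1 := H.trace_eq_zero hc
  have h2 : (h.val.adjugate).trace = 0 := by
    have h3 := H.inv_right.trace_eq_zero (by simpa using hc)
    rw [coe_units_inv, Matrix.inv_def, trace_smul, smul_eq_zero] at h3
    refine h3.resolve_left fun h4 => ?_
    have := h.det_ne_zero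
    simp [this] at h4
  rw [adjugate_fin_three, trace_fin_three] at h2
  rw [trace_fin_three] at h1
  simp at h2
  rw [det_fin_three, det_fin_three]
  simp
  linear_combination (-x ^ 2) * h1 + x * h2

theorem exists_eigenvector_of_rel {g h : GL (Fin 3) K} {c t : K} (H : Rel g h c) (hc : c ≠ 1)
    (ht : t ^ 3 = h.val.det) : ∃ v, v ≠ 0 ∧ h.val *ᵥ v = t • v := by
  have h1 := det_sub_of_rel H hc t
  rw [ht, sub_self] at h1
  obtain ⟨v, hv, h2⟩ := exists_mulVec_eq_zero_iff.2 h1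
  refine ⟨v, hv, ?_⟩
  rw [sub_mulVec, smul_mulVec, one_mulVec, sub_eq_zero] at h2
  exact h2.symm

theorem det_eq_cube_of_eigenvector {g h : GL (Fin 3) K} {c t : K} (H : Rel g h c) (hc : c ≠ 1)
    {v : Fin 3 → K} (hv : v ≠ 0) (h1 : h.val *ᵥ v = t • v) : h.val.det = t ^ 3 := by
  have h2 : (t • (1 : Matrix (Fin 3) (Fin 3) K) - h.val).det = 0 := by
    refine exists_mulVec_eq_zero_iff.1 ⟨v, hv, ?_⟩
    rw [sub_mulVec, smul_mulVec, one_mulVec, h1, sub_self]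
  rw [det_sub_of_rel H hc, sub_eq_zero] at h2
  exact h2.symm

theorem isPrimitiveRoot_of_cube {c : K} (h : c ^ 3 = 1) (hc : c ≠ 1) : IsPrimitiveRoot c 3 := by
  rw [← orderOf_eq_prime h hc]
  exact IsPrimitiveRoot.orderOf c

theorem matrix_ext_basis (b : Module.Basis (Fin 3) K (Fin 3 → K)) {M N : Matrix (Fin 3) (Fin 3) K}
    (h : ∀ i, M *ᵥ b i = N *ᵥ b i) : M = N :=
  Matrix.toLin'.injective (b.ext fun i => by simpa using h i)

/-- Moving g past hⁱ multiplies the eigenvalue by cⁱ, and 1, c, c² are distinct because c is a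
primitive cube root of unity. -/
theorem exists_rel_basis {g h : GL (Fin 3) K} {c t : K} (H : Rel g h c) (hc : c ≠ 1)
    {v : Fin 3 → K} (hv : v ≠ 0) (h1 : g.val *ᵥ v = t • v) :
    ∃ b : Module.Basis (Fin 3) K (Fin 3 → K), (∀ i, b i = (h ^ (i : ℕ)).val *ᵥ v) ∧
      ∀ i, g.val *ᵥ b i = (t * c ^ (i : ℕ)) • b i := by
  have ht : t ≠ 0 := by
    rintro rfl
    rw [zero_smul] at h1
    exact mulVec_ne_zero g hv h1
  have heig : ∀ n : ℕ, g.val *ᵥ ((h ^ n).val *ᵥ v) = (t * c ^ n) • ((h ^ n).val *ᵥ v) := by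
    intro n
    rw [mulVec_mulVec, H.pow_right n, smul_mulVec, ← mulVec_mulVec, h1, mulVec_smul, smul_smul,
      mul_comm]
  have hprim := isPrimitiveRoot_of_cube H.cube hc
  have hli : LinearIndependent K (fun i : Fin 3 => (h ^ (i : ℕ)).val *ᵥ v) := by
    refine Module.End.eigenvectors_linearIndependent' (Matrix.toLin' g.val)
      (fun i : Fin 3 => t * c ^ (i : ℕ)) ?_ _ ?_
    · intro i j hij
      exact Fin.ext (hprim.pow_inj i.2 j.2 (mul_left_cancel₀ ht hij))
    · intro i
      refine ⟨?_, mulVec_ne_zero _ hv⟩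
      rw [Module.End.mem_eigenspace_iff, Matrix.toLin'_apply]
      exact heig i
  let b := basisOfLinearIndependentOfCardEqFinrank hli (by simp)
  have hb : ∀ i, b i = (h ^ (i : ℕ)).val *ᵥ v := fun i => by simp [b]
  exact ⟨b, hb, fun i => by rw [hb]; exact heig i⟩

/-- The eigenvalues of g are simple, so M preserves the line of v; commuting with h spreads the same
factor to hv and h²v. -/
theorem scalar_of_commute_eigen {g h : GL (Fin 3) K} {c t : K} (H : Rel g h c) (hc : c ≠ 1)
    {v : Fin 3 → K} (hv : v ≠ 0) (h1 : g.val *ᵥ v = t • v) {M : Matrix (Fin 3) (Fin 3) K}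
    (hg : M * g.val = g.val * M) (hh : M * h.val = h.val * M) : ∃ r : K, M = r • 1 := by
  obtain ⟨b, hb, hgb⟩ := exists_rel_basis H hc hv h1
  have ht : t ≠ 0 := by
    rintro rfl
    rw [zero_smul] at h1
    exact mulVec_ne_zero g hv h1
  have hprim := isPrimitiveRoot_of_cube H.cube hc
  have hb0 : b 0 = v := by rw [hb]; simp
  obtain ⟨r, hMv⟩ : ∃ r : K, M *ᵥ v = r • v := by
    refine ⟨b.repr (M *ᵥ v) 0, ?_⟩
    have h2 : g.val *ᵥ (M *ᵥ v) = t • (M *ᵥ v) := by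
      rw [mulVec_mulVec, ← hg, ← mulVec_mulVec, h1, mulVec_smul]
    have h3 : ∀ i : Fin 3, i ≠ 0 → b.repr (M *ᵥ v) i = 0 := by
      intro i hi
      have e1 : g.val *ᵥ (M *ᵥ v) =
          ∑ j, (b.repr (M *ᵥ v) j * (t * c ^ (j : ℕ))) • b j := by
        conv_lhs => rw [← b.sum_repr (M *ᵥ v)]
        rw [← Matrix.toLin'_apply, map_sum]
        refine Finset.sum_congr rfl fun j _ => ?_
        rw [map_smul, Matrix.toLin'_apply, hgb, smul_smul]
      have e2 := congrArg (fun w => b.repr w i) (e1.symm.trans h2)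
      simp only [b.repr_sum_self, map_smul, Finsupp.smul_apply, smul_eq_mul] at e2
      by_contra hne
      have e3 : t * c ^ (i : ℕ) = t * c ^ 0 := by
        rw [pow_zero, mul_one]
        exact mul_left_cancel₀ hne (by rw [e2, mul_comm])
      exact hi (Fin.ext (hprim.pow_inj i.2 (by norm_num) (mul_left_cancel₀ ht e3)))
    conv_lhs => rw [← b.sum_repr (M *ᵥ v)]
    rw [Fin.sum_univ_three, h3 1 (by decide), h3 2 (by decide), hb0]
    simp
  refine ⟨r, matrix_ext_basis b fun i => ?_⟩
  have hcomm : M * (h ^ (i : ℕ)).val = (h ^ (i : ℕ)).val * M := by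
    rw [Units.val_pow_eq_pow_val]
    exact (show Commute M h.val from hh).pow_right _
  rw [hb, mulVec_mulVec, hcomm, ← mulVec_mulVec, hMv, mulVec_smul, smul_mulVec, one_mulVec]

/-- The group Kˣ modulo cubes is cyclic of order at most 3, so a homomorphism to it from (ℤ/3)²
kills one of the four lines, generated by (1,0), (0,1), (1,1), (1,2). -/
theorem exists_cube_det [Finite K] {c d : K} (hc : c ≠ 0) (hd : d ≠ 0) :
    (∃ t, t ^ 3 = c) ∨ (∃ t, t ^ 3 = d) ∨ (∃ t, t ^ 3 = c * d) ∨ ∃ t, t ^ 3 = c * d ^ 2 := by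
  obtain ⟨γ, hγ⟩ := IsCyclic.exists_monoid_generator (α := Kˣ)
  obtain ⟨i, hi⟩ := Submonoid.mem_powers_iff _ _ |>.1 (hγ (Units.mk0 c hc))
  obtain ⟨j, hj⟩ := Submonoid.mem_powers_iff _ _ |>.1 (hγ (Units.mk0 d hd))
  have hi : (γ : K) ^ i = c := by simpa using congrArg Units.val hi
  have hj : (γ : K) ^ j = d := by simpa using congrArg Units.val hj
  have key : ∀ n : ℕ, 3 ∣ n → ∃ t : K, t ^ 3 = (γ : K) ^ n := by
    rintro _ ⟨m, rfl⟩
    exact ⟨(γ : K) ^ m, by rw [← pow_mul, mul_comm]⟩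
  rw [← hi, ← hj, ← pow_add, ← pow_mul, ← pow_add]
  have : 3 ∣ i ∨ 3 ∣ j ∨ 3 ∣ i + j ∨ 3 ∣ i + j * 2 := by
    rcases (by omega : i % 3 = 0 ∨ i % 3 = 1 ∨ i % 3 = 2) with hi | hi | hi <;>
      rcases (by omega : j % 3 = 0 ∨ j % 3 = 1 ∨ j % 3 = 2) with hj | hj | hj <;> omega
  rcases this with h | h | h | h
  · exact Or.inl (key _ h)
  · exact Or.inr (Or.inl (key _ h))
  · exact Or.inr (Or.inr (Or.inl (key _ h)))
  · exact Or.inr (Or.inr (Or.inr (key _ h)))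

/-- One of g, h, gh, gh² has a cube as determinant, hence an eigenvector over K itself; it still
forms a pair with h or g whose scalar is not 1. -/
theorem exists_eigen_pair [Finite K] {g h : GL (Fin 3) K} {c : K} (H : Rel g h c) (hc : c ≠ 1) :
    ∃ g' ∈ Subgroup.closure {g, h}, ∃ h' ∈ Subgroup.closure {g, h}, ∃ (c' t : K) (v : Fin 3 → K),
      Rel g' h' c' ∧ c' ≠ 1 ∧ v ≠ 0 ∧ g'.val *ᵥ v = t • v := by
  have hg : g ∈ Subgroup.closure {g, h} := Subgroup.subset_closure (by simp)
  have hh : h ∈ Subgroup.closure {g, h} := Subgroup.subset_closure (by simp)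
  have H' := H.symm
  have hc' : c⁻¹ ≠ 1 := by simpa using hc
  have aux : ∀ g' ∈ Subgroup.closure {g, h}, ∀ h' ∈ Subgroup.closure {g, h}, ∀ c' t,
      Rel g' h' c' → c' ≠ 1 → t ^ 3 = g'.val.det → ∃ g' ∈ Subgroup.closure {g, h},
      ∃ h' ∈ Subgroup.closure {g, h}, ∃ (c' t : K) (v : Fin 3 → K),
      Rel g' h' c' ∧ c' ≠ 1 ∧ v ≠ 0 ∧ g'.val *ᵥ v = t • v := by
    intro g' hg' h' hh' c' t H1 hc1 ht
    obtain ⟨v, hv, h1⟩ := exists_eigenvector_of_rel H1.symm (by simpa using hc1) ht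
    exact ⟨g', hg', h', hh', c', t, v, H1, hc1, hv, h1⟩
  rcases exists_cube_det g.det_ne_zero h.det_ne_zero with ⟨t, ht⟩ | ⟨t, ht⟩ | ⟨t, ht⟩ | ⟨t, ht⟩
  · exact aux g hg h hh c t H hc ht
  · exact aux h hh g hg c⁻¹ t H' hc' ht
  · refine aux (g * h) (mul_mem hg hh) h hh c t ?_ hc (by rw [ht, Units.val_mul, det_mul])
    simpa using H.mul_left (Rel.refl h)
  · refine aux (g * h ^ 2) (mul_mem hg (pow_mem hh 2)) h hh c t ?_ hc
      (by rw [ht, Units.val_mul, det_mul, Units.val_pow_eq_pow_val, det_pow])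
    simpa using H.mul_left ((Rel.refl h).pow_left 2)

theorem commute_of_mem_closure {g h k x : GL (Fin 3) K} (hg : Commute x g) (hh : Commute x h)
    (hk : k ∈ Subgroup.closure {g, h}) : Commute x k := by
  have : Subgroup.closure {g, h} ≤ Subgroup.centralizer {x} := by
    rw [Subgroup.closure_le]
    rintro y (rfl | rfl)
    · exact Subgroup.mem_centralizer_singleton_iff.2 hg.symm
    · exact Subgroup.mem_centralizer_singleton_iff.2 hh.symm
  exact (Subgroup.mem_centralizer_singleton_iff.1 (this hk)).symm

/-- A Schur lemma without extension of scalars: pass to a pair in the generated group having an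
eigenvector over K. -/
theorem mk_eq_one_of_commute [Finite K] {g h x : GL (Fin 3) K} {c : K} (H : Rel g h c)
    (hc : c ≠ 1) (hg : Commute x g) (hh : Commute x h) : mk x = 1 := by
  obtain ⟨g', hg', h', hh', c', t, v, H', hc', hv, h1⟩ := exists_eigen_pair H hc
  obtain ⟨r, hr⟩ := scalar_of_commute_eigen H' hc' hv h1 (M := x.val)
    (congrArg Units.val (commute_of_mem_closure hg hh hg'))
    (congrArg Units.val (commute_of_mem_closure hg hh hh'))
  exact mk_eq_one_iff.2 ⟨r, hr⟩

theorem Rel.commute_of_one {g h : GL (Fin 3) K} (H : Rel g h 1) : Commute g h :=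
  Units.ext (by rw [Units.val_mul, Units.val_mul, H, one_smul])

/-- A representative y commutes with g and h up to powers of c. Multiplying it by suitable powers of
g and h cancels both scalars, and the product is then scalar by Schur. -/
theorem eq_pow_mul_pow_of_commute [Finite K] {g h : GL (Fin 3) K} {c : K} (H : Rel g h c)
    (hc : c ≠ 1) {x : PGL(3, K)} (hg : x * mk g = mk g * x) (hh : x * mk h = mk h * x) :
    ∃ i j : ℕ, x = mk g ^ i * mk h ^ j := by
  obtain ⟨y, rfl⟩ := mk_surjective x
  obtain ⟨α, hα⟩ := exists_rel_of_commute hg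
  obtain ⟨β, hβ⟩ := exists_rel_of_commute hh
  have hprim := isPrimitiveRoot_of_cube H.cube hc
  obtain ⟨i, -, hi⟩ := hprim.eq_pow_of_pow_eq_one hα.cube
  obtain ⟨j, -, hj⟩ := hprim.eq_pow_of_pow_eq_one hβ.symm.cube
  have hβ0 := hβ.ne_zero
  have e1 : Rel (g ^ j * h ^ i * y) g 1 := by
    have := (((Rel.refl g).pow_left j).mul_left (H.symm.pow_left i)).mul_left hα
    rw [← hi] at this
    have hci : c ^ i ≠ 0 := by rw [hi]; exact hα.ne_zero
    simpa [inv_mul_cancel₀ hci] using this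
  have e2 : Rel (g ^ j * h ^ i * y) h 1 := by
    have := ((H.pow_left j).mul_left ((Rel.refl h).pow_left i)).mul_left hβ
    rw [hj] at this
    simpa [inv_mul_cancel₀ hβ0] using this
  have e3 := mk_eq_one_of_commute H hc e1.commute_of_one e2.commute_of_one
  have cube : ∀ z : GL (Fin 3) K, (∃ a, Rel z g a) → (∃ b, Rel z h b) → mk z ^ 3 = 1 := by
    rintro z ⟨a, ha⟩ ⟨b, hb⟩
    rw [← map_pow]
    refine mk_eq_one_of_commute H hc (Rel.commute_of_one ?_) (Rel.commute_of_one ?_)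
    · rw [← ha.cube]; exact ha.pow_left 3
    · rw [← hb.cube]; exact hb.pow_left 3
  have g3 := cube g ⟨1, Rel.refl g⟩ ⟨c, H⟩
  have h3 := cube h ⟨_, H.symm⟩ ⟨1, Rel.refl h⟩
  -- Cubes are trivial in the quotient, so inversion is squaring.
  refine ⟨2 * j, 2 * i, ?_⟩
  have gj : (mk g ^ j)⁻¹ = mk g ^ (2 * j) := by
    rw [inv_eq_iff_mul_eq_one, ← pow_add, show j + 2 * j = 3 * j by ring, pow_mul, g3, one_pow]
  have hi' : (mk h ^ i)⁻¹ = mk h ^ (2 * i) := by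
    rw [inv_eq_iff_mul_eq_one, ← pow_add, show i + 2 * i = 3 * i by ring, pow_mul, h3, one_pow]
  have hcomm : Commute (mk g) (mk h) := H.commute
  rw [← gj, ← hi', (hcomm.pow_pow j i).inv_inv.eq, ← _root_.mul_inv_rev]
  exact eq_inv_of_mul_eq_one_right (by rw [← e3, map_mul, map_mul, map_pow, map_pow])

theorem cube_eq_one_of_rel [Finite K] {g h : GL (Fin 3) K} {c : K} (H : Rel g h c) (hc : c ≠ 1) :
    mk g ^ 3 = 1 := by
  rw [← map_pow]
  refine mk_eq_one_of_commute H hc (Rel.commute_of_one ?_) (Rel.commute_of_one ?_)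
  · simpa using (Rel.refl g).pow_left 3
  · rw [← H.cube]; exact H.pow_left 3

/-! ### Abelian subgroups with noncommuting representatives -/

/-- A subgroup of `PGL₃(K)` has elements whose representatives do not commute. -/
def HasWeylPair (H : Subgroup PGL(3, K)) : Prop :=
  ∃ g h c, mk g ∈ H ∧ mk h ∈ H ∧ Rel g h c ∧ c ≠ 1

theorem HasWeylPair.maximal [Finite K] {H : Subgroup PGL(3, K)} (hH : HasWeylPair H)
    (hc : IsMulCommutative H) : IsMaximalAbelian H := by
  obtain ⟨g, h, c, hg, hh, hrel, hc1⟩ := hH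
  refine isMaximalAbelian_of_centralizer hc fun x hx => ?_
  obtain ⟨i, j, rfl⟩ := eq_pow_mul_pow_of_commute hrel hc1 (hx _ hg) (hx _ hh)
  exact mul_mem (pow_mem hg i) (pow_mem hh j)

/-- The classes of g and h have cube 1 and generate. They are independent because the scalars by
which gᵐhⁿ commutes with h and g are cᵐ and c⁻ⁿ. -/
theorem HasWeylPair.equiv [Finite K] {H : Subgroup PGL(3, K)} (hH : HasWeylPair H)
    (hcomm : IsMulCommutative H) : Nonempty (H ≃* Multiplicative (ZMod 3 × ZMod 3)) := by
  obtain ⟨g, h, c, hg, hh, hrel, hc1⟩ := hH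
  have hprim := isPrimitiveRoot_of_cube hrel.cube hc1
  have hgen : ∀ x : H, ∃ i j : ℕ, x = ⟨mk g, hg⟩ ^ i * ⟨mk h, hh⟩ ^ j := by
    intro x
    obtain ⟨i, j, hx⟩ := eq_pow_mul_pow_of_commute hrel hc1 (x := x)
      (isMulCommutative_iff.1 hcomm _ x.2 _ hg) (isMulCommutative_iff.1 hcomm _ x.2 _ hh)
    exact ⟨i, j, Subtype.ext hx⟩
  have g3 := cube_eq_one_of_rel hrel hc1
  have h3 := cube_eq_one_of_rel hrel.symm (by simpa using hc1)
  let : CommGroup H := { mul_comm := mul_comm' }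
  have h3' : ∀ x : Additive H, 3 • x = 0 := by
    intro x
    obtain ⟨i, j, hx⟩ := hgen x.toMul
    change x.toMul ^ 3 = 1
    rw [hx, mul_pow, ← pow_mul, ← pow_mul, mul_comm i, mul_comm j, pow_mul, pow_mul]
    have e1 : (⟨mk g, hg⟩ : H) ^ 3 = 1 := Subtype.ext g3
    have e2 : (⟨mk h, hh⟩ : H) ^ 3 = 1 := Subtype.ext h3
    rw [e1, e2, one_pow, one_pow, one_mul]
  let : Module (ZMod 3) (Additive H) := AddCommGroup.zmodModule h3'
  let a : Additive H := Additive.ofMul ⟨mk g, hg⟩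
  let b : Additive H := Additive.ofMul ⟨mk h, hh⟩
  let F : ZMod 3 × ZMod 3 →ₗ[ZMod 3] Additive H :=
    (LinearMap.toSpanSingleton (ZMod 3) _ a).coprod (LinearMap.toSpanSingleton (ZMod 3) _ b)
  have hF : ∀ i j : ℕ, F ((i : ZMod 3), (j : ZMod 3)) = i • a + j • b := by
    intro i j
    change (i : ZMod 3) • a + (j : ZMod 3) • b = _
    rw [Nat.cast_smul_eq_nsmul, Nat.cast_smul_eq_nsmul]
  have hsurj : Function.Surjective F := by
    intro x
    obtain ⟨i, j, hx⟩ := hgen x.toMul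
    exact ⟨(i, j), (hF i j).trans (congrArg Additive.ofMul hx).symm⟩
  have hinj : Function.Injective F := by
    rw [← LinearMap.ker_eq_bot, LinearMap.ker_eq_bot']
    rintro ⟨m, n⟩ hmn
    rw [← ZMod.natCast_zmod_val m, ← ZMod.natCast_zmod_val n, hF] at hmn
    have e0 : mk (g ^ m.val * h ^ n.val) = 1 := by
      rw [map_mul, map_pow, map_pow]
      exact congrArg (fun x : Additive H => (x.toMul : PGL(3, K))) hmn
    obtain ⟨r, hr⟩ := mk_eq_one_iff.1 e0
    have e1 : Rel (g ^ m.val * h ^ n.val) h (c ^ m.val) := by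
      simpa using (hrel.pow_left m.val).mul_left ((Rel.refl h).pow_left n.val)
    have e2 : Rel (g ^ m.val * h ^ n.val) g (c⁻¹ ^ n.val) := by
      simpa using ((Rel.refl g).pow_left m.val).mul_left (hrel.symm.pow_left n.val)
    have e3 := e1.eq_one_of_commute (by rw [hr]; simp)
    have e4 := e2.eq_one_of_commute (by rw [hr]; simp)
    rw [inv_pow, inv_eq_one] at e4
    rw [hprim.pow_eq_one_iff_dvd] at e3 e4
    ext
    · exact (ZMod.val_eq_zero m).1 (Nat.eq_zero_of_dvd_of_lt e3 (ZMod.val_lt m))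
    · exact (ZMod.val_eq_zero n).1 (Nat.eq_zero_of_dvd_of_lt e4 (ZMod.val_lt n))
  let E : (ZMod 3 × ZMod 3) ≃+ Additive H := AddEquiv.ofBijective F.toAddMonoidHom ⟨hinj, hsurj⟩
  exact ⟨
    { toFun := fun g => Multiplicative.ofAdd (E.symm (Additive.ofMul g))
      invFun := fun w => (E w.toAdd).toMul
      left_inv := fun g => E.apply_symm_apply (Additive.ofMul g)
      right_inv := fun w => E.symm_apply_apply w.toAdd
      map_mul' := fun g h => E.symm.map_add (Additive.ofMul g) (Additive.ofMul h) }⟩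

/-! ### Normal forms of such pairs and their conjugacy -/

theorem exists_smul_GL (g : GL (Fin 3) K) {s : K} (hs : s ≠ 0) :
    ∃ g' : GL (Fin 3) K, g'.val = s • g.val ∧ mk g' = mk g := by
  refine ⟨g * GeneralLinearGroup.scalar (Fin 3) (Units.mk0 s hs), ?_, by simp⟩
  rw [Units.val_mul, GeneralLinearGroup.coe_scalar]
  ext i j; simp [mul_comm]

theorem Rel.smul_left {g g' h : GL (Fin 3) K} {c s : K} (H : Rel g h c) (hg : g'.val = s • g.val) :
    Rel g' h c := by
  unfold Rel at *
  rw [hg, smul_mul_assoc, H, mul_smul_comm, smul_comm]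

theorem Rel.smul_right {g h h' : GL (Fin 3) K} {c s : K} (H : Rel g h c)
    (hg : h'.val = s • h.val) : Rel g h' c := by
  unfold Rel at *
  rw [hg, smul_mul_assoc, mul_smul_comm, H, smul_comm]

/-- The subgroup contains `g`, `h` with `g h = ω h g`, `g v = v` and `h ^ 3 = d` for some
nonzero vector `v`. -/
def StdPair (H : Subgroup PGL(3, K)) (ω d : K) : Prop :=
  ∃ (g h : GL (Fin 3) K) (v : Fin 3 → K), mk g ∈ H ∧ mk h ∈ H ∧ Rel g h ω ∧ v ≠ 0 ∧
    g.val *ᵥ v = v ∧ (h ^ 3).val = d • 1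

theorem StdPair.hasWeylPair {H : Subgroup PGL(3, K)} {ω d : K} (hω : ω ≠ 1) (h : StdPair H ω d) :
    HasWeylPair H := by
  obtain ⟨g, h, v, hg, hh, hr, -, -, -⟩ := h
  exact ⟨g, h, ω, hg, hh, hr, hω⟩

/-- The map sending v, hv, h²v to v', h'v', h'²v' intertwines both g with g' and h with h', because
the eigenvalues 1, ω, ω² agree and h³ = h'³ = d. The images generate the second group. -/
theorem StdPair.conj [Finite K] {H H' : Subgroup PGL(3, K)} {ω d : K} (hω : ω ≠ 1)
    (hH : IsMulCommutative H) (hH' : IsMulCommutative H') (h : StdPair H ω d)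
    (h' : StdPair H' ω d) : IsConjSubgroup H H' := by
  have hmax := (h'.hasWeylPair hω).maximal hH'
  obtain ⟨g, h, v, hg, hh, hr, hv, hgv, hhd⟩ := h
  obtain ⟨g', h', v', hg', hh', hr', hv', hgv', hhd'⟩ := h'
  obtain ⟨b, hb, hgb⟩ := exists_rel_basis hr hω hv (t := 1) (by rw [hgv, one_smul])
  obtain ⟨b', hb', hgb'⟩ := exists_rel_basis hr' hω hv' (t := 1) (by rw [hgv', one_smul])
  let φ : (Fin 3 → K) ≃ₗ[K] (Fin 3 → K) := b.equiv b' (Equiv.refl _)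
  let P := equivGL φ
  have hP : ∀ i, P.val *ᵥ b i = b' i := fun i => by
    rw [equivGL_mulVec]; simp [φ]
  have hPg : P * g = g' * P := Units.ext <| matrix_ext_basis b fun i => by
    rw [Units.val_mul, Units.val_mul, ← mulVec_mulVec, ← mulVec_mulVec, hgb, mulVec_smul, hP, hgb']
  have hPpow : ∀ n : ℕ, P.val *ᵥ ((h ^ n).val *ᵥ v) = (h' ^ n).val *ᵥ v' := by
    have base : ∀ n : ℕ, n < 3 → P.val *ᵥ ((h ^ n).val *ᵥ v) = (h' ^ n).val *ᵥ v' := by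
      intro n hn
      have := hP ⟨n, hn⟩
      rwa [hb, hb'] at this
    intro n
    induction n using Nat.strong_induction_on with
    | _ n ih =>
      by_cases hn : n < 3
      · exact base n hn
      · obtain ⟨m, rfl⟩ : ∃ m, n = m + 3 := ⟨n - 3, by omega⟩
        rw [pow_add, pow_add, Units.val_mul, Units.val_mul, hhd, hhd', ← mulVec_mulVec,
          ← mulVec_mulVec, smul_mulVec, smul_mulVec, one_mulVec, one_mulVec, mulVec_smul,
          mulVec_smul, mulVec_smul, ih m (by omega)]
  have hPh : P * h = h' * P := Units.ext <| matrix_ext_basis b fun i => by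
    have e1 : h.val *ᵥ b i = (h ^ ((i : ℕ) + 1)).val *ᵥ v := by
      rw [hb, pow_succ', Units.val_mul, mulVec_mulVec]
    have e2 : h'.val *ᵥ b' i = (h' ^ ((i : ℕ) + 1)).val *ᵥ v' := by
      rw [hb', pow_succ', Units.val_mul, mulVec_mulVec]
    rw [Units.val_mul, Units.val_mul, ← mulVec_mulVec, ← mulVec_mulVec, hP, e1, e2, hPpow]
  have mem : ∀ {x x' : GL (Fin 3) K}, P * x = x' * P → mk x ∈ H →
      mk x' ∈ (MulAut.conj (mk P) • H : Subgroup PGL(3, K)) := by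
    intro x x' hx hm
    have : x' = P * x * P⁻¹ := by rw [hx]; group
    rw [this, mem_conj_iff]
    simpa [mul_assoc] using hm
  refine ⟨mk P, ?_⟩
  have hab := isMulCommutative_conj hH (mk P)
  refine le_antisymm (hmax.2 hab ?_) ?_
  all_goals
    intro x hx
    obtain ⟨i, j, rfl⟩ := eq_pow_mul_pow_of_commute hr' hω (x := x)
      (isMulCommutative_iff.1 hH' _ hx _ hg') (isMulCommutative_iff.1 hH' _ hx _ hh')
    exact mul_mem (pow_mem (mem hPg hg) i) (pow_mem (mem hPh hh) j)

/-- A noncube d₀ generates Kˣ modulo cubes, whose classes are 1, d₀, d₀². -/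
theorem cube_classes [Finite K] {d d₀ : K} (hd : d ≠ 0) (hd₀ : ∀ t, t ^ 3 ≠ d₀) :
    ∃ s, s ≠ 0 ∧ (d = s ^ 3 ∨ d = s ^ 3 * d₀ ∨ d = s ^ 3 * d₀ ^ 2) := by
  have h0 : d₀ ≠ 0 := by rintro rfl; exact hd₀ 0 (by simp)
  rcases exists_cube_det hd h0 with ⟨t, ht⟩ | ⟨t, ht⟩ | ⟨t, ht⟩ | ⟨t, ht⟩
  · exact ⟨t, by rintro rfl; simp at ht; exact hd ht.symm, Or.inl ht.symm⟩
  · exact absurd ht (hd₀ t)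
  · have ht0 : t ≠ 0 := by
      rintro rfl
      rw [zero_pow (by norm_num)] at ht
      exact mul_ne_zero hd h0 ht.symm
    refine ⟨t / d₀, div_ne_zero ht0 h0, Or.inr (Or.inr ?_)⟩
    field_simp
    rw [ht]
  · have ht0 : t ≠ 0 := by
      rintro rfl
      rw [zero_pow (by norm_num)] at ht
      exact mul_ne_zero hd (pow_ne_zero 2 h0) ht.symm
    refine ⟨t / d₀, div_ne_zero ht0 h0, Or.inr (Or.inl ?_)⟩
    field_simp
    rw [ht]

/-- Scaling g makes its eigenvalue on v equal to 1, squaring it if necessary makes the commutation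
scalar ω, and scaling h changes h³ by cubes. -/
theorem HasWeylPair.stdPair [Finite K] {H : Subgroup PGL(3, K)} {ω d₀ : K}
    (hω : IsPrimitiveRoot ω 3) (hd₀ : ∀ t, t ^ 3 ≠ d₀) (h : HasWeylPair H) :
    StdPair H ω 1 ∨ StdPair H ω d₀ := by
  have hω4 : ω ^ (2 * 2) = ω := by linear_combination ω * hω.pow_eq_one
  have h00 : d₀ ≠ 0 := by rintro rfl; exact hd₀ 0 (by simp)
  obtain ⟨g, h, c, hg, hh, hr, hc⟩ := h
  have hcl : ∀ x ∈ Subgroup.closure {g, h}, mk x ∈ H := by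
    have : Subgroup.closure {g, h} ≤ H.comap mk := by
      rw [Subgroup.closure_le]
      rintro x (rfl | rfl)
      · exact hg
      · exact hh
    exact fun x hx => this hx
  obtain ⟨g₁, hg₁, h₁, hh₁, c₁, t, v, hr₁, hc₁, hv, hgv⟩ := exists_eigen_pair hr hc
  have ht : t ≠ 0 := by
    rintro rfl
    rw [zero_smul] at hgv
    exact mulVec_ne_zero _ hv hgv
  obtain ⟨g₂, hg₂, hmk⟩ := exists_smul_GL g₁ (inv_ne_zero ht)
  have hr₂ := hr₁.smul_left hg₂
  have hgv₂ : g₂.val *ᵥ v = v := by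
    rw [hg₂, smul_mulVec, hgv, smul_smul, inv_mul_cancel₀ ht, one_smul]
  have hmem₂ : mk g₂ ∈ H := hmk ▸ hcl _ hg₁
  obtain ⟨g₃, hmem₃, hr₃, hgv₃⟩ : ∃ g₃, mk g₃ ∈ H ∧ Rel g₃ h₁ ω ∧ g₃.val *ᵥ v = v := by
    obtain ⟨i, hi, rfl⟩ := hω.eq_pow_of_pow_eq_one hr₂.cube
    interval_cases i
    · simp at hc₁
    · exact ⟨g₂, hmem₂, by simpa using hr₂, hgv₂⟩
    · refine ⟨g₂ ^ 2, by rw [map_pow]; exact pow_mem hmem₂ 2, ?_, ?_⟩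
      · have := hr₂.pow_left 2
        rwa [← pow_mul, hω4] at this
      · rw [sq, Units.val_mul, ← mulVec_mulVec, hgv₂, hgv₂]
  have hω1 : ω ≠ 1 := hω.ne_one (by norm_num)
  have hmemh := hcl _ hh₁
  obtain ⟨d, hd⟩ := mk_eq_one_iff.1
    ((map_pow _ _ _).trans (cube_eq_one_of_rel hr₃.symm (by simpa using hω1)))
  have hd0 : d ≠ 0 := by
    rintro rfl
    rw [zero_smul] at hd
    exact (h₁ ^ 3).ne_zero hd
  obtain ⟨s, hs, h⟩ := cube_classes hd0 hd₀
  have scaled : ∀ {g h : GL (Fin 3) K} {d d' s : K}, mk g ∈ H → mk h ∈ H → Rel g h ω →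
      g.val *ᵥ v = v → (h ^ 3).val = d • 1 → s ≠ 0 → d = s ^ 3 * d' → StdPair H ω d' := by
    intro g h d d' s hg hh hr hgv hd hs hds
    obtain ⟨h', hh', hmk'⟩ := exists_smul_GL h (inv_ne_zero hs)
    refine ⟨g, h', v, hg, hmk' ▸ hh, hr.smul_right hh', hv, hgv, ?_⟩
    rw [Units.val_pow_eq_pow_val, hh', smul_pow, ← Units.val_pow_eq_pow_val, hd, smul_smul, hds]
    congr 1
    field_simp
  rcases h with h | h | h
  · exact Or.inl (scaled hmem₃ hmemh hr₃ hgv₃ hd hs (by rw [h, mul_one]))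
  · exact Or.inr (scaled hmem₃ hmemh hr₃ hgv₃ hd hs h)
  -- In the class of d₀², squaring both matrices keeps the scalar, as ω⁴ = ω, and gives h⁶ =
  -- (s³d₀²)² = (s²d₀)³·d₀.
  · refine Or.inr (scaled (g := g₃ ^ 2) (h := h₁ ^ 2) (d := d ^ 2) (s := s ^ 2 * d₀)
      (by rw [map_pow]; exact pow_mem hmem₃ 2) (by rw [map_pow]; exact pow_mem hmemh 2) ?_ ?_ ?_
      (mul_ne_zero (pow_ne_zero 2 hs) h00) (by rw [h]; ring))
    · have := (hr₃.pow_left 2).pow_right 2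
      rwa [← pow_mul, hω4] at this
    · rw [sq, Units.val_mul, ← mulVec_mulVec, hgv₃, hgv₃]
    · rw [← pow_mul, mul_comm, pow_mul, Units.val_pow_eq_pow_val, hd, smul_pow, one_pow]

/-! ### The determinant modulo cubes as an invariant -/

/-- All representatives of elements have a cube as determinant. -/
def CubeDet (H : Subgroup PGL(3, K)) : Prop :=
  ∀ k : GL (Fin 3) K, mk k ∈ H → ∃ t, t ^ 3 = k.val.det

/-- Both generators have determinant 1, so any representative c·gⁱhʲ has determinant c³. -/
theorem StdPair.cubeDet [Finite K] {H : Subgroup PGL(3, K)} {ω : K} (hω : ω ≠ 1)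
    (hH : IsMulCommutative H) (h : StdPair H ω 1) : CubeDet H := by
  obtain ⟨g, h, v, hg, hh, hr, hv, hgv, hhd⟩ := h
  have hgdet : g.val.det = 1 := by
    rw [det_eq_cube_of_eigenvector hr.symm (by simpa using hω) hv (t := 1) (by rw [hgv, one_smul]),
      one_pow]
  obtain ⟨b, hb, -⟩ := exists_rel_basis hr hω hv (t := 1) (by rw [hgv, one_smul])
  have hhdet : h.val.det = 1 := by
    -- As h³ = 1, the sum v + hv + h²v is fixed by h; it is nonzero because the summands form a
    -- basis.
    rw [det_eq_cube_of_eigenvector hr hω (v := b 0 + b 1 + b 2) (t := 1) ?_ ?_, one_pow]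
    · intro h0
      have := congrArg (fun w => b.repr w 0) h0
      simp at this
    · rw [one_smul, mulVec_add, mulVec_add, hb, hb, hb, mulVec_mulVec, mulVec_mulVec, mulVec_mulVec,
        ← Units.val_mul, ← Units.val_mul, ← Units.val_mul, ← pow_succ', ← pow_succ', ← pow_succ']
      have : (h ^ (((2 : Fin 3) : ℕ) + 1)).val *ᵥ v = v := by
        change (h ^ 3).val *ᵥ v = v
        rw [hhd, one_smul, one_mulVec]
      rw [this]
      simp
      abel
  intro k hk
  obtain ⟨i, j, hij⟩ := eq_pow_mul_pow_of_commute hr hω (x := mk k)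
    (isMulCommutative_iff.1 hH _ hk _ hg) (isMulCommutative_iff.1 hH _ hk _ hh)
  rw [← map_pow, ← map_pow, ← map_mul, eq_comm, mk_eq_mk_iff_smul] at hij
  obtain ⟨c, -, hc⟩ := hij
  refine ⟨c, ?_⟩
  rw [hc, det_smul, Units.val_mul, det_mul, Units.val_pow_eq_pow_val, Units.val_pow_eq_pow_val,
    det_pow, det_pow, hgdet, hhdet]
  simp

theorem CubeDet.conj {H H' : Subgroup PGL(3, K)} (h : CubeDet H) (hc : IsConjSubgroup H H') :
    CubeDet H' := by
  obtain ⟨x, rfl⟩ := hc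
  obtain ⟨P, rfl⟩ := mk_surjective x
  intro k hk
  rw [mem_conj_iff, ← map_inv, ← map_mul, ← map_mul] at hk
  obtain ⟨t, ht⟩ := h _ hk
  refine ⟨t, ht.trans ?_⟩
  rw [Units.val_mul, Units.val_mul, det_mul, det_mul, mul_right_comm, ← det_mul, ← Units.val_mul,
    inv_mul_cancel, Units.val_one, det_one, one_mul]

theorem HasWeylPair.conj {H H' : Subgroup PGL(3, K)} (h : HasWeylPair H)
    (hc : IsConjSubgroup H H') : HasWeylPair H' := by
  obtain ⟨x, rfl⟩ := hc
  obtain ⟨P, rfl⟩ := mk_surjective x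
  obtain ⟨g, h, c, hg, hh, hr, hc⟩ := h
  refine ⟨P * g * P⁻¹, P * h * P⁻¹, c, ?_, ?_, ?_, hc⟩
  · rw [mem_conj_iff]; simpa [mul_assoc] using hg
  · rw [mem_conj_iff]; simpa [mul_assoc] using hh
  · have e1 : P * g * P⁻¹ * (P * h * P⁻¹) = P * (g * h) * P⁻¹ := by group
    have e2 : P * h * P⁻¹ * (P * g * P⁻¹) = P * (h * g) * P⁻¹ := by group
    have e3 : (g * h).val = c • (h * g).val := hr
    unfold Rel
    rw [← Units.val_mul, e1, ← Units.val_mul, e2, Units.val_mul, Units.val_mul, e3, mul_smul_comm,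
      smul_mul_assoc, ← Units.val_mul, ← Units.val_mul]

/-! ### The Heisenberg group -/

section heisenberg

variable {ω : K}

theorem diagonal_mul_cyclic (h3 : ω ^ 3 = 1) :
    diagonal ![1, ω, ω ^ 2] * !![0, 0, 1; 1, 0, 0; 0, 1, 0] =
      ω • (!![0, 0, 1; 1, 0, 0; 0, 1, 0] * diagonal ![1, ω, ω ^ 2]) := by
  have hd : diagonal ![1, ω, ω ^ 2] = !![1, 0, 0; 0, ω, 0; 0, 0, ω ^ 2] := by
    ext i j; fin_cases i <;> fin_cases j <;> simp
  rw [hd]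
  ext i j; fin_cases i <;> fin_cases j <;> simp [Matrix.mul_apply, Fin.sum_univ_three]
  · linear_combination -h3
  · ring

theorem heisenberg_comm (hω : IsPrimitiveRoot ω 3) : IsMulCommutative (heisenbergGroup ω) := by
  have h3 := hω.pow_eq_one
  rw [heisenbergGroup, MonoidHom.map_closure]
  refine Subgroup.isMulCommutative_closure ?_
  have key : ∀ x y : GL (Fin 3) K, x.val = diagonal ![1, ω, ω ^ 2] →
      y.val = !![0, 0, 1; 1, 0, 0; 0, 1, 0] → Rel x y ω := by
    intro x y hx hy
    rw [Rel, hx, hy, diagonal_mul_cyclic h3]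
  rintro _ ⟨x, hx, rfl⟩ _ ⟨y, hy, rfl⟩
  rcases hx with hx | hx <;> rcases hy with hy | hy
  · rw [show x = y from Units.ext (hx.trans hy.symm)]
  · exact (key x y hx hy).commute
  · exact (key y x hy hx).commute.symm
  · rw [show x = y from Units.ext (hx.trans hy.symm)]

theorem heisenberg_stdPair (hω : IsPrimitiveRoot ω 3) : StdPair (heisenbergGroup ω) ω 1 := by
  have h3 := hω.pow_eq_one
  have h0 := hω.ne_zero (by norm_num)
  have hd1 : (diagonal ![1, ω, ω ^ 2]).det ≠ 0 := by
    rw [det_diagonal, Fin.prod_univ_three]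
    simp [h0]
  have hd2 : (!![0, 0, 1; 1, 0, 0; 0, 1, 0] : Matrix (Fin 3) (Fin 3) K).det ≠ 0 := by
    rw [det_fin_three]; simp
  refine ⟨GeneralLinearGroup.mkOfDetNeZero _ hd1, GeneralLinearGroup.mkOfDetNeZero _ hd2,
    Pi.single 0 1, Subgroup.mem_map_of_mem _ (Subgroup.subset_closure (Or.inl rfl)),
    Subgroup.mem_map_of_mem _ (Subgroup.subset_closure (Or.inr rfl)), ?_, ?_, ?_, ?_⟩
  · exact diagonal_mul_cyclic h3
  · intro h
    have := congrFun h 0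
    simp at this
  · change diagonal ![1, ω, ω ^ 2] *ᵥ Pi.single 0 1 = Pi.single 0 1
    ext i; fin_cases i <;> simp [mulVec_diagonal]
  · rw [Units.val_pow_eq_pow_val]
    change !![0, 0, 1; 1, 0, 0; 0, 1, 0] ^ 3 = _
    ext i j; fin_cases i <;> fin_cases j <;>
      simp [pow_succ, Matrix.mul_apply, Fin.sum_univ_three]

end heisenberg

/-! ### The Frobenius group -/

/-- Cubing identifies ω with 1, so on a finite field it cannot be surjective. -/
theorem exists_noncube [Finite K] {ω : K} (hω : IsPrimitiveRoot ω 3) :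
    ∃ d₀ : K, ∀ t, t ^ 3 ≠ d₀ := by
  by_contra! h
  have hinj : Function.Injective (fun t : K => t ^ 3) := Finite.injective_iff_surjective.2 h
  exact hω.ne_one (by norm_num) (hinj (a₁ := ω) (a₂ := 1) (by simp [hω.pow_eq_one]))

/-- A finite field embeds in any other whose degree over K is a multiple of its own. -/
theorem exists_root_of_irreducible [Finite K] {L : Type*} [Field L] [Algebra K L] [Finite L]
    {p : Polynomial K} (hp : Irreducible p) (h : p.natDegree = Module.finrank K L) :
    ∃ x : L, Polynomial.aeval x p = 0 := by
  have := Fact.mk hp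
  have hf : Module.finrank K (AdjoinRoot p) ∣ Module.finrank K L := by
    rw [← h, (AdjoinRoot.powerBasis hp.ne_zero).finrank, AdjoinRoot.powerBasis_dim]
  obtain ⟨f⟩ := FiniteField.nonempty_algHom_of_finrank_dvd hf
  refine ⟨f (AdjoinRoot.root p), ?_⟩
  rw [Polynomial.aeval_algHom_apply, AdjoinRoot.aeval_eq, AdjoinRoot.mk_self, map_zero]

section frobenius

variable {L : Type*} [Field L] [Algebra K L]

/-- The generators of the Frobenius group. -/
def frobeniusGens (K L : Type*) [Field K] [Field L] [Algebra K L] :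
    Set (LinearMap.GeneralLinearGroup K L) :=
  {f | (∃ x : L, (∃ c : K, c ≠ 0 ∧ x ^ 3 = algebraMap K L c) ∧ ∀ y, f.val y = x * y) ∨
      ∀ y, f.val y = y ^ Nat.card K}

theorem mem_frobeniusGroup {e : L ≃ₗ[K] (Fin 3 → K)} {f : LinearMap.GeneralLinearGroup K L}
    (hf : f ∈ frobeniusGens K L) : mk (toGL e f) ∈ frobeniusGroup e :=
  Subgroup.mem_map_of_mem _ (Subgroup.subset_closure hf)

theorem rel_toGL {e : L ≃ₗ[K] (Fin 3 → K)} {f f' : LinearMap.GeneralLinearGroup K L} {c : K}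
    (h : ∀ y, f.val (f'.val y) = c • f'.val (f.val y)) : Rel (toGL e f) (toGL e f') c := by
  refine GL_ext_mulVec e fun v => ?_
  rw [← mulVec_mulVec, toGL_val_mulVec, toGL_val_mulVec, smul_mulVec, ← mulVec_mulVec,
    toGL_val_mulVec, toGL_val_mulVec, h, map_smul]

theorem exists_cubeRoot_algebraMap {ω : K} (hω : IsPrimitiveRoot ω 3) {x : L} (hx : x ^ 3 = 1) :
    ∃ c : K, algebraMap K L c = x := by
  have := hω.map_of_injective (algebraMap K L).injective
  obtain ⟨i, -, hi⟩ := this.eq_pow_of_pow_eq_one hx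
  exact ⟨ω ^ i, by rw [map_pow, hi]⟩

/-- The cube of x^(q−1) is c^(q−1) = 1, and the cube roots of unity of L lie in K. So Frobenius
commutes with multiplication by x up to a scalar. -/
theorem frobenius_scalar [Finite K] {ω : K} (hω : IsPrimitiveRoot ω 3) {x : L} {c : K} (hc : c ≠ 0)
    (hx : x ^ 3 = algebraMap K L c) : ∃ b : K, x ^ Nat.card K = b • x := by
  have := Fintype.ofFinite K
  have hx0 : x ≠ 0 := by
    rintro rfl
    rw [zero_pow (by norm_num), eq_comm, map_eq_zero] at hx
    exact hc hx
  have hq : 1 ≤ Nat.card K := Finite.one_lt_card.le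
  obtain ⟨b, hb⟩ := exists_cubeRoot_algebraMap (L := L) hω (x := x ^ (Nat.card K - 1)) (by
    rw [← pow_mul, mul_comm, pow_mul, hx, ← map_pow, Nat.card_eq_fintype_card,
      FiniteField.pow_card_sub_one_eq_one c hc, map_one])
  refine ⟨b, ?_⟩
  rw [Algebra.smul_def, hb, ← pow_succ, Nat.sub_add_cancel hq]

theorem frobenius_comm [Finite K] {ω : K} (hω : IsPrimitiveRoot ω 3) (e : L ≃ₗ[K] (Fin 3 → K)) :
    IsMulCommutative (frobeniusGroup e) := by
  rw [frobeniusGroup, MonoidHom.map_closure]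
  refine Subgroup.isMulCommutative_closure ?_
  have key : ∀ (f f' : LinearMap.GeneralLinearGroup K L) (x : L),
      (∃ c : K, c ≠ 0 ∧ x ^ 3 = algebraMap K L c) → (∀ y, f.val y = x * y) →
      (∀ y, f'.val y = y ^ Nat.card K) → mk (toGL e f') * mk (toGL e f) =
        mk (toGL e f) * mk (toGL e f') := by
    rintro f f' x ⟨c, hc, hx⟩ hf hf'
    obtain ⟨b, hb⟩ := frobenius_scalar hω hc hx
    refine Rel.commute (c := b) (rel_toGL fun y => ?_)
    rw [hf', hf, hf, hf', mul_pow, hb, smul_mul_assoc]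
  rintro _ ⟨f, hf, rfl⟩ _ ⟨f', hf', rfl⟩
  rcases hf with ⟨x, hx, hf⟩ | hf <;> rcases hf' with ⟨x', hx', hf'⟩ | hf'
  · refine Rel.commute (c := 1) (rel_toGL fun y => ?_)
    rw [hf, hf', hf', hf, one_smul, mul_left_comm]
  · exact (key f f' x hx hf hf').symm
  · exact key f' f x' hx' hf' hf
  · rw [show f = f' from Units.ext (LinearMap.ext fun y => by rw [hf, hf'])]

/-- For θ³ = d₀ with d₀ a noncube, Frobenius F and multiplication by θ satisfy Fθ = b·θF with b =
θ^(q−1). If the determinant of θ were a cube, multiplication by θ would have an eigenvalue t in K,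
and then θ = t. -/
theorem frobenius_weyl [Finite K] {ω : K} (hω : IsPrimitiveRoot ω 3)
    (hL : Module.finrank K L = 3) (e : L ≃ₗ[K] (Fin 3 → K)) :
    HasWeylPair (frobeniusGroup e) ∧ ¬ CubeDet (frobeniusGroup e) := by
  have : FiniteDimensional K L := Module.finite_of_finrank_pos (by omega)
  have : Finite L := Module.finite_of_finite K
  have := Fintype.ofFinite K
  obtain ⟨d₀, hd₀⟩ := exists_noncube hω
  have h00 : d₀ ≠ 0 := by rintro rfl; exact hd₀ 0 (by simp)
  obtain ⟨θ, hθ⟩ := exists_root_of_irreducible (L := L)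
    (X_pow_sub_C_irreducible_of_prime Nat.prime_three hd₀) (by
      rw [Polynomial.natDegree_X_pow_sub_C, hL])
  have hθ3 : θ ^ 3 = algebraMap K L d₀ := by
    simpa [sub_eq_zero] using hθ
  have hθ0 : θ ≠ 0 := by
    rintro rfl
    rw [zero_pow (by norm_num), eq_comm, map_eq_zero] at hθ3
    exact h00 hθ3
  have hnot : ∀ t : K, t • (1 : L) ≠ θ := by
    intro t ht
    apply hd₀ t
    apply (algebraMap K L).injective
    rw [← hθ3, ← ht, ← Algebra.algebraMap_eq_smul_one, map_pow]
  let F : LinearMap.GeneralLinearGroup K L := LinearMap.GeneralLinearGroup.ofLinearEquiv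
    (FiniteField.frobeniusAlgEquivOfAlgebraic K L).toLinearEquiv
  have hF : ∀ y, F.val y = y ^ Nat.card K := fun y => by
    rw [Nat.card_eq_fintype_card]; rfl
  let X : LinearMap.GeneralLinearGroup K L :=
    Units.map (Algebra.lmul K L : L →* Module.End K L) (Units.mk0 θ hθ0)
  have hX : ∀ y, X.val y = θ * y := fun y => rfl
  have hFm := mem_frobeniusGroup (e := e) (f := F) (Or.inr hF)
  have hXm := mem_frobeniusGroup (e := e) (f := X) (Or.inl ⟨θ, ⟨d₀, h00, hθ3⟩, hX⟩)
  obtain ⟨b, hb⟩ := frobenius_scalar hω h00 hθ3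
  have hrel : Rel (toGL e F) (toGL e X) b := rel_toGL fun y => by
    rw [hF, hX, hX, hF, mul_pow, hb, smul_mul_assoc]
  -- If b = 1, then θ together with K would give q + 1 roots of X^q − X.
  have hb1 : b ≠ 1 := by
    rintro rfl
    rw [one_smul, Nat.card_eq_fintype_card] at hb
    have h0 := FiniteField.X_pow_card_sub_X_ne_zero L (Fintype.one_lt_card (α := K))
    classical
    have hsub : (insert θ (Finset.univ.image (algebraMap K L))).val ⊆
        (Polynomial.X ^ Fintype.card K - Polynomial.X : Polynomial L).roots := by
      intro z hz
      rw [Polynomial.mem_roots h0, Polynomial.IsRoot.def, Polynomial.eval_sub,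
        Polynomial.eval_pow, Polynomial.eval_X, sub_eq_zero]
      rcases Finset.mem_insert.1 (Finset.mem_def.2 hz) with rfl | hz
      · exact hb
      · obtain ⟨t, -, rfl⟩ := Finset.mem_image.1 hz
        rw [← map_pow, FiniteField.pow_card]
    have hle := Polynomial.card_le_degree_of_subset_roots hsub
    rw [FiniteField.X_pow_card_sub_X_natDegree_eq L Fintype.one_lt_card,
      Finset.card_insert_of_notMem fun hz => ?_,
      Finset.card_image_of_injective _ (algebraMap K L).injective, Finset.card_univ] at hle
    · exact absurd hle (by simp)
    · obtain ⟨t, -, ht⟩ := Finset.mem_image.1 hz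
      exact hnot t (by rw [← Algebra.algebraMap_eq_smul_one, ht])
  refine ⟨⟨_, _, b, hFm, hXm, hrel, hb1⟩, fun hcube => ?_⟩
  obtain ⟨t, ht⟩ := hcube _ hXm
  obtain ⟨v, hv, hXv⟩ := exists_eigenvector_of_rel hrel hb1 ht
  obtain ⟨y, rfl⟩ := e.surjective v
  rw [toGL_val_mulVec, hX, ← map_smul] at hXv
  have hy : y ≠ 0 := by rintro rfl; simp at hv
  apply hnot t
  refine mul_right_cancel₀ hy ?_
  rw [e.injective hXv, smul_mul_assoc, one_mul]

end frobenius

/-! ### Commuting sets of endomorphisms -/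

section commuting

variable {V : Type*} [AddCommGroup V] [Module K V]

/-- The endomorphisms in `S` are multiplications by elements of the algebra `A`, after some
identification of `A` with the vector space. -/
def ActsByMul (S : Set (Module.End K V)) (A : Type*) [CommRing A] [Algebra K A] : Prop :=
  ∃ φ : A ≃ₗ[K] V, ∀ f ∈ S, ∃ a, ∀ x, f (φ x) = φ (a * x)

/-- Commuting with multiplication by a generator γ makes f linear over A, hence multiplication by
its value at 1. -/
theorem eq_mul_of_commute_generator {A : Type*} [CommRing A] [Algebra K A] {γ : A}
    (hγ : Algebra.adjoin K {γ} = ⊤) (φ : A ≃ₗ[K] V) {g f : Module.End K V}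
    (hg : ∀ x, g (φ x) = φ (γ * x)) (hf : f * g = g * f) (x : A) :
    f (φ x) = φ (φ.symm (f (φ 1)) * x) := by
  let B : Subalgebra K A :=
    { carrier := {a | ∀ x, f (φ (a * x)) = φ (a * φ.symm (f (φ x)))}
      mul_mem' := by
        intro a b ha hb x
        rw [mul_assoc, ha, hb, φ.symm_apply_apply, mul_assoc]
      add_mem' := by
        intro a b ha hb x
        rw [add_mul, map_add, map_add, ha, hb, add_mul, map_add]
      algebraMap_mem' := by
        intro c x
        rw [← Algebra.smul_def, ← Algebra.smul_def, map_smul, map_smul, map_smul,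
          φ.apply_symm_apply] }
  have hB : B = ⊤ := by
    rw [eq_top_iff, ← hγ, Algebra.adjoin_le_iff, Set.singleton_subset_iff]
    intro x
    rw [← hg, ← hg, φ.apply_symm_apply]
    exact LinearMap.congr_fun hf (φ x)
  have hx : x ∈ B := hB ▸ Algebra.mem_top
  have := hx 1
  rwa [mul_one, mul_comm] at this

theorem ActsByMul.of_generator {A : Type*} [CommRing A] [Algebra K A] {γ : A}
    (hγ : Algebra.adjoin K {γ} = ⊤) (φ : A ≃ₗ[K] V) {g : Module.End K V}
    (hg : ∀ x, g (φ x) = φ (γ * x)) {S : Set (Module.End K V)} (hS : ∀ f ∈ S, f * g = g * f) :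
    ActsByMul S A :=
  ⟨φ, fun f hf => ⟨_, eq_mul_of_commute_generator hγ φ hg (hS f hf)⟩⟩

theorem ActsByMul.of_injective [FiniteDimensional K V] {A : Type*} [CommRing A] [Algebra K A]
    [FiniteDimensional K A] {γ : A} (hγ : Algebra.adjoin K {γ} = ⊤) (ψ : A →ₗ[K] V)
    (hψ : ∀ x, ψ x = 0 → x = 0) (h : Module.finrank K A = Module.finrank K V)
    {g : Module.End K V} (hg : ∀ x, g (ψ x) = ψ (γ * x)) {S : Set (Module.End K V)}
    (hS : ∀ f ∈ S, f * g = g * f) : ActsByMul S A :=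
  of_generator hγ (LinearEquiv.ofInjectiveOfFinrankEq ψ ((injective_iff_map_eq_zero ψ).2 hψ) h)
    hg hS

theorem pow_finrank_eq_zero_of_isNilpotent [FiniteDimensional K V] {n : Module.End K V}
    (h : IsNilpotent n) : n ^ Module.finrank K V = 0 := by
  have := LinearMap.aeval_self_charpoly n
  rwa [h.charpoly_eq_X_pow_finrank, map_pow, Polynomial.aeval_X] at this

/-- In degree 2 or 3 a characteristic polynomial without roots is irreducible, so it has a root γ
generating L. For v ≠ 0 the map p(γ) ↦ p(g)v identifies L with V and turns γ into g. -/
theorem actsByMul_of_no_eigenvalue [Finite K] {L : Type*} [Field L] [Algebra K L]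
    (hV : Module.finrank K V = Module.finrank K L)
    (h2 : 2 ≤ Module.finrank K L) (h3 : Module.finrank K L ≤ 3) {S : Set (Module.End K V)}
    {g : Module.End K V} (hg : ∀ c, ¬ g.HasEigenvalue c) (hS : ∀ f ∈ S, f * g = g * f) :
    ActsByMul S L := by
  have : FiniteDimensional K L := Module.finite_of_finrank_pos (by omega)
  have : FiniteDimensional K V := Module.finite_of_finrank_pos (by omega)
  have : Finite L := Module.finite_of_finite K
  have hdeg : g.charpoly.natDegree = Module.finrank K L := by
    rw [LinearMap.charpoly_natDegree, hV]
  have hirr : Irreducible g.charpoly := by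
    rw [Polynomial.irreducible_iff_roots_eq_zero_of_degree_le_three (by omega) (by omega)]
    refine Multiset.eq_zero_of_forall_notMem fun c hc => hg c ?_
    exact Module.End.hasEigenvalue_iff_isRoot_charpoly g c |>.2 (Polynomial.isRoot_of_mem_roots hc)
  obtain ⟨γ, hγ⟩ := exists_root_of_irreducible (L := L) hirr hdeg
  have hmin : g.charpoly = minpoly K γ := minpoly.eq_of_irreducible_of_monic hirr hγ
    (LinearMap.charpoly_monic g)
  have htop : Algebra.adjoin K {γ} = ⊤ := by
    have h := (Field.primitive_element_iff_minpoly_natDegree_eq K γ).2 (by rw [← hmin, hdeg])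
    rw [← IntermediateField.adjoin_simple_toSubalgebra_of_isAlgebraic (IsAlgebraic.of_finite K γ),
      h, IntermediateField.top_toSubalgebra]
  obtain ⟨v, hv⟩ : ∃ v : V, v ≠ 0 := by
    have : Nontrivial V := Module.nontrivial_of_finrank_pos (R := K) (by omega)
    exact exists_ne 0
  let F : Polynomial K →ₗ[K] V := (LinearMap.applyₗ v) ∘ₗ (Polynomial.aeval g).toLinearMap
  let G : Polynomial K →ₗ[K] L := (Polynomial.aeval γ).toLinearMap
  have hF : ∀ q, F q = Polynomial.aeval g q v := fun q => rfl
  have hG : ∀ q, G q = Polynomial.aeval γ q := fun q => rfl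
  have hGs : Function.Surjective G := by
    intro y
    have hy : y ∈ Algebra.adjoin K {γ} := htop ▸ Algebra.mem_top
    rw [Algebra.adjoin_singleton_eq_range_aeval] at hy
    exact hy
  have hGF : ∀ q, G q = 0 ↔ F q = 0 := by
    intro q
    rw [hG, hF, ← minpoly.dvd_iff, ← hmin]
    constructor
    · rintro ⟨r, rfl⟩
      rw [mul_comm, map_mul, LinearMap.aeval_self_charpoly, mul_zero, LinearMap.zero_apply]
    · intro hq
      -- If the irreducible characteristic polynomial does not divide q, a Bézout identity applied
      -- to v gives v = 0.
      by_contra hnd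
      obtain ⟨a, b, hab⟩ := (hirr.coprime_iff_not_dvd).2 hnd
      apply hv
      have := congrArg (fun r => Polynomial.aeval g r v) hab
      simpa [LinearMap.aeval_self_charpoly, hq] using this.symm
  let ψ : L →ₗ[K] V := (LinearMap.ker G).liftQ F (fun q hq => (hGF q).1 hq) ∘ₗ
    (G.quotKerEquivOfSurjective hGs).symm.toLinearMap
  have hψ : ∀ q, ψ (G q) = F q := by
    intro q
    have : (G.quotKerEquivOfSurjective hGs).symm (G q) = (LinearMap.ker G).mkQ q := by
      rw [LinearEquiv.symm_apply_eq]; rfl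
    simp only [ψ, LinearMap.comp_apply, LinearEquiv.coe_coe, this]
    rfl
  refine ActsByMul.of_injective htop ψ (fun y hy => ?_) hV.symm (g := g) (fun x => ?_) hS
  · obtain ⟨q, rfl⟩ := hGs y
    rw [hψ] at hy
    exact (hGF q).2 hy
  obtain ⟨q, rfl⟩ := hGs x
  have : γ * G q = G (Polynomial.X * q) := by simp [hG]
  rw [this, hψ, hψ, hF, hF, map_mul, Polynomial.aeval_X]
  rfl

/-- The summands are the kernel and range of a large power of n, both preserved by everything
commuting with n. The exponent k + 1 ensures that the power is positive, so the kernel contains ker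
n. -/
theorem exists_fitting [FiniteDimensional K V] (n : Module.End K V) :
    ∃ M N : Submodule K V, IsCompl M N ∧
      (∀ f : Module.End K V, f * n = n * f → (∀ x ∈ M, f x ∈ M) ∧ ∀ x ∈ N, f x ∈ N) ∧
      (¬ Function.Injective n → M ≠ ⊥) ∧ (¬ IsNilpotent n → N ≠ ⊥) := by
  obtain ⟨k, hk⟩ := Filter.eventually_atTop.1 n.eventually_isCompl_ker_pow_range_pow
  refine ⟨LinearMap.ker (n ^ (k + 1)), LinearMap.range (n ^ (k + 1)), hk _ (by omega), ?_, ?_, ?_⟩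
  · intro f hf
    have hc : ∀ x, f ((n ^ (k + 1)) x) = (n ^ (k + 1)) (f x) := fun x =>
      LinearMap.congr_fun (Commute.pow_right (show Commute f n from hf) (k + 1)).eq x
    refine ⟨fun x hx => ?_, ?_⟩
    · rw [LinearMap.mem_ker] at *
      rw [← hc, hx, map_zero]
    · rintro _ ⟨y, rfl⟩
      exact ⟨f y, (hc y).symm⟩
  · intro h hbot
    apply h
    rw [← LinearMap.ker_eq_bot, eq_bot_iff, ← hbot]
    intro x hx
    rw [LinearMap.mem_ker] at *
    rw [pow_succ, Module.End.mul_apply, hx, map_zero]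
  · intro h hbot
    exact h ⟨k + 1, LinearMap.range_eq_bot.1 hbot⟩

/-- Algebra structures on `B × K` from complementary invariant subspaces. -/
theorem ActsByMul.prod {S : Set (Module.End K V)} {M N : Submodule K V} (h : IsCompl M N)
    (hM : Module.finrank K M = 1) (hSM : ∀ f ∈ S, ∀ x ∈ M, f x ∈ M)
    (hSN : ∀ f ∈ S, ∀ x ∈ N, f x ∈ N) {B : Type*} [CommRing B] [Algebra K B]
    (hB : ActsByMul {f' : Module.End K N | ∃ f ∈ S, ∀ x, (f' x : V) = f x} B) :
    ActsByMul S (B × K) := by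
  obtain ⟨φ, hφ⟩ := hB
  have : FiniteDimensional K M := Module.finite_of_finrank_pos (by omega)
  let μ : K ≃ₗ[K] M := LinearEquiv.ofFinrankEq K M (by rw [hM, Module.finrank_self])
  let ψ : (B × K) ≃ₗ[K] V := (φ.prodCongr μ).trans
    ((Submodule.prodEquivOfIsCompl N M h.symm))
  have hψ : ∀ x, ψ x = (φ x.1 : V) + (μ x.2 : V) := fun x => rfl
  refine ⟨ψ, fun f hf => ?_⟩
  obtain ⟨b, hb⟩ := hφ (f.restrict (hSN f hf)) ⟨f, hf, fun x => rfl⟩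
  obtain ⟨c, hc⟩ : ∃ c : K, c = μ.symm ⟨f (μ 1), hSM f hf _ (μ 1).2⟩ := ⟨_, rfl⟩
  have hc' : f (μ 1) = c • (μ 1 : V) := by
    have := congrArg μ hc
    rw [μ.apply_symm_apply, ← mul_one c, ← smul_eq_mul, map_smul] at this
    exact (congrArg Subtype.val this).symm
  refine ⟨(b, c), fun x => ?_⟩
  have h1 : f (φ x.1) = φ (b * x.1) := congrArg Subtype.val (hb x.1)
  have h2 : f (μ x.2) = μ (c * x.2) := by
    rw [← mul_one x.2, ← smul_eq_mul x.2, map_smul, Submodule.coe_smul, map_smul, hc', mul_smul_comm,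
      map_smul, ← smul_eq_mul c, map_smul]
    rfl
  rw [hψ, map_add, h1, h2, hψ]
  rfl

theorem actsByMul_of_finrank_eq_one {S : Set (Module.End K V)} (h : Module.finrank K V = 1) :
    ActsByMul S K := by
  have : FiniteDimensional K V := Module.finite_of_finrank_pos (by omega)
  let μ : K ≃ₗ[K] V := LinearEquiv.ofFinrankEq K V (by rw [h, Module.finrank_self])
  refine ⟨μ, fun f _ => ⟨μ.symm (f (μ 1)), fun x => ?_⟩⟩
  rw [mul_comm, ← smul_eq_mul, map_smul, μ.apply_symm_apply, ← map_smul, ← map_smul, smul_eq_mul,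
    mul_one]

theorem not_injective_of_hasEigenvalue {n : Module.End K V} {c : K}
    (h : n.HasEigenvalue c) : ¬ Function.Injective (n - algebraMap K (Module.End K V) c) := by
  intro hinj
  obtain ⟨v, hv⟩ := h.exists_hasEigenvector
  apply hv.2
  apply hinj
  rw [map_zero, LinearMap.sub_apply, hv.apply_eq_smul, Module.algebraMap_end_apply, sub_self]

theorem commute_sub_algebraMap {f g : Module.End K V} (h : f * g = g * f) (c : K) :
    f * (g - algebraMap K (Module.End K V) c) = (g - algebraMap K (Module.End K V) c) * f := by
  rw [mul_sub, sub_mul, h, Algebra.commutes]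

theorem adjoin_eps : Algebra.adjoin K {(DualNumber.eps : DualNumber K)} = ⊤ := by
  rw [eq_top_iff]
  intro x _
  have : x = algebraMap K (DualNumber K) x.fst +
      algebraMap K (DualNumber K) x.snd * (DualNumber.eps : DualNumber K) := by
    rw [TrivSqZeroExt.algebraMap_eq_inl]
    exact TrivSqZeroExt.ext (by simp) (by simp)
  rw [this]
  exact add_mem (Subalgebra.algebraMap_mem _ _)
    (mul_mem (Subalgebra.algebraMap_mem _ _) (Algebra.subset_adjoin (Set.mem_singleton _)))

/-- The pair v, n v with n v ≠ 0 is a basis on which n acts as ε on 1, ε. -/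
theorem actsByMul_dual (hV : Module.finrank K V = 2) {S : Set (Module.End K V)}
    {n : Module.End K V} (hnil : IsNilpotent n) (hn0 : n ≠ 0) (hS : ∀ f ∈ S, f * n = n * f) :
    ActsByMul S (DualNumber K) := by
  have : FiniteDimensional K V := Module.finite_of_finrank_pos (by omega)
  have hn2 : n ^ 2 = 0 := by
    rw [← hV]; exact pow_finrank_eq_zero_of_isNilpotent hnil
  obtain ⟨v, hv⟩ : ∃ v, n v ≠ 0 := by
    by_contra! h
    exact hn0 (LinearMap.ext h)
  have hnn : ∀ x, n (n x) = 0 := fun x => by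
    rw [← Module.End.mul_apply, ← sq, hn2, LinearMap.zero_apply]
  let ψ : DualNumber K →ₗ[K] V :=
    { toFun x := x.fst • v + x.snd • n v
      map_add' x y := by simp only [TrivSqZeroExt.fst_add, TrivSqZeroExt.snd_add]; module
      map_smul' k x := by
        simp only [TrivSqZeroExt.fst_smul, TrivSqZeroExt.snd_smul, smul_eq_mul,
          RingHom.id_apply]; module }
  have hψ : ∀ x, ψ x = x.fst • v + x.snd • n v := fun x => rfl
  have hfr : Module.finrank K (DualNumber K) = Module.finrank K V := by
    rw [hV]
    exact (Module.finrank_prod (R := K) (M := K) (M' := K)).trans (by simp)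
  have : FiniteDimensional K (DualNumber K) := inferInstanceAs (FiniteDimensional K (K × K))
  refine ActsByMul.of_injective (γ := (DualNumber.eps : DualNumber K)) ?_ ψ (fun x hx => ?_) hfr
    (g := n) (fun x => ?_) hS
  · exact adjoin_eps
  · rw [hψ] at hx
    have h0 : x.fst = 0 := by
      have := congrArg n hx
      simpa [hnn, hv] using this
    rw [h0, zero_smul, zero_add, smul_eq_zero, or_iff_left hv] at hx
    exact TrivSqZeroExt.ext h0 hx
  · rw [hψ, hψ]
    simp [hnn]

/-- An element without eigenvalues gives L. Otherwise a nonscalar g minus an eigenvalue is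
nilpotent, giving dual numbers, or splits the plane, giving K × K; scalars alone also act through K
× K. -/
theorem actsByMul_of_finrank_eq_two [Finite K] {L : Type*} [Field L] [Algebra K L]
    (hL : Module.finrank K L = 2) (hV : Module.finrank K V = 2) {S : Set (Module.End K V)}
    (hS : ∀ f ∈ S, ∀ g ∈ S, f * g = g * f) :
    ActsByMul S L ∨ ActsByMul S (K × K) ∨ ActsByMul S (DualNumber K) := by
  have : FiniteDimensional K V := Module.finite_of_finrank_pos (by omega)
  by_cases h1 : ∃ g ∈ S, ∀ c, ¬ g.HasEigenvalue c
  · obtain ⟨g, hg, hc⟩ := h1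
    exact Or.inl (actsByMul_of_no_eigenvalue (by omega) (by omega) (by omega) hc
      fun f hf => hS f hf g hg)
  push Not at h1
  right
  by_cases h2 : ∀ g ∈ S, ∃ c : K, g = algebraMap K _ c
  · left
    let φ : (K × K) ≃ₗ[K] V := LinearEquiv.ofFinrankEq _ _ (by simp [hV])
    refine ⟨φ, fun f hf => ?_⟩
    obtain ⟨c, rfl⟩ := h2 f hf
    refine ⟨(c, c), fun x => ?_⟩
    rw [Module.algebraMap_end_apply, ← map_smul]
    rfl
  push Not at h2
  obtain ⟨g, hg, hgc⟩ := h2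
  obtain ⟨c, hc⟩ := h1 g hg
  set n := g - algebraMap K _ c with hn
  have hn0 : n ≠ 0 := sub_ne_zero.2 (hgc c)
  have hni : ¬ Function.Injective n := not_injective_of_hasEigenvalue hc
  have hnS : ∀ f ∈ S, f * n = n * f := fun f hf => commute_sub_algebraMap (hS f hf g hg) c
  by_cases hnil : IsNilpotent n
  · exact Or.inr (actsByMul_dual hV hnil hn0 hnS)
  · left
    obtain ⟨M, N, hMN, hinv, hM, hN⟩ := exists_fitting n
    have h1 := mt Submodule.finrank_eq_zero.1 (hM hni)
    have h2 := mt Submodule.finrank_eq_zero.1 (hN hnil)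
    have h3 := Submodule.finrank_add_eq_of_isCompl hMN
    exact ActsByMul.prod hMN (by omega) (fun f hf => (hinv f (hnS f hf)).1)
      (fun f hf => (hinv f (hnS f hf)).2) (actsByMul_of_finrank_eq_one (by omega))

end commuting

/-! ### Commuting endomorphisms of a three-dimensional space -/

section commuting

variable {V : Type*} [AddCommGroup V] [Module K V]

theorem adjoin_jet : Algebra.adjoin K {(⟨0, 1, 0⟩ : Jet K)} = ⊤ := by
  rw [eq_top_iff]
  intro x _
  have : x = x.a • (1 : Jet K) + x.b • (⟨0, 1, 0⟩ : Jet K) +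
      x.c • ((⟨0, 1, 0⟩ : Jet K) * ⟨0, 1, 0⟩) := by
    ext <;> simp
  have h : (⟨0, 1, 0⟩ : Jet K) ∈ Algebra.adjoin K {(⟨0, 1, 0⟩ : Jet K)} :=
    Algebra.subset_adjoin (Set.mem_singleton _)
  rw [this]
  exact add_mem (add_mem (Subalgebra.smul_mem _ (one_mem _) _) (Subalgebra.smul_mem _ h _))
    (Subalgebra.smul_mem _ (mul_mem h h) _)

theorem actsByMul_jet (hV : Module.finrank K V = 3) {S : Set (Module.End K V)}
    {n : Module.End K V} (hnil : IsNilpotent n) (hn0 : n ^ 2 ≠ 0) (hS : ∀ f ∈ S, f * n = n * f) :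
    ActsByMul S (Jet K) := by
  have : FiniteDimensional K V := Module.finite_of_finrank_pos (by omega)
  have : FiniteDimensional K (Jet K) := Module.Finite.equiv (Jet.toFun3 K).symm
  have hn3 : n ^ 3 = 0 := by
    rw [← hV]; exact pow_finrank_eq_zero_of_isNilpotent hnil
  obtain ⟨v, hv⟩ : ∃ v, n (n v) ≠ 0 := by
    by_contra! h
    exact hn0 (LinearMap.ext fun x => by rw [sq]; exact h x)
  have hnn : ∀ x, n (n (n x)) = 0 := fun x => by
    have := LinearMap.congr_fun hn3 x
    rwa [pow_succ, sq] at this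
  let ψ : Jet K →ₗ[K] V :=
    { toFun x := x.a • v + x.b • n v + x.c • n (n v)
      map_add' x y := by simp only [Jet.add_a, Jet.add_b, Jet.add_c]; module
      map_smul' k x := by
        simp only [Jet.smul_a, Jet.smul_b, Jet.smul_c, RingHom.id_apply]; module }
  have hψ : ∀ x, ψ x = x.a • v + x.b • n v + x.c • n (n v) := fun x => rfl
  have hfr : Module.finrank K (Jet K) = Module.finrank K V := by
    rw [hV, (Jet.toFun3 K).finrank_eq]; simp
  refine ActsByMul.of_injective adjoin_jet ψ (fun x hx => ?_) hfr (g := n) (fun x => ?_) hS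
  · rw [hψ] at hx
    have ha : x.a = 0 := by
      have := congrArg (fun y => n (n y)) hx
      simpa [hnn, hv] using this
    rw [ha, zero_smul, zero_add] at hx
    have hb : x.b = 0 := by
      have := congrArg n hx
      simpa [hnn, hv] using this
    rw [hb, zero_smul, zero_add, smul_eq_zero, or_iff_left hv] at hx
    exact Jet.ext ha hb hx
  · rw [hψ, hψ]
    simp [hnn]

theorem actsByMul_of_finrank_eq_three [Finite K] {L₂ L₃ : Type*} [Field L₂] [Field L₃]
    [Algebra K L₂] [Algebra K L₃] (hL₂ : Module.finrank K L₂ = 2) (hL₃ : Module.finrank K L₃ = 3)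
    (hV : Module.finrank K V = 3) {S : Set (Module.End K V)}
    (hS : ∀ f ∈ S, ∀ g ∈ S, f * g = g * f) :
    ActsByMul S L₃ ∨ ActsByMul S (L₂ × K) ∨ ActsByMul S ((K × K) × K) ∨
      ActsByMul S (DualNumber K × K) ∨ ActsByMul S (Jet K) ∨
        ∀ f ∈ S, ∃ c, (f - algebraMap K (Module.End K V) c) ^ 2 = 0 := by
  have : FiniteDimensional K V := Module.finite_of_finrank_pos (by omega)
  by_cases h1 : ∃ g ∈ S, ∀ c, ¬ g.HasEigenvalue c
  · obtain ⟨g, hg, hc⟩ := h1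
    exact Or.inl (actsByMul_of_no_eigenvalue (by omega) (by omega) (by omega) hc
      fun f hf => hS f hf g hg)
  push Not at h1
  right
  have hcomm : ∀ g ∈ S, ∀ c, ∀ f ∈ S, f * (g - algebraMap K (Module.End K V) c) =
      (g - algebraMap K (Module.End K V) c) * f :=
    fun g hg c f hf => commute_sub_algebraMap (hS f hf g hg) c
  by_cases h2 : ∃ g ∈ S, ∃ c, ¬ IsNilpotent (g - algebraMap K (Module.End K V) c) ∧
      ¬ Function.Injective (g - algebraMap K (Module.End K V) c)
  · obtain ⟨g, hg, c, hnil, hni⟩ := h2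
    obtain ⟨M, N, hMN, hinv, hM, hN⟩ := exists_fitting (g - algebraMap K (Module.End K V) c)
    replace hinv := fun f hf => hinv f (hcomm g hg c f hf)
    have key : ∀ M N : Submodule K V, IsCompl M N → Module.finrank K M = 1 →
        Module.finrank K N = 2 → (∀ f ∈ S, ∀ x ∈ M, f x ∈ M) → (∀ f ∈ S, ∀ x ∈ N, f x ∈ N) →
        ActsByMul S (L₂ × K) ∨ ActsByMul S ((K × K) × K) ∨ ActsByMul S (DualNumber K × K) := by
      intro M N hMN hM hN hSM hSN
      have h := actsByMul_of_finrank_eq_two hL₂ hN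
        (S := {f' : Module.End K N | ∃ f ∈ S, ∀ x, (f' x : V) = f x}) (by
          rintro f' ⟨f, hf, hff⟩ g' ⟨g, hg, hgg⟩
          ext x
          rw [Module.End.mul_apply, Module.End.mul_apply, hff, hgg, hgg, hff]
          exact LinearMap.congr_fun (hS f hf g hg) x)
      exact h.imp (ActsByMul.prod hMN hM hSM hSN)
        (Or.imp (ActsByMul.prod hMN hM hSM hSN) (ActsByMul.prod hMN hM hSM hSN))
    have d1 := mt Submodule.finrank_eq_zero.1 (hM hni)
    have d2 := mt Submodule.finrank_eq_zero.1 (hN hnil)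
    have d3 := Submodule.finrank_add_eq_of_isCompl hMN
    -- Both Fitting summands are nonzero, so their dimensions are 1 and 2 in one order or the other.
    have h := if h : Module.finrank K M = 1 then
        key M N hMN h (by omega) (fun f hf => (hinv f hf).1) (fun f hf => (hinv f hf).2)
      else key N M hMN.symm (by omega) (by omega) (fun f hf => (hinv f hf).2)
        (fun f hf => (hinv f hf).1)
    tauto
  push Not at h2
  have hnil : ∀ g ∈ S, ∃ c, IsNilpotent (g - algebraMap K (Module.End K V) c) := by
    intro g hg
    obtain ⟨c, hc⟩ := h1 g hg
    exact ⟨c, of_not_not fun h => not_injective_of_hasEigenvalue hc (h2 g hg c h)⟩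
  by_cases h3 : ∃ g ∈ S, ∃ c, IsNilpotent (g - algebraMap K (Module.End K V) c) ∧
      (g - algebraMap K (Module.End K V) c) ^ 2 ≠ 0
  · obtain ⟨g, hg, c, hn, hn2⟩ := h3
    exact Or.inr (Or.inr (Or.inr (Or.inl (actsByMul_jet hV hn hn2 (hcomm g hg c)))))
  push Not at h3
  refine Or.inr (Or.inr (Or.inr (Or.inr fun g hg => ?_)))
  obtain ⟨c, hc⟩ := hnil g hg
  exact ⟨c, h3 g hg c hc⟩

theorem exists_basis_of_pair (hV : Module.finrank K V = 3) {u w : V}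
    (h : LinearIndependent K ![u, w]) :
    ∃ b : Module.Basis (Fin 3) K V, b 0 = u ∧ b 1 = w := by
  have : FiniteDimensional K V := Module.finite_of_finrank_pos (by omega)
  obtain ⟨z, hz⟩ : ∃ z, z ∉ Submodule.span K (Set.range ![u, w]) := by
    by_contra! hz
    have h1 := finrank_span_eq_card h
    rw [(eq_top_iff.2 fun z _ => hz z : Submodule.span K (Set.range ![u, w]) = ⊤), finrank_top,
      hV] at h1
    simp at h1
  have hl := h.finSnoc hz
  refine ⟨basisOfLinearIndependentOfCardEqFinrank hl (by simp [hV]), ?_, ?_⟩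
  · simp
  · simp

/-- Square-zero endomorphisms of a 3-dimensional space have rank at most one. -/
theorem exists_smul_of_sq_eq_zero (hV : Module.finrank K V = 3) {n : Module.End K V}
    (hn : ∀ x, n (n x) = 0) {z : V} (hz : n z ≠ 0) (x : V) : ∃ a : K, n x = a • n z := by
  have : FiniteDimensional K V := Module.finite_of_finrank_pos (by omega)
  have h1 := LinearMap.finrank_range_add_finrank_ker n
  have h2 : Module.finrank K (LinearMap.range n) ≤ Module.finrank K (LinearMap.ker n) :=
    Submodule.finrank_mono (by rintro _ ⟨y, rfl⟩; exact hn y)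
  have h3 : Module.finrank K (LinearMap.range n) ≤ 1 := by omega
  obtain ⟨v, hv⟩ := finrank_le_one_iff.1 h3
  obtain ⟨c, hc⟩ := hv ⟨n z, z, rfl⟩
  obtain ⟨d, hd⟩ := hv ⟨n x, x, rfl⟩
  have hc0 : c ≠ 0 := by
    rintro rfl
    rw [zero_smul] at hc
    exact hz (congrArg Subtype.val hc).symm
  refine ⟨d / c, ?_⟩
  have hc' : c • (v : V) = n z := congrArg Subtype.val hc
  have hd' : d • (v : V) = n x := congrArg Subtype.val hd
  rw [← hc', ← hd', smul_smul, div_mul_cancel₀ _ hc0]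

/-- As n has rank one, m(nx) = n(mx) = a·nx for some a; applying m again gives a² = 0. -/
theorem mul_eq_zero_of_sq_eq_zero (hV : Module.finrank K V = 3) {m n : Module.End K V}
    (hm : ∀ x, m (m x) = 0) (hn : ∀ x, n (n x) = 0) (h : m * n = n * m) (x : V) :
    m (n x) = 0 := by
  by_contra hx
  have h' : ∀ y, m (n y) = n (m y) := LinearMap.congr_fun h
  have hnx : n x ≠ 0 := by intro h0; rw [h0, map_zero] at hx; exact hx rfl
  obtain ⟨a, ha⟩ := exists_smul_of_sq_eq_zero hV hn hnx (m x)
  rw [h', ha] at hx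
  apply hx
  have hmm := hm (n x)
  rw [h', ha, map_smul, h', ha, smul_smul, smul_eq_zero, mul_self_eq_zero, or_iff_left hnx] at hmm
  rw [hmm, zero_smul]

/-- The square-zero parts annihilate each other. Either their images lie in a common line, or two
images are independent; these two vectors are then killed by every square-zero part and span a plane
containing all the images. -/
theorem exists_basis_of_sq_eq_zero (hV : Module.finrank K V = 3) {S : Set (Module.End K V)}
    (hS : ∀ f ∈ S, ∀ g ∈ S, f * g = g * f)
    (hS2 : ∀ f ∈ S, ∃ c, (f - algebraMap K (Module.End K V) c) ^ 2 = 0) :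
    ∃ b : Module.Basis (Fin 3) K V,
      (∀ f ∈ S, ∃ r a c : K, f (b 0) = r • b 0 ∧ f (b 1) = a • b 0 + r • b 1 ∧
        f (b 2) = c • b 0 + r • b 2) ∨
      (∀ f ∈ S, ∃ r a c : K, f (b 0) = r • b 0 ∧ f (b 1) = r • b 1 ∧
        f (b 2) = c • b 0 + a • b 1 + r • b 2) := by
  have : FiniteDimensional K V := Module.finite_of_finrank_pos (by omega)
  let N : Set (Module.End K V) := {n | (∀ x, n (n x) = 0) ∧
    ∃ f ∈ S, ∃ c, n = f - algebraMap K (Module.End K V) c}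
  have hNS : ∀ f ∈ S, ∃ c : K, ∃ n ∈ N, ∀ x, f x = n x + c • x := by
    intro f hf
    obtain ⟨c, hc⟩ := hS2 f hf
    refine ⟨c, _, ⟨fun x => ?_, f, hf, c, rfl⟩, fun x => ?_⟩
    · have := LinearMap.congr_fun hc x
      rwa [sq] at this
    · simp
  have hmul : ∀ m ∈ N, ∀ n ∈ N, ∀ x, m (n x) = 0 := by
    rintro m ⟨hm, f, hf, c, hmf⟩ n ⟨hn, g, hg, d, hng⟩
    refine mul_eq_zero_of_sq_eq_zero hV hm hn ?_
    rw [hng]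
    refine commute_sub_algebraMap ?_ d
    rw [hmf]
    exact (commute_sub_algebraMap (hS g hg f hf) c).symm
  by_cases h0 : ∀ n ∈ N, n = 0
  · refine ⟨(Module.finBasis K V).reindex (finCongr hV), Or.inl fun f hf => ?_⟩
    obtain ⟨c, n, hn, hfn⟩ := hNS f hf
    rw [h0 n hn] at hfn
    exact ⟨c, 0, 0, by simp [hfn], by simp [hfn], by simp [hfn]⟩
  push Not at h0
  obtain ⟨n₀, hn₀, hne⟩ := h0
  obtain ⟨z, hz⟩ : ∃ z, n₀ z ≠ 0 := by
    by_contra! h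
    exact hne (LinearMap.ext h)
  by_cases hA : ∀ m ∈ N, ∀ x, ∃ a : K, a • n₀ z = m x
  · have hpair : LinearIndependent K ![n₀ z, z] := by
      rw [LinearIndependent.pair_iff' hz]
      intro a ha
      apply hz
      rw [← ha, map_smul, hn₀.1, smul_zero]
    obtain ⟨b, hb0, -⟩ := exists_basis_of_pair hV hpair
    refine ⟨b, Or.inl fun f hf => ?_⟩
    obtain ⟨r, n, hn, hfn⟩ := hNS f hf
    obtain ⟨a, ha⟩ := hA n hn (b 1)
    obtain ⟨c, hc⟩ := hA n hn (b 2)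
    refine ⟨r, a, c, ?_, ?_, ?_⟩
    · rw [hfn, hb0, hmul n hn n₀ hn₀, zero_add]
    · rw [hfn, ← ha, hb0]
    · rw [hfn, ← hc, hb0]
  · push Not at hA
    obtain ⟨m, hm, x, hx⟩ := hA
    obtain ⟨b, hb0, hb1⟩ := exists_basis_of_pair hV ((LinearIndependent.pair_iff' hz).2 hx)
    have hb2 : n₀ (b 2) ≠ 0 := by
      intro h
      apply hne
      refine b.ext fun i => ?_
      fin_cases i
      · simpa [hb0] using hn₀.1 z
      · simpa [hb1] using hmul n₀ hn₀ m hm x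
      · simpa using h
    refine ⟨b, Or.inr fun f hf => ?_⟩
    obtain ⟨r, n, hn, hfn⟩ := hNS f hf
    have hrepr := b.sum_repr (n (b 2))
    rw [Fin.sum_univ_three] at hrepr
    -- Apply n₀ to the expansion of n(b₂): everything vanishes except the multiple of n₀(b₂) ≠ 0.
    have h2 : b.repr (n (b 2)) 2 = 0 := by
      have := congrArg n₀ hrepr
      rw [hmul n₀ hn₀ n hn, map_add, map_add, map_smul, map_smul, map_smul, hb0, hb1, hn₀.1,
        hmul n₀ hn₀ m hm, smul_zero, smul_zero, zero_add, zero_add, smul_eq_zero] at this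
      exact this.resolve_right hb2
    rw [h2, zero_smul, add_zero] at hrepr
    refine ⟨r, b.repr (n (b 2)) 1, b.repr (n (b 2)) 0, ?_, ?_, ?_⟩
    · rw [hfn, hb0, hmul n hn n₀ hn₀, zero_add]
    · rw [hfn, hb1, hmul n hn m hm, zero_add]
    · rw [hfn, hrepr]

end commuting

/-! ### Abelian subgroups of `PGL₃(K)` -/

/-- All representatives of elements of the subgroup commute with each other. -/
def LiftsCommute (H : Subgroup PGL(3, K)) : Prop :=
  ∀ g h : GL (Fin 3) K, mk g ∈ H → mk h ∈ H → g.val * h.val = h.val * g.val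

theorem LiftsCommute.not_hasWeylPair {H : Subgroup PGL(3, K)} (h : LiftsCommute H) :
    ¬ HasWeylPair H := by
  rintro ⟨g, g', c, hg, hg', hr, hc⟩
  exact hc (hr.eq_one_of_commute (h g g' hg hg'))

theorem liftsCommute_of_not_hasWeylPair {H : Subgroup PGL(3, K)} (hH : IsMulCommutative H)
    (h : ¬ HasWeylPair H) : LiftsCommute H := by
  intro g g' hg hg'
  obtain ⟨c, hc⟩ := exists_rel_of_commute (isMulCommutative_iff.1 hH _ hg _ hg')
  by_cases h1 : c = 1
  · rw [hc, h1, one_smul]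
  · exact absurd ⟨g, g', c, hg, hg', hc, h1⟩ h

/-- The endomorphisms of `K³` representing elements of the subgroup. -/
def liftEnds (H : Subgroup PGL(3, K)) : Set (Module.End K (Fin 3 → K)) :=
  {f | ∃ g : GL (Fin 3) K, mk g ∈ H ∧ ∀ x, f x = g.val *ᵥ x}

theorem mem_liftEnds {H : Subgroup PGL(3, K)} {g : GL (Fin 3) K} (hg : mk g ∈ H) :
    Matrix.toLin' g.val ∈ liftEnds H := ⟨g, hg, fun x => by rw [Matrix.toLin'_apply]⟩

theorem LiftsCommute.liftEnds {H : Subgroup PGL(3, K)} (h : LiftsCommute H) :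
    ∀ f ∈ liftEnds H, ∀ g ∈ liftEnds H, f * g = g * f := by
  rintro f ⟨a, ha, hf⟩ g ⟨b, hb, hg⟩
  refine LinearMap.ext fun x => ?_
  rw [Module.End.mul_apply, Module.End.mul_apply, hf, hg, hg, hf, mulVec_mulVec, mulVec_mulVec,
    h a b ha hb]

theorem ActsByMul.subConj {H : Subgroup PGL(3, K)} {A B : Type*} [CommRing A] [Algebra K A]
    [CommRing B] [Algebra K B] (h : ActsByMul (liftEnds H) A) (e : B ≃ₗ[K] (Fin 3 → K))
    (ψ : A ≃ₐ[K] B) : SubConj H (torus e) := by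
  obtain ⟨φ, hφ⟩ := h
  refine SubConj.trans_conj (H' := torus φ) ⟨1, ?_⟩ (torus_conj φ e ψ).symm
  rw [map_one, one_smul]
  intro x hx
  obtain ⟨g, rfl⟩ := mk_surjective x
  obtain ⟨a, ha⟩ := hφ _ (mem_liftEnds hx)
  exact mem_torus.2 ⟨a, fun x => by rw [← ha, Matrix.toLin'_apply]⟩

/-- A basis-free criterion for being conjugate into a group of matrices. -/
theorem subConj_of_basis {H H' : Subgroup PGL(3, K)} (b : Module.Basis (Fin 3) K (Fin 3 → K))
    (h : ∀ g : GL (Fin 3) K, mk g ∈ H → ∃ M : Matrix (Fin 3) (Fin 3) K,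
      (∀ i, g.val *ᵥ b i = ∑ j, M j i • b j) ∧
        ∀ g' : GL (Fin 3) K, g'.val = M → mk g' ∈ H') : SubConj H H' := by
  let P : GL (Fin 3) K := equivGL b.equivFun.symm
  have hP : ∀ v, P.val *ᵥ v = ∑ j, v j • b j := fun v => by
    rw [equivGL_mulVec, Module.Basis.equivFun_symm_apply]
  refine ⟨mk P, fun x hx => ?_⟩
  obtain ⟨g, rfl⟩ := mk_surjective x
  obtain ⟨M, hM, hM'⟩ := h g hx
  rw [mem_conj_iff, ← map_inv, ← map_mul, ← map_mul]
  apply hM'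
  refine matrix_ext_basis (Pi.basisFun K (Fin 3)) fun i => ?_
  rw [Units.val_mul, Units.val_mul, ← mulVec_mulVec, ← mulVec_mulVec, inv_mulVec_eq_iff, hP, hP,
    Pi.basisFun_apply]
  have : ∑ j, (Pi.single i (1 : K) : Fin 3 → K) j • b j = b i := by
    simp [Pi.single_apply, ite_smul]
  rw [this, hM]
  simp

theorem subConj_unipotent_of_sq_eq_zero {H : Subgroup PGL(3, K)} (hH : LiftsCommute H)
    (h : ∀ f ∈ liftEnds H, ∃ c, (f - algebraMap K (Module.End K (Fin 3 → K)) c) ^ 2 = 0) :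
    SubConj H (unipotentGroup 0 1) ∨ SubConj H (unipotentGroup 1 0) := by
  obtain ⟨b, hb | hb⟩ := exists_basis_of_sq_eq_zero (by simp) hH.liftEnds h
  · right
    refine subConj_of_basis b fun g hg => ?_
    obtain ⟨r, a, c, h0, h1, h2⟩ := hb _ (mem_liftEnds hg)
    rw [Matrix.toLin'_apply] at h0 h1 h2
    refine ⟨!![r, a * 1, c; 0, r, a * 0; 0, 0, r], fun i => ?_,
      fun g' hg' => mem_unipotentGroup.2 ⟨r, a, c, hg'⟩⟩
    fin_cases i
    · simp [Fin.sum_univ_three, h0]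
    · simp [Fin.sum_univ_three, h1]
    · simp [Fin.sum_univ_three, h2]
  · left
    refine subConj_of_basis b fun g hg => ?_
    obtain ⟨r, a, c, h0, h1, h2⟩ := hb _ (mem_liftEnds hg)
    rw [Matrix.toLin'_apply] at h0 h1 h2
    refine ⟨!![r, a * 0, c; 0, r, a * 1; 0, 0, r], fun i => ?_,
      fun g' hg' => mem_unipotentGroup.2 ⟨r, a, c, hg'⟩⟩
    fin_cases i
    · simp [Fin.sum_univ_three, h0]
    · simp [Fin.sum_univ_three, h1]
    · simp [Fin.sum_univ_three, h2]

variable (K) in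
/-- Functions on three points as an iterated product. -/
def prodPiThree : ((K × K) × K) ≃ₐ[K] (Fin 3 → K) where
  toFun x := ![x.1.1, x.1.2, x.2]
  invFun v := ((v 0, v 1), v 2)
  left_inv _ := rfl
  right_inv _ := by ext i; fin_cases i <;> rfl
  map_mul' _ _ := by ext i; fin_cases i <;> rfl
  map_add' _ _ := by ext i; fin_cases i <;> rfl
  commutes' _ := by ext i; fin_cases i <;> rfl

theorem units_eq_one_of_card_eq_two [Finite K] (h : Nat.card K = 2) {r : K} (hr : r ≠ 0) :
    r = 1 := by
  by_contra h1
  obtain ⟨x, y, hxy, huniv⟩ := Nat.card_eq_two_iff.1 h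
  have h0 := huniv.symm ▸ Set.mem_univ (0 : K)
  have h1' := huniv.symm ▸ Set.mem_univ (1 : K)
  have hr' := huniv.symm ▸ Set.mem_univ r
  have := zero_ne_one (α := K)
  simp only [Set.mem_insert_iff, Set.mem_singleton_iff] at h0 h1' hr'
  grind

/-- Over 𝔽₂ the block parameter r is 1, so the group consists of transvections. This and the
triviality of the diagonal group are why these two families are omitted for q = 2. -/
theorem blockGroup_le_of_card_eq_two [Finite K] (h : Nat.card K = 2) :
    blockGroup K ≤ unipotentGroup 1 0 := by
  refine Subgroup.map_mono ?_
  rintro g ⟨r, a, hr, hg⟩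
  rw [units_eq_one_of_card_eq_two h hr] at hg
  exact ⟨a, 0, by rw [hg]; simp⟩

theorem diagonalGroup_eq_bot_of_card_eq_two [Finite K] (h : Nat.card K = 2) :
    diagonalGroup K = ⊥ := by
  rw [← Subgroup.card_eq_one, card_diagonal, h]; norm_num

variable {L₂ L₃ : Type*} [Field L₂] [Field L₃] [Algebra K L₂] [Algebra K L₃]

theorem LiftsCommute.exists_subConj [Finite K] {H : Subgroup PGL(3, K)} (hH : LiftsCommute H)
    (hL₂ : Module.finrank K L₂ = 2) (hL₃ : Module.finrank K L₃ = 3)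
    (e₂ : (L₂ × K) ≃ₗ[K] (Fin 3 → K)) (e₃ : L₃ ≃ₗ[K] (Fin 3 → K)) (ω : K) :
    ∃ i : Family, i.Occurs K ∧ SubConj H (i.group e₂ e₃ ω) := by
  rcases actsByMul_of_finrank_eq_three hL₂ hL₃ (by simp) hH.liftEnds with h | h | h | h | h | h
  · exact ⟨.cubic, trivial, h.subConj e₃ AlgEquiv.refl⟩
  · exact ⟨.quadratic, trivial, h.subConj e₂ AlgEquiv.refl⟩
  · have hd : SubConj H (diagonalGroup K) := by
      rw [diagonalGroup_eq_torus]
      exact h.subConj _ (prodPiThree K)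
    by_cases hq : Nat.card K = 2
    · exact ⟨.cubic, trivial, hd.trans_le (by
        rw [diagonalGroup_eq_bot_of_card_eq_two hq]; exact bot_le)⟩
    · exact ⟨.diagonal, hq, hd⟩
  · have hd : SubConj H (blockGroup K) := by
      rw [blockGroup_eq_torus]
      exact h.subConj _ AlgEquiv.refl
    by_cases hq : Nat.card K = 2
    · exact ⟨.dualTranslation, trivial, hd.trans_le (blockGroup_le_of_card_eq_two hq)⟩
    · exact ⟨.block, hq, hd⟩
  · refine ⟨.unipotent, trivial, ?_⟩
    change SubConj H (unipotentGroup 1 1)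
    rw [unipotentGroup_eq_torus]
    exact h.subConj _ AlgEquiv.refl
  · exact (subConj_unipotent_of_sq_eq_zero hH h).elim (fun h => ⟨.translation, trivial, h⟩)
      fun h => ⟨.dualTranslation, trivial, h⟩

/-- The order 3 of c divides q − 1. -/
theorem card_mod_three_of_isPrimitiveRoot [Finite K] {c : K} (h : IsPrimitiveRoot c 3) :
    Nat.card K % 3 = 1 := by
  have := Fintype.ofFinite K
  have hc0 : c ≠ 0 := h.ne_zero (by norm_num)
  have h1 := h.dvd_of_pow_eq_one _ (FiniteField.pow_card_sub_one_eq_one c hc0)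
  have h2 := Fintype.one_lt_card (α := K)
  rw [Nat.card_eq_fintype_card]
  omega

/-- The normal form with h³ = 1 is excluded because it would make all determinants cubes. -/
theorem frobenius_stdPair [Finite K] {ω d₀ : K} (hω : IsPrimitiveRoot ω 3)
    (hd₀ : ∀ t, t ^ 3 ≠ d₀) (hL₃ : Module.finrank K L₃ = 3) (e₃ : L₃ ≃ₗ[K] (Fin 3 → K)) :
    StdPair (frobeniusGroup e₃) ω d₀ := by
  obtain ⟨hw, hc⟩ := frobenius_weyl hω hL₃ e₃
  exact (hw.stdPair hω hd₀).resolve_left fun h =>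
    hc (h.cubeDet (hω.ne_one (by norm_num)) (frobenius_comm hω e₃))

theorem HasWeylPair.exists_conj [Finite K] {H : Subgroup PGL(3, K)} (h : HasWeylPair H)
    (hH : IsMulCommutative H) (hL₃ : Module.finrank K L₃ = 3)
    (e₂ : (L₂ × K) ≃ₗ[K] (Fin 3 → K)) (e₃ : L₃ ≃ₗ[K] (Fin 3 → K)) (ω : K)
    (hω : Nat.card K % 3 = 1 → IsPrimitiveRoot ω 3) :
    ∃ i : Family, i.Occurs K ∧ IsConjSubgroup (i.group e₂ e₃ ω) H := by
  have hq : Nat.card K % 3 = 1 := by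
    obtain ⟨g, h, c, -, -, hr, hc⟩ := h
    exact card_mod_three_of_isPrimitiveRoot (isPrimitiveRoot_of_cube hr.cube hc)
  replace hω := hω hq
  have hω1 : ω ≠ 1 := hω.ne_one (by norm_num)
  obtain ⟨d₀, hd₀⟩ := exists_noncube hω
  rcases h.stdPair hω hd₀ with h | h
  · exact ⟨.heisenberg, hq, (heisenberg_stdPair hω).conj hω1 (heisenberg_comm hω) hH h⟩
  · exact ⟨.frobenius, hq,
      (frobenius_stdPair hω hd₀ hL₃ e₃).conj hω1 (frobenius_comm hω e₃) hH h⟩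

/-! ### Conjugacy invariants -/

theorem liftsCommute_torus {A : Type*} [CommRing A] [Algebra K A] (e : A ≃ₗ[K] (Fin 3 → K)) :
    LiftsCommute (torus e) := by
  intro g h hg hh
  obtain ⟨a, ha⟩ := mem_torus.1 hg
  obtain ⟨b, hb⟩ := mem_torus.1 hh
  refine GL_ext_mulVec e fun v => ?_
  rw [← mulVec_mulVec, ← mulVec_mulVec, hb, ha, ha, hb, mul_left_comm]

theorem liftsCommute_unipotentGroup (x y : K) : LiftsCommute (unipotentGroup x y) := by
  intro g h hg hh
  obtain ⟨r, a, b, hg⟩ := mem_unipotentGroup.1 hg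
  obtain ⟨s, c, d, hh⟩ := mem_unipotentGroup.1 hh
  rw [hg, hh]
  ext i j; fin_cases i <;> fin_cases j <;> simp [Matrix.mul_apply, Fin.sum_univ_three] <;> ring

theorem card_eq_of_isConjSubgroup {G : Type*} [Group G] {H H' : Subgroup G}
    (h : IsConjSubgroup H H') : Nat.card H = Nat.card H' := by
  obtain ⟨g, rfl⟩ := h
  exact Nat.card_congr (Subgroup.equivSMul (MulAut.conj g) H).toEquiv

/-- All representatives of elements are scalar plus square-zero. -/
def SqZeroLifts (H : Subgroup PGL(3, K)) : Prop :=
  ∀ g : GL (Fin 3) K, mk g ∈ H → ∃ c : K, (g.val - c • 1) * (g.val - c • 1) = 0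

theorem SqZeroLifts.conj {H H' : Subgroup PGL(3, K)} (h : SqZeroLifts H)
    (hc : IsConjSubgroup H H') : SqZeroLifts H' := by
  obtain ⟨x, rfl⟩ := hc
  obtain ⟨P, rfl⟩ := mk_surjective x
  intro g hg
  rw [mem_conj_iff, ← map_inv, ← map_mul, ← map_mul] at hg
  obtain ⟨c, hc⟩ := h _ hg
  have h1 : (P⁻¹ * g * P).val - c • 1 = P⁻¹.val * (g.val - c • 1) * P.val := by
    rw [Units.val_mul, Units.val_mul, mul_sub, sub_mul, mul_smul_comm, smul_mul_assoc, mul_one,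
      ← Units.val_mul P⁻¹ P, inv_mul_cancel, Units.val_one]
  refine ⟨c, ?_⟩
  rw [h1] at hc
  have h2 : P⁻¹.val * (g.val - c • 1) * P.val * (P⁻¹.val * (g.val - c • 1) * P.val) =
      P⁻¹.val * ((g.val - c • 1) * (g.val - c • 1)) * P.val := by
    simp only [mul_assoc]
    rw [Units.mul_inv_cancel_left]
  rw [h2, Units.mul_left_eq_zero, Units.mul_right_eq_zero] at hc
  exact hc

/-- There are two independent vectors, each multiplied by the same scalar by any given
representative of an element. -/
def FixesLine (H : Subgroup PGL(3, K)) : Prop :=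
  ∃ u w : Fin 3 → K, LinearIndependent K ![u, w] ∧
    ∀ g : GL (Fin 3) K, mk g ∈ H → ∃ r : K, g.val *ᵥ u = r • u ∧ g.val *ᵥ w = r • w

theorem FixesLine.conj {H H' : Subgroup PGL(3, K)} (h : FixesLine H)
    (hc : IsConjSubgroup H H') : FixesLine H' := by
  obtain ⟨x, rfl⟩ := hc
  obtain ⟨P, rfl⟩ := mk_surjective x
  obtain ⟨u, w, huw, h⟩ := h
  refine ⟨P.val *ᵥ u, P.val *ᵥ w, ?_, fun g hg => ?_⟩
  · rw [LinearIndependent.pair_iff] at huw ⊢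
    intro s t hst
    rw [← mulVec_smul, ← mulVec_smul, ← mulVec_add] at hst
    refine huw s t ?_
    have := inv_mulVec_eq_iff.2 hst.symm
    rw [← this, mulVec_zero]
  · rw [mem_conj_iff, ← map_inv, ← map_mul, ← map_mul] at hg
    obtain ⟨r, hu, hw⟩ := h _ hg
    rw [Units.val_mul, Units.val_mul, ← mulVec_mulVec, ← mulVec_mulVec, inv_mulVec_eq_iff,
      mulVec_smul] at hu hw
    exact ⟨r, hu, hw⟩

theorem sqZeroLifts_unipotentGroup {x y : K} (h : x * y = 0) : SqZeroLifts (unipotentGroup x y) := by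
  intro g hg
  obtain ⟨r, a, b, hg⟩ := mem_unipotentGroup.1 hg
  refine ⟨r, ?_⟩
  rw [hg]
  ext i j
  fin_cases i <;> fin_cases j <;> simp [Matrix.mul_apply, Fin.sum_univ_three]
  by_cases hx : x = 0
  · exact Or.inl (Or.inr hx)
  · exact Or.inr (Or.inr ((mul_eq_zero.1 h).resolve_left hx))

theorem exists_unipotent_lift (x y a b : K) : ∃ g : GL (Fin 3) K, mk g ∈ unipotentGroup x y ∧
    g.val = !![1, a * x, b; 0, 1, a * y; 0, 0, 1] := by
  have hdet : (!![1, a * x, b; 0, 1, a * y; 0, 0, 1] : Matrix (Fin 3) (Fin 3) K).det = 1 := by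
    rw [det_fin_three]; simp
  refine ⟨GeneralLinearGroup.mkOfDetNeZero _ (by rw [hdet]; exact one_ne_zero), ?_, rfl⟩
  exact mem_unipotentGroup.2 ⟨1, a, b, rfl⟩

theorem not_sqZeroLifts_unipotentGroup : ¬ SqZeroLifts (unipotentGroup (1 : K) 1) := by
  intro h
  -- For a = 1 the superdiagonal is (1, 1), so g − c has square with corner entry 1 whatever c is.
  obtain ⟨g, hg, hv⟩ := exists_unipotent_lift (1 : K) 1 1 0
  obtain ⟨c, hc⟩ := h g hg
  have := congrFun (congrFun hc 0) 2
  rw [hv] at this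
  simp [Matrix.mul_apply, Fin.sum_univ_three] at this

theorem fixesLine_translation : FixesLine (unipotentGroup (0 : K) 1) := by
  refine ⟨Pi.single 0 1, Pi.single 1 1, ?_, fun g hg => ?_⟩
  · rw [LinearIndependent.pair_iff]
    intro s t hst
    exact ⟨by simpa using congrFun hst 0, by simpa using congrFun hst 1⟩
  · obtain ⟨r, a, b, hg⟩ := mem_unipotentGroup.1 hg
    refine ⟨r, ?_, ?_⟩ <;> rw [hg] <;> ext i <;> fin_cases i <;> simp

/-- Two transvections, along the second and third coordinates, already leave only multiples of the
first basis vector as common eigenvectors. -/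
theorem not_fixesLine_dualTranslation : ¬ FixesLine (unipotentGroup (1 : K) 0) := by
  rintro ⟨u, w, huw, h⟩
  obtain ⟨g, hg, hgv⟩ := exists_unipotent_lift (1 : K) 0 1 0
  obtain ⟨g', hg', hgv'⟩ := exists_unipotent_lift (1 : K) 0 0 1
  obtain ⟨r, hu, hw⟩ := h g hg
  obtain ⟨r', hu', hw'⟩ := h g' hg'
  have key : ∀ v : Fin 3 → K, g.val *ᵥ v = r • v → g'.val *ᵥ v = r' • v → v 1 = 0 ∧ v 2 = 0 := by
    intro v hv hv'
    rw [hgv] at hv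
    rw [hgv'] at hv'
    have a0 := congrFun hv 0
    have a1 := congrFun hv 1
    have b0 := congrFun hv' 0
    have b2 := congrFun hv' 2
    simp [mulVec, dotProduct, Fin.sum_univ_three] at a0 a1 b0 b2
    constructor
    · by_contra h1
      have hr : r = 1 := mul_right_cancel₀ h1 (by rw [← a1, one_mul])
      rw [hr, one_mul] at a0
      exact h1 (by simpa using a0)
    · by_contra h1
      have hr : r' = 1 := mul_right_cancel₀ h1 (by rw [← b2, one_mul])
      rw [hr, one_mul] at b0
      exact h1 (by simpa using b0)
  obtain ⟨u1, u2⟩ := key u hu hu'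
  obtain ⟨w1, w2⟩ := key w hw hw'
  rw [LinearIndependent.pair_iff] at huw
  have h0 := huw (w 0) (-(u 0)) (by
    ext i; fin_cases i <;> simp [u1, u2, w1, w2]
    ring)
  have h1 := huw 1 0 (by
    ext i; fin_cases i <;> simp [u1, u2, neg_eq_zero.1 h0.2])
  exact one_ne_zero h1.1

theorem card_unipotent_of_mul_eq_zero {x y : K} (hxy : x * y = 0) (h : x ≠ 0 ∨ y ≠ 0) :
    Nat.card (unipotentGroup x y) = Nat.card K ^ 2 := by
  obtain ⟨φ⟩ := unipotent_equiv_prod hxy h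
  rw [Nat.card_congr (φ.toEquiv.trans Multiplicative.toAdd), Nat.card_prod, sq]

/-! ### The list of maximal abelian subgroups -/

section list

variable {L₂ L₃ : Type*} [Field L₂] [Field L₃] [Algebra K L₂] [Algebra K L₃]
  (e₂ : (L₂ × K) ≃ₗ[K] (Fin 3 → K)) (e₃ : L₃ ≃ₗ[K] (Fin 3 → K)) (ω : K)

/-- The two families whose groups have noncommuting representatives. -/
def Family.IsExceptional (i : Family) : Prop := i = .heisenberg ∨ i = .frobenius

theorem Family.liftsCommute_group {i : Family} (hi : ¬ i.IsExceptional) :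
    LiftsCommute (i.group e₂ e₃ ω) := by
  cases i
  · exact liftsCommute_torus _
  · exact liftsCommute_torus _
  · rw [Family.group, diagonalGroup_eq_torus]
    exact liftsCommute_torus _
  · rw [Family.group, blockGroup_eq_torus]
    exact liftsCommute_torus _
  · exact liftsCommute_unipotentGroup _ _
  · exact liftsCommute_unipotentGroup _ _
  · exact liftsCommute_unipotentGroup _ _
  · exact absurd (Or.inl rfl) hi
  · exact absurd (Or.inr rfl) hi

theorem Family.hasWeylPair_iff [Finite K] (hL₃ : Module.finrank K L₃ = 3)
    (hω : Nat.card K % 3 = 1 → IsPrimitiveRoot ω 3) {i : Family} (hi : i.Occurs K) :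
    HasWeylPair (i.group e₂ e₃ ω) ↔ i.IsExceptional := by
  refine ⟨fun h => ?_, ?_⟩
  · by_contra hi
    exact (Family.liftsCommute_group e₂ e₃ ω hi).not_hasWeylPair h
  · rintro (rfl | rfl)
    · exact (heisenberg_stdPair (hω hi)).hasWeylPair ((hω hi).ne_one (by norm_num))
    · exact (frobenius_weyl (hω hi) hL₃ e₃).1

theorem Family.maximal [Finite K] (hL₂ : Module.finrank K L₂ = 2)
    (hL₃ : Module.finrank K L₃ = 3) (hω : Nat.card K % 3 = 1 → IsPrimitiveRoot ω 3)
    {i : Family} (hi : i.Occurs K) :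
    IsMaximalAbelian (i.group e₂ e₃ ω) := by
  cases i
  · exact cubic_maximal hL₃ e₃
  · exact quadratic_maximal hL₂ e₂
  · exact diagonal_maximal hi
  · exact block_maximal hi
  · exact unipotentGroup_maximal (Or.inl one_ne_zero)
  · exact unipotentGroup_maximal (Or.inr one_ne_zero)
  · exact unipotentGroup_maximal (Or.inl one_ne_zero)
  · exact ((Family.hasWeylPair_iff e₂ e₃ ω hL₃ hω hi).2 (Or.inl rfl)).maximal
      (heisenberg_comm (hω hi))
  · exact ((Family.hasWeylPair_iff e₂ e₃ ω hL₃ hω hi).2 (Or.inr rfl)).maximal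
      (frobenius_comm (hω hi) e₃)

/-- Without a Weyl pair, H lies in a conjugate of a listed group, and maximality of H turns the
inclusion into equality. -/
theorem isMaximalAbelian_iff [Finite K] (hL₂ : Module.finrank K L₂ = 2)
    (hL₃ : Module.finrank K L₃ = 3) (hω : Nat.card K % 3 = 1 → IsPrimitiveRoot ω 3)
    (H : Subgroup PGL(3, K)) : IsMaximalAbelian H ↔
    ∃ i : Family, i.Occurs K ∧ IsConjSubgroup (i.group e₂ e₃ ω) H := by
  constructor
  · intro hH
    by_cases hw : HasWeylPair H
    · exact hw.exists_conj hH.1 hL₃ e₂ e₃ ω hω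
    · obtain ⟨i, hi, h⟩ := (liftsCommute_of_not_hasWeylPair hH.1 hw).exists_subConj hL₂ hL₃ e₂ e₃ ω
      exact ⟨i, hi, hH.conj_of_subConj (Family.maximal e₂ e₃ ω hL₂ hL₃ hω hi).1 h⟩
  · rintro ⟨i, hi, h⟩
    exact (Family.maximal e₂ e₃ ω hL₂ hL₃ hω hi).conj h

/-- The exceptional groups differ in whether determinants are cubes. Among the others, the orders
q²+q+1, q²−1, (q−1)², q(q−1), q² are distinct for q ≥ 2; the three groups of order q² are separated
by square-zero lifts and by the existence of a pointwise fixed line. -/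
theorem Family.eq_of_isConjSubgroup [Finite K] (hL₂ : Module.finrank K L₂ = 2)
    (hL₃ : Module.finrank K L₃ = 3) (hω : Nat.card K % 3 = 1 → IsPrimitiveRoot ω 3)
    {i j : Family} (hi : i.Occurs K) (hj : j.Occurs K)
    (h : IsConjSubgroup (i.group e₂ e₃ ω) (j.group e₂ e₃ ω)) : i = j := by
  have hiff : i.IsExceptional ↔ j.IsExceptional := by
    rw [← Family.hasWeylPair_iff e₂ e₃ ω hL₃ hω hi, ← Family.hasWeylPair_iff e₂ e₃ ω hL₃ hω hj]
    exact ⟨fun hw => hw.conj h, fun hw => hw.conj h.symm⟩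
  by_cases hex : i.IsExceptional
  · have hcube : ∀ hq : Nat.card K % 3 = 1, ¬ IsConjSubgroup (Family.group e₂ e₃ ω .heisenberg)
        (Family.group e₂ e₃ ω .frobenius) := fun hq h =>
      (frobenius_weyl (hω hq) hL₃ e₃).2 (((heisenberg_stdPair (hω hq)).cubeDet
        ((hω hq).ne_one (by norm_num)) (heisenberg_comm (hω hq))).conj h)
    rcases hex with rfl | rfl <;> rcases hiff.1 (by simp [IsExceptional]) with rfl | rfl
    · rfl
    · exact absurd h (hcube hi)
    · exact absurd h.symm (hcube hi)
    · rfl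
  · have hex' := mt hiff.2 hex
    have hcard := card_eq_of_isConjSubgroup h
    have hsq : SqZeroLifts (i.group e₂ e₃ ω) ↔ SqZeroLifts (j.group e₂ e₃ ω) :=
      ⟨fun hs => hs.conj h, fun hs => hs.conj h.symm⟩
    have hline : FixesLine (i.group e₂ e₃ ω) ↔ FixesLine (j.group e₂ e₃ ω) :=
      ⟨fun hs => hs.conj h, fun hs => hs.conj h.symm⟩
    have c1 : Nat.card (Family.group e₂ e₃ ω .cubic) = _ := card_cubic e₃ hL₃
    have c2 : Nat.card (Family.group e₂ e₃ ω .quadratic) = _ := card_quadratic e₂ hL₂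
    have c3 : Nat.card (Family.group e₂ e₃ ω .diagonal) = _ := card_diagonal
    have c4 : Nat.card (Family.group e₂ e₃ ω .block) = _ := card_block
    have c5 : Nat.card (Family.group e₂ e₃ ω .unipotent) = _ := card_unipotent
    have c6 : Nat.card (Family.group e₂ e₃ ω .translation) = _ :=
      card_unipotent_of_mul_eq_zero (zero_mul 1) (Or.inr one_ne_zero)
    have c7 : Nat.card (Family.group e₂ e₃ ω .dualTranslation) = _ :=
      card_unipotent_of_mul_eq_zero (mul_zero 1) (Or.inl one_ne_zero)
    have s5 : ¬ SqZeroLifts (Family.group e₂ e₃ ω .unipotent) := not_sqZeroLifts_unipotentGroup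
    have s6 : SqZeroLifts (Family.group e₂ e₃ ω .translation) :=
      sqZeroLifts_unipotentGroup (zero_mul 1)
    have s7 : SqZeroLifts (Family.group e₂ e₃ ω .dualTranslation) :=
      sqZeroLifts_unipotentGroup (mul_zero 1)
    have l6 : FixesLine (Family.group e₂ e₃ ω .translation) := fixesLine_translation
    have l7 : ¬ FixesLine (Family.group e₂ e₃ ω .dualTranslation) := not_fixesLine_dualTranslation
    -- With q = k + 2 all the orders become linear in k and k², so comparing them is linear
    -- arithmetic.
    obtain ⟨k, hk⟩ := Nat.exists_eq_add_of_le (Finite.one_lt_card (α := K))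
    have q1 : (1 + 1 + k) ^ 2 = k * k + 4 * k + 4 := by ring
    have q2 : (1 + k) ^ 2 = k * k + 2 * k + 1 := by ring
    have q3 : (1 + k) * (1 + 1 + k) = k * k + 3 * k + 2 := by ring
    have q4 : 1 + 1 + k - 1 = 1 + k := by omega
    simp only [Nat.succ_eq_add_one] at hk
    rw [hk] at c1 c2 c3 c4 c5 c6 c7
    rw [q1] at c1 c2 c5 c6 c7
    rw [q4] at c3 c4
    rw [q2] at c3
    rw [q3] at c4
    rw [IsExceptional, not_or] at hex hex'
    generalize k * k = m at *
    obtain ⟨n, hn⟩ : ∃ n : Family → ℕ, ∀ i, n i = Nat.card (i.group e₂ e₃ ω) :=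
      ⟨_, fun _ => rfl⟩
    obtain ⟨S, hS⟩ : ∃ S : Family → Prop, ∀ i, S i ↔ SqZeroLifts (i.group e₂ e₃ ω) :=
      ⟨_, fun _ => Iff.rfl⟩
    obtain ⟨F, hF⟩ : ∃ F : Family → Prop, ∀ i, F i ↔ FixesLine (i.group e₂ e₃ ω) :=
      ⟨_, fun _ => Iff.rfl⟩
    rw [← hn] at c1 c2 c3 c4 c5 c6 c7
    rw [← hn, ← hn] at hcard
    rw [← hS] at s5 s6 s7
    rw [← hS, ← hS] at hsq
    rw [← hF] at l6 l7
    rw [← hF, ← hF] at hline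
    clear hn hS hF
    cases i <;> first
      | exact absurd rfl hex.1
      | exact absurd rfl hex.2
      | skip
    all_goals cases j <;> first
      | rfl
      | exact absurd rfl hex'.1
      | exact absurd rfl hex'.2
      | skip
    all_goals first
      | omega
      | exact absurd (hsq.2 s6) s5
      | exact absurd (hsq.2 s7) s5
      | exact absurd (hsq.1 s6) s5
      | exact absurd (hsq.1 s7) s5
      | exact absurd (hline.1 l6) l7
      | exact absurd (hline.2 l6) l7

end list

end DesarguesSidon

open DesarguesSidon in
theorem proposition3p1 {K : Type*} [Field K] [Finite K]
    -- a quadratic and a cubic extension of `K`, with identifications `L₂ × K ≅ K³ ≅ L₃`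
    {L₂ L₃ : Type*} [Field L₂] [Field L₃] [Algebra K L₂] [Algebra K L₃]
    (hL₂ : Module.finrank K L₂ = 2) (hL₃ : Module.finrank K L₃ = 3)
    (e₂ : (L₂ × K) ≃ₗ[K] (Fin 3 → K)) (e₃ : L₃ ≃ₗ[K] (Fin 3 → K))
    -- if `q ≡ 1 mod 3`, a primitive cube root of unity in `K`
    (ω : K) (hω : Nat.card K % 3 = 1 → IsPrimitiveRoot ω 3) :
    -- the maximal abelian subgroups are exactly the conjugates of the groups listed
    (∀ H : Subgroup PGL(3, K), IsMaximalAbelian H ↔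
      ∃ i : Family, i.Occurs K ∧ IsConjSubgroup (i.group e₂ e₃ ω) H) ∧
    -- the list has no repetitions
    (∀ i j : Family, i.Occurs K → j.Occurs K →
      IsConjSubgroup (i.group e₂ e₃ ω) (j.group e₂ e₃ ω) → i = j) ∧
    -- isomorphism types
    (IsCyclic (torus e₃) ∧ Nonempty (torus e₃ ≃* UnitsMod K L₃)) ∧
    Nonempty (torus e₂ ≃* L₂ˣ) ∧
    Nonempty (diagonalGroup K ≃* Kˣ × Kˣ) ∧
    Nonempty (blockGroup K ≃* Kˣ × Multiplicative K) ∧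
    ((Odd (Nat.card K) → Nonempty (unipotentGroup (1 : K) 1 ≃* Multiplicative (K × K))) ∧
      ∀ d : ℕ, Nat.card K = 2 ^ d →
        Nonempty (unipotentGroup (1 : K) 1 ≃* Multiplicative (Fin d → ZMod 4))) ∧
    Nonempty (unipotentGroup (0 : K) 1 ≃* Multiplicative (K × K)) ∧
    Nonempty (unipotentGroup (1 : K) 0 ≃* Multiplicative (K × K)) ∧
    (Nat.card K % 3 = 1 →
      Nonempty (heisenbergGroup ω ≃* Multiplicative (ZMod 3 × ZMod 3)) ∧
      Nonempty (frobeniusGroup e₃ ≃* Multiplicative (ZMod 3 × ZMod 3))) ∧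
    -- the Sidon sets obtained from the first five groups
    (∀ D : Submodule K L₃, Module.finrank K D = 2 →
      SomePairYields (torus e₃) (fun S => SameUpToIso S (singer D)) ∧
      EveryPairYields (torus e₃) (fun S => SameUpToIso S (singer D))) ∧
    (∀ (D : Submodule K L₂) (u : L₂), Module.finrank K D = 1 → u ∉ D →
      SomePairYields (torus e₂) (fun S => SameUpToIso S (bose D u)) ∧
      (Nat.card K ≠ 2 → EveryPairYields (torus e₂) (fun S => SameUpToIso S (bose D u)))) ∧
    (SomePairYields (diagonalGroup K) (fun S => SameUpToIso S (hughes K)) ∧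
      (Nat.card K ≠ 2 →
        EveryPairYields (diagonalGroup K) (fun S => SameUpToIso S (hughes K)))) ∧
    (SomePairYields (blockGroup K) (fun S => SameUpToIso S (spence K)) ∧
      (Nat.card K ≠ 2 →
        EveryPairYields (blockGroup K) (fun S => SameUpToIso S (spence K)))) ∧
    (Odd (Nat.card K) →
      SomePairYields (unipotentGroup (1 : K) 1) (fun S => SameUpToIso S (erdosTuran K)) ∧
      EveryPairYields (unipotentGroup (1 : K) 1) (fun S => SameUpToIso S (erdosTuran K))) ∧
    (Even (Nat.card K) →
      SomePairYields (unipotentGroup (1 : K) 1) (fun S => S.ncard = Nat.card K) ∧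
      EveryPairYields (unipotentGroup (1 : K) 1) (fun S => S.ncard = Nat.card K)) := by
  have : FiniteDimensional K L₃ := Module.finite_of_finrank_pos (by omega)
  have : Finite L₃ := Module.finite_of_finite K
  refine ⟨isMaximalAbelian_iff e₂ e₃ ω hL₂ hL₃ hω,
    fun i j hi hj h => Family.eq_of_isConjSubgroup e₂ e₃ ω hL₂ hL₃ hω hi hj h,
    ⟨cubic_isCyclic e₃, cubic_equiv e₃⟩, quadratic_equiv e₂, diagonal_equiv, block_equiv,
    ⟨unipotent_equiv_of_odd, fun d hd => unipotent_equiv_of_card_two_pow hd⟩,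
    unipotent_equiv_prod (zero_mul 1) (Or.inr one_ne_zero),
    unipotent_equiv_prod (mul_zero 1) (Or.inl one_ne_zero), fun hq => ⟨?_, ?_⟩,
    fun D hD => cubic_pairs e₃ hL₃ D hD, fun D u hD hu => quadratic_pairs e₂ hL₂ D u hD hu,
    diagonal_pairs, block_pairs, unipotent_pairs_of_odd, fun _ => unipotent_pairs_ncard⟩
  · exact ((Family.hasWeylPair_iff e₂ e₃ ω hL₃ hω (i := .heisenberg) hq).2 (Or.inl rfl)).equiv
      (heisenberg_comm (hω hq))
  · exact ((Family.hasWeylPair_iff e₂ e₃ ω hL₃ hω (i := .frobenius) hq).2 (Or.inr rfl)).equiv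
      (frobenius_comm (hω hq) e₃)
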